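/- **Setting.** Let $G$ be a second countable, Hausdorff, locally compact abelian group (written additively) with a discrete cocompact subgroup $N$. All Hilbert spaces are complex, separable and nonzero. ${\rm U}(\mathcal H)$ carries the strong operator topology, ${\rm PU}(\mathcal H)={\rm U}(\mathcal H)/{\rm U}(1)$ the quotient topology, ${\rm Ad}:{\rm U}(\mathcal H)\to{\rm PU}(\mathcal H)$ is the quotient map, and for $v={\rm Ad}(V)$, $U\in{\rm U}(\mathcal H)$ we write $v[U]=VUV^{-1}$. Let $\Gamma$ be a finite group and $\chi:\Gamma\to G/N$ a homomorphism. **Dynamical triples.** A dynamical triple $(\chi,\lambda,\mu)$ with underlying Hilbert space $\mathcal H$ consists of continuous maps $\lambda:\Gamma\times G/N\to{\rm PU}(\mathcal H)$ and $\mu:G\times G/N\to{\rm PU}(\mathcal H)$ with $$\lambda(ba,z)=\lambda(b,z+\chi(a))\lambda(a,z),\quad \mu(g+h,z)=\mu(g,z+hN)\mu(h,z),\quad \lambda(a,z+gN)\mu(g,z)=\mu(g,z+\chi(a))\lambda(a,z).$$ These data are commuting actions of $\Gamma$ and $G$ on the bundle $G/N\times{\rm PU}(\mathcal H)\to G/N$,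 via $a\cdot(z,U)=(z+\chi(a),\lambda(a,z)U)$ and $g\cdot(z,U)=(z+gN,\mu(g,z)U)$. An isomorphism of triples over $\mathcal H$ and $\mathcal K$ is given by a unitary isomorphism $w:\mathcal H\to\mathcal K$, an element $z_0\in G/N$ and a continuous $v:G/N\to{\rm PU}(\mathcal K)$ such that $(z,U)\mapsto(z+z_0,v(z)\,wUw^{-1})$ is $\Gamma\times G$-equivariant. Put $\nu(a,g,z)=\lambda(a,z+gN)\mu(g,z)$ and $z\cdot(a,g)=z+\chi(a)+gN$. Two triples are outer conjugate if they are isomorphic to triples over one Hilbert space whose joint cocycles satisfy $\nu'=\nu\,{\rm Ad}(n)$ for a continuous $n:\Gamma\times G\times G/N\to{\rm U}(\mathcal H)$ with $n(yx,z)=\nu(x,z)^{-1}[n(y,z\cdot x)]\,n(x,z)$; they are stably outer conjugate if they become outer conjugate after tensoring both with the trivial triple on some Hilbert space $\mathcal H_0$. A triple is dualisable if its Mackey obstruction vanishes. That is, for a Borel lift $\overline\mu:G\to L^\infty(G/N,{\rm U}(\mathcal H))$ of $\mu$ (weak operator topology), the ${\rm U}(1)$-valued cocycle $\omega$ defined by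 $\overline\mu(h,z+gN)\overline\mu(g,z)=\overline\mu(g+h,z)\omega(g,h,z)$ is trivial in $H^2_{\rm Bor}(G,L^\infty(G/N,{\rm U}(1)))$. Let ${\rm Dyn}^\dagger(\Gamma,\chi)$ be the set of stable outer conjugation classes of dualisable triples with this $\chi$. **Cohomology.** Let $M_\chi=C(G/N,{\rm U}(1))$ with the compact-open topology, on which $(a,g)\in\Gamma\times G$ acts by shifting the argument by $-\chi(a)-gN$. Let $C^{k,l}$ be the group of continuous maps $\Gamma^k\times G^l\to M_\chi$, with boundary operators $\delta_\chi$ (for $\Gamma$) and $d$ (for $G$), both given by $$(\delta m)(a_0,\dots,a_n)=a_0^{-1}m(a_1,\dots,a_n)-m(a_1a_0,a_2,\dots,a_n)+\dots+(-1)^n m(a_0,\dots,a_na_{n-1})+(-1)^{n+1}m(a_0,\dots,a_{n-1}).$$ Let $H^\bullet_{\rm cont}(\Gamma,G,M_\chi)$ be the cohomology of the total complex with boundary $d+(-1)^l\delta_\chi$ on $C^{k,l}$. Let $H^{2,\dagger}_{\rm cont}(\Gamma,G,M_\chi)$ be the kernel of the forgetful map $H^2_{\rm cont}(\Gamma,G,M_\chi)\to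 H^2_{\rm cont}(G,C(G/N,{\rm U}(1)))$, $[\psi,\phi,\omega]\mapsto[\omega]$. **Theorem.** For every finite group $\Gamma$ and every homomorphism $\chi:\Gamma\to G/N$, the tensor product of triples makes ${\rm Dyn}^\dagger(\Gamma,\chi)$ an abelian group, and there is an isomorphism of groups $${\rm Dyn}^\dagger(\Gamma,\chi)\;\cong\;H^{2,\dagger}_{\rm cont}(\Gamma,G,M_\chi).$$ It is natural with respect to pullback along homomorphisms $f:\Gamma'\to\Gamma$ of finite groups (with $\chi'=\chi\circ f$). It has the following values: if $(\chi,\lambda,\mu)$ is dualisable and has continuous unitary lifts $\overline\lambda,\overline\mu$ with $\overline\mu(g+h,z)=\overline\mu(h,z+gN)\overline\mu(g,z)$, and continuous ${\rm U}(1)$-valued $\psi,\phi$ are given by $$\overline\lambda(b,z+\chi(a))\overline\lambda(a,z)=\overline\lambda(ba,z)\psi(a,b,z),\qquad \overline\lambda(a,z+gN)\overline\mu(g,z)=\overline\mu(g,z+\chi(a))\overline\lambda(a,z)\phi(a,g,z),$$ then $(\psi,\phi,1)$ is a total 2-cocycle and the class of the triple is sent to $[\psi,\phi,1]$. The same holds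 in the dual setting: let $\widehat G={\rm Hom}(G,{\rm U}(1))$ be the dual group and $N^\perp=\{\hat g\in\widehat G : \hat g|_N=1\}$. Then for every finite group $\Gamma$ and homomorphism $\hat\chi:\Gamma\to\widehat G/N^\perp$, the group $\widehat{\rm Dyn}^\dagger(\Gamma,\hat\chi)$ of stable outer conjugation classes of dualisable dual dynamical triples (same definitions with $\widehat G,N^\perp,\hat\chi$ in place of $G,N,\chi$) is isomorphic to $H^{2,\dagger}_{\rm cont}(\Gamma,\widehat G,M_{\hat\chi})$, with $M_{\hat\chi}=C(\widehat G/N^\perp,{\rm U}(1))$, with the same naturality and values. -/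

import Mathlib

universe u

open MeasureTheory TensorProduct UniformSpace

namespace EquivTriples

noncomputable section

/-! ### Hilbert space tensor products -/

section HilbertTensor

/-- The Hilbert space tensor product: the completion of the algebraic tensor product. -/
abbrev HTensor (H K : Type u) [NormedAddCommGroup H] [InnerProductSpace ℂ H]
    [NormedAddCommGroup K] [InnerProductSpace ℂ K] : Type u :=
  Completion (H ⊗[ℂ] K)

variable {H K L H' K' H'' K'' : Type u}
  [NormedAddCommGroup H] [InnerProductSpace ℂ H] [NormedAddCommGroup K] [InnerProductSpace ℂ K]
  [NormedAddCommGroup L] [InnerProductSpace ℂ L]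
  [NormedAddCommGroup H'] [InnerProductSpace ℂ H'] [NormedAddCommGroup K'] [InnerProductSpace ℂ K']
  [NormedAddCommGroup H''] [InnerProductSpace ℂ H'']
  [NormedAddCommGroup K''] [InnerProductSpace ℂ K'']

/-- The elementary tensor `x ⊗ y` in the Hilbert space tensor product. -/
def htmul (x : H) (y : K) : HTensor H K := ((x ⊗ₜ[ℂ] y : H ⊗[ℂ] K) : Completion (H ⊗[ℂ] K))

theorem denseRange_toCompl (E : Type u) [NormedAddCommGroup E] [InnerProductSpace ℂ E] :
    DenseRange (Completion.toComplₗᵢ (𝕜 := ℂ) (E := E)).toLinearMap :=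
  Completion.denseRange_coe

/-- The tensor product `f ⊗ g` of two unitary isomorphisms. -/
def unitaryTensor (f : H ≃ₗᵢ[ℂ] H') (g : K ≃ₗᵢ[ℂ] K') : HTensor H K ≃ₗᵢ[ℂ] HTensor H' K' :=
  (TensorProduct.congrIsometry f g).toLinearEquiv.extendOfIsometry
    (Completion.toComplₗᵢ (𝕜 := ℂ) (E := H ⊗[ℂ] K)).toLinearMap
    (Completion.toComplₗᵢ (𝕜 := ℂ) (E := H' ⊗[ℂ] K')).toLinearMap
    (denseRange_toCompl _) (denseRange_toCompl _)
    (fun x => by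
      change ‖((TensorProduct.congrIsometry f g x : H' ⊗[ℂ] K') : Completion (H' ⊗[ℂ] K'))‖ =
        ‖((x : H ⊗[ℂ] K) : Completion (H ⊗[ℂ] K))‖
      rw [Completion.norm_coe, Completion.norm_coe, LinearIsometryEquiv.norm_map])

@[simp]
theorem unitaryTensor_coe (f : H ≃ₗᵢ[ℂ] H') (g : K ≃ₗᵢ[ℂ] K') (t : H ⊗[ℂ] K) :
    unitaryTensor f g (t : Completion (H ⊗[ℂ] K)) =
      ((TensorProduct.congrIsometry f g t : H' ⊗[ℂ] K') : Completion (H' ⊗[ℂ] K')) :=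
  LinearEquiv.extendOfIsometry_eq _ _ _ _ _ _ _

@[simp]
theorem unitaryTensor_htmul (f : H ≃ₗᵢ[ℂ] H') (g : K ≃ₗᵢ[ℂ] K') (x : H) (y : K) :
    unitaryTensor f g (htmul x y) = htmul (f x) (g y) := by
  simp [htmul]

/-- Two unitary isomorphisms that agree on elementary tensors are equal. -/
theorem unitary_ext {M : Type u} [NormedAddCommGroup M] [InnerProductSpace ℂ M]
    {f g : HTensor H K ≃ₗᵢ[ℂ] M} (h : ∀ x y, f (htmul x y) = g (htmul x y)) : f = g := by
  ext t
  refine Completion.induction_on t (isClosed_eq f.continuous g.continuous) (fun a => ?_)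
  induction a using TensorProduct.induction_on with
  | zero => rw [Completion.coe_zero, map_zero, map_zero]
  | tmul x y => exact h x y
  | add a b ha hb => simp only [Completion.coe_add, map_add, ha, hb]

theorem unitaryTensor_refl :
    unitaryTensor (LinearIsometryEquiv.refl ℂ H) (LinearIsometryEquiv.refl ℂ K) =
      LinearIsometryEquiv.refl ℂ (HTensor H K) :=
  unitary_ext fun x y => by simp

theorem unitaryTensor_trans (f : H ≃ₗᵢ[ℂ] H') (g : K ≃ₗᵢ[ℂ] K')
    (f' : H' ≃ₗᵢ[ℂ] H'') (g' : K' ≃ₗᵢ[ℂ] K'') :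
    (unitaryTensor f g).trans (unitaryTensor f' g') =
      unitaryTensor (f.trans f') (g.trans g') :=
  unitary_ext fun x y => by simp

theorem unitaryTensor_mul (f f' : H ≃ₗᵢ[ℂ] H) (g g' : K ≃ₗᵢ[ℂ] K) :
    unitaryTensor (f * f') (g * g') = unitaryTensor f g * unitaryTensor f' g' :=
  unitary_ext fun x y => by simp

theorem unitaryTensor_one :
    unitaryTensor (1 : H ≃ₗᵢ[ℂ] H) (1 : K ≃ₗᵢ[ℂ] K) = 1 := unitaryTensor_refl

theorem denseRange_map {f : H →ₗᵢ[ℂ] H'} {g : K →ₗᵢ[ℂ] K'} (hf : DenseRange f)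
    (hg : DenseRange g) : DenseRange (TensorProduct.mapIsometry f g) := by
  intro t
  induction t using TensorProduct.induction_on with
  | zero => exact subset_closure ⟨0, map_zero _⟩
  | tmul x y =>
    have h : DenseRange fun p : H × K => ((f p.1, g p.2) : H' × K') := hf.prodMap hg
    refine map_mem_closure (f := fun p : H' × K' => p.1 ⊗ₜ[ℂ] p.2)
      TensorProduct.continuous_tmul (h (x, y)) ?_
    rintro _ ⟨p, rfl⟩
    exact ⟨p.1 ⊗ₜ p.2, by simp⟩
  | add a b ha hb =>
    refine map_mem_closure₂ continuous_add ha hb ?_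
    rintro _ ⟨x, rfl⟩ _ ⟨y, rfl⟩
    exact ⟨x + y, map_add _ _ _⟩

/-- Commutativity of the Hilbert space tensor product. -/
def tensorComm (H K : Type u) [NormedAddCommGroup H] [InnerProductSpace ℂ H]
    [NormedAddCommGroup K] [InnerProductSpace ℂ K] : HTensor H K ≃ₗᵢ[ℂ] HTensor K H :=
  (TensorProduct.commIsometry ℂ H K).toLinearEquiv.extendOfIsometry
    (Completion.toComplₗᵢ (𝕜 := ℂ) (E := H ⊗[ℂ] K)).toLinearMap
    (Completion.toComplₗᵢ (𝕜 := ℂ) (E := K ⊗[ℂ] H)).toLinearMap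
    (denseRange_toCompl _) (denseRange_toCompl _) (fun x => by
      change ‖((TensorProduct.commIsometry ℂ H K x : K ⊗[ℂ] H) : Completion (K ⊗[ℂ] H))‖ =
        ‖((x : H ⊗[ℂ] K) : Completion (H ⊗[ℂ] K))‖
      rw [Completion.norm_coe, Completion.norm_coe, LinearIsometryEquiv.norm_map])

/-- The isometric inclusion of the algebraic triple tensor product, bracketed to the left. -/
def inclLeft (H K L : Type u) [NormedAddCommGroup H] [InnerProductSpace ℂ H]
    [NormedAddCommGroup K] [InnerProductSpace ℂ K]
    [NormedAddCommGroup L] [InnerProductSpace ℂ L] :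
    (H ⊗[ℂ] K) ⊗[ℂ] L →ₗᵢ[ℂ] HTensor (HTensor H K) L :=
  Completion.toComplₗᵢ.comp
    (TensorProduct.mapIsometry Completion.toComplₗᵢ LinearIsometry.id)

/-- The isometric inclusion of the algebraic triple tensor product, bracketed to the right. -/
def inclRight (H K L : Type u) [NormedAddCommGroup H] [InnerProductSpace ℂ H]
    [NormedAddCommGroup K] [InnerProductSpace ℂ K]
    [NormedAddCommGroup L] [InnerProductSpace ℂ L] :
    H ⊗[ℂ] (K ⊗[ℂ] L) →ₗᵢ[ℂ] HTensor H (HTensor K L) :=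
  Completion.toComplₗᵢ.comp
    (TensorProduct.mapIsometry LinearIsometry.id Completion.toComplₗᵢ)

theorem denseRange_inclLeft : DenseRange (inclLeft H K L) :=
  Completion.denseRange_coe.comp
    (denseRange_map Completion.denseRange_coe Function.surjective_id.denseRange)
    (Completion.continuous_coe _)

theorem denseRange_inclRight : DenseRange (inclRight H K L) :=
  Completion.denseRange_coe.comp
    (denseRange_map Function.surjective_id.denseRange Completion.denseRange_coe)
    (Completion.continuous_coe _)

/-- Associativity of the Hilbert space tensor product. -/
def tensorAssoc (H K L : Type u) [NormedAddCommGroup H] [InnerProductSpace ℂ H]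
    [NormedAddCommGroup K] [InnerProductSpace ℂ K]
    [NormedAddCommGroup L] [InnerProductSpace ℂ L] :
    HTensor (HTensor H K) L ≃ₗᵢ[ℂ] HTensor H (HTensor K L) :=
  (TensorProduct.assocIsometry ℂ H K L).toLinearEquiv.extendOfIsometry
    (inclLeft H K L).toLinearMap (inclRight H K L).toLinearMap
    denseRange_inclLeft denseRange_inclRight (fun x => by
      change ‖inclRight H K L (TensorProduct.assocIsometry ℂ H K L x)‖ = ‖inclLeft H K L x‖
      rw [LinearIsometry.norm_map, LinearIsometry.norm_map, LinearIsometryEquiv.norm_map])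

theorem tensorComm_htmul (x : H) (y : K) : tensorComm H K (htmul x y) = htmul y x :=
  LinearEquiv.extendOfIsometry_eq _ _ _ _ _ _ _

theorem tensorAssoc_htmul (x : H) (y : K) (z : L) :
    tensorAssoc H K L (htmul (htmul x y) z) = htmul x (htmul y z) :=
  LinearEquiv.extendOfIsometry_eq (TensorProduct.assocIsometry ℂ H K L).toLinearEquiv
    (inclLeft H K L).toLinearMap (inclRight H K L).toLinearMap
    denseRange_inclLeft denseRange_inclRight _ ((x ⊗ₜ y) ⊗ₜ z)

theorem unitary_ext₃ {M : Type u} [NormedAddCommGroup M] [InnerProductSpace ℂ M]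
    {f g : HTensor (HTensor H K) L ≃ₗᵢ[ℂ] M}
    (h : ∀ x y z, f (htmul (htmul x y) z) = g (htmul (htmul x y) z)) : f = g := by
  ext t
  refine congrFun (DenseRange.equalizer denseRange_inclLeft f.continuous g.continuous ?_) t
  funext a
  change f (inclLeft H K L a) = g (inclLeft H K L a)
  induction a using TensorProduct.induction_on with
  | zero => rw [LinearIsometry.map_zero, LinearIsometryEquiv.map_zero,
      LinearIsometryEquiv.map_zero]
  | tmul a z =>
    induction a using TensorProduct.induction_on with
    | zero => rw [TensorProduct.zero_tmul, LinearIsometry.map_zero, LinearIsometryEquiv.map_zero,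
        LinearIsometryEquiv.map_zero]
    | tmul x y => exact h x y z
    | add a b ha hb => simp only [TensorProduct.add_tmul, map_add, ha, hb]
  | add a b ha hb => simp only [map_add, ha, hb]

instance [TopologicalSpace.SeparableSpace H] [TopologicalSpace.SeparableSpace K] :
    TopologicalSpace.SeparableSpace (H ⊗[ℂ] K) := by
  have hs : TopologicalSpace.IsSeparable
      (Submodule.span ℂ (Set.range fun p : H × K => p.1 ⊗ₜ[ℂ] p.2) : Set (H ⊗[ℂ] K)) :=
    (TopologicalSpace.isSeparable_range TensorProduct.continuous_tmul).span
  have ht : (Submodule.span ℂ (Set.range fun p : H × K => p.1 ⊗ₜ[ℂ] p.2) : Set (H ⊗[ℂ] K))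
      = Set.univ := by
    have := TensorProduct.span_tmul_eq_top ℂ H K
    rw [← Submodule.top_coe (R := ℂ), ← this]
    congr 2
    ext t
    simp
  rw [ht] at hs
  exact TopologicalSpace.isSeparable_univ_iff.mp hs

instance [Nontrivial H] [Nontrivial K] : Nontrivial (HTensor H K) := by
  obtain ⟨x, hx⟩ := exists_ne (0 : H)
  obtain ⟨y, hy⟩ := exists_ne (0 : K)
  refine ⟨⟨htmul x y, 0, fun h => ?_⟩⟩
  have h1 : ‖htmul x y‖ = ‖x‖ * ‖y‖ := by simp [htmul]
  rw [h, norm_zero] at h1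
  rcases mul_eq_zero.mp h1.symm with h2 | h2
  · exact hx (norm_eq_zero.mp h2)
  · exact hy (norm_eq_zero.mp h2)

end HilbertTensor

/-! ### Unitary and projective unitary groups -/

section Unitary

variable {H K L : Type u}
  [NormedAddCommGroup H] [InnerProductSpace ℂ H] [NormedAddCommGroup K] [InnerProductSpace ℂ K]
  [NormedAddCommGroup L] [InnerProductSpace ℂ L]

/-- The unitary group `U(H)`. -/
abbrev UnitaryGp (H : Type u) [NormedAddCommGroup H] [InnerProductSpace ℂ H] : Type u := H ≃ₗᵢ[ℂ] H

/-- The strong operator topology on `U(H)`. -/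
instance : TopologicalSpace (UnitaryGp H) :=
  TopologicalSpace.induced (fun (U : UnitaryGp H) (x : H) => U x) inferInstance

theorem continuous_unitary_apply (x : H) : Continuous fun U : UnitaryGp H => U x :=
  (continuous_apply x).comp continuous_induced_dom

theorem continuous_unitary_iff {X : Type*} [TopologicalSpace X] {f : X → UnitaryGp H} :
    Continuous f ↔ ∀ x, Continuous fun t => f t x :=
  continuous_induced_rng.trans continuous_pi_iff

theorem continuous_unitary_eval : Continuous fun p : UnitaryGp H × H => p.1 p.2 := by
  rw [continuous_iff_continuousAt]
  rintro ⟨U, x⟩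
  rw [ContinuousAt, tendsto_iff_dist_tendsto_zero]
  have h1 : Filter.Tendsto (fun p : UnitaryGp H × H => dist p.2 x + dist (p.1 x) (U x))
      (nhds (U, x)) (nhds 0) := by
    have : Continuous fun p : UnitaryGp H × H => dist p.2 x + dist (p.1 x) (U x) :=
      (continuous_snd.dist continuous_const).add
        (((continuous_unitary_apply x).comp continuous_fst).dist continuous_const)
    simpa using this.tendsto (U, x)
  refine squeeze_zero (fun _ => dist_nonneg) (fun p => ?_) h1
  calc dist (p.1 p.2) (U x) ≤ dist (p.1 p.2) (p.1 x) + dist (p.1 x) (U x) := dist_triangle _ _ _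
    _ = _ := by rw [p.1.dist_map]

instance : IsTopologicalGroup (UnitaryGp H) where
  continuous_mul := continuous_unitary_iff.mpr fun x =>
    continuous_unitary_eval.comp
      (continuous_fst.prodMk ((continuous_unitary_apply x).comp continuous_snd))
  continuous_inv := continuous_unitary_iff.mpr fun x => by
    rw [continuous_iff_continuousAt]
    intro U
    rw [ContinuousAt, tendsto_iff_dist_tendsto_zero]
    have h1 : Filter.Tendsto (fun V : UnitaryGp H => dist (V (U⁻¹ x)) (U (U⁻¹ x)))
        (nhds U) (nhds 0) := by
      have : Continuous fun V : UnitaryGp H => dist (V (U⁻¹ x)) (U (U⁻¹ x)) :=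
        (continuous_unitary_apply _).dist continuous_const
      simpa using this.tendsto U
    refine h1.congr (fun V => ?_)
    rw [← V.dist_map (V⁻¹ x) (U⁻¹ x), dist_comm]
    congr 1
    · exact (LinearIsometryEquiv.apply_symm_apply U x).trans
        (LinearIsometryEquiv.apply_symm_apply V x).symm

/-- The inclusion of the scalars `U(1)` into `U(H)`. -/
def scalar (H : Type u) [NormedAddCommGroup H] [InnerProductSpace ℂ H] : Circle →* UnitaryGp H where
  toFun c := { DistribMulAction.toLinearEquiv ℂ H c with
    norm_map' := fun x => by
      change ‖c • x‖ = ‖x‖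
      rw [Circle.smul_def, norm_smul, Circle.norm_coe, one_mul] }
  map_one' := by ext x; exact one_smul Circle x
  map_mul' c d := by ext x; exact mul_smul c d x

@[simp]
theorem scalar_apply (c : Circle) (x : H) : scalar H c x = (c : ℂ) • x := rfl

theorem scalar_comm (c : Circle) (U : UnitaryGp H) : U * scalar H c = scalar H c * U := by
  ext x; simp

/-- The subgroup `U(1)` of scalars in `U(H)`. -/
def scalars (H : Type u) [NormedAddCommGroup H] [InnerProductSpace ℂ H] : Subgroup (UnitaryGp H) :=
  (scalar H).range

instance : (scalars H).Normal where
  conj_mem := by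
    rintro _ ⟨c, rfl⟩ U
    exact ⟨c, by rw [scalar_comm, mul_inv_cancel_right]⟩

/-- The projective unitary group `PU(H) = U(H)/U(1)` with the quotient topology. -/
abbrev PU (H : Type u) [NormedAddCommGroup H] [InnerProductSpace ℂ H] : Type u :=
  UnitaryGp H ⧸ scalars H

/-- The quotient map `Ad : U(H) → PU(H)`. -/
def Ad : UnitaryGp H →* PU H := QuotientGroup.mk' (scalars H)

theorem Ad_surjective : Function.Surjective (Ad : UnitaryGp H → PU H) :=
  QuotientGroup.mk'_surjective _

theorem Ad_isOpenQuotientMap : IsOpenQuotientMap (Ad : UnitaryGp H → PU H) :=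
  QuotientGroup.isOpenQuotientMap_mk

theorem Ad_scalar (c : Circle) : Ad (scalar H c) = 1 :=
  (QuotientGroup.eq_one_iff _).mpr ⟨c, rfl⟩

/-- Conjugation by a unitary isomorphism `w : H → K`. -/
def unitaryConj (w : H ≃ₗᵢ[ℂ] K) : UnitaryGp H →* UnitaryGp K where
  toFun U := (w.symm.trans U).trans w
  map_one' := by ext x; simp
  map_mul' U V := by ext x; simp

@[simp]
theorem unitaryConj_apply (w : H ≃ₗᵢ[ℂ] K) (U : UnitaryGp H) (x : K) :
    unitaryConj w U x = w (U (w.symm x)) := rfl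

theorem unitaryConj_scalar (w : H ≃ₗᵢ[ℂ] K) (c : Circle) :
    unitaryConj w (scalar H c) = scalar K c := by ext x; simp

theorem continuous_unitaryConj (w : H ≃ₗᵢ[ℂ] K) : Continuous (unitaryConj w) :=
  continuous_unitary_iff.mpr fun x => w.continuous.comp (continuous_unitary_apply (w.symm x))

/-- The isomorphism `PU(H) → PU(K)` induced by (the class modulo `U(1)` of) a unitary isomorphism
`w : H → K`. -/
def puConj (w : H ≃ₗᵢ[ℂ] K) : PU H →* PU K :=
  QuotientGroup.map (scalars H) (scalars K) (unitaryConj w) (by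
    rintro _ ⟨c, rfl⟩
    exact ⟨c, (unitaryConj_scalar w c).symm⟩)

@[simp]
theorem puConj_Ad (w : H ≃ₗᵢ[ℂ] K) (U : UnitaryGp H) : puConj w (Ad U) = Ad (unitaryConj w U) := rfl

theorem continuous_puConj (w : H ≃ₗᵢ[ℂ] K) : Continuous (puConj w) :=
  Ad_isOpenQuotientMap.isQuotientMap.continuous_iff.mpr
    (Ad_isOpenQuotientMap.continuous.comp (continuous_unitaryConj w))

/-- The action `v[U] = V U V⁻¹`, for any preimage `V` of `v`, of `PU(H)` on `U(H)`. -/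
def puAct : PU H →* MulAut (UnitaryGp H) :=
  QuotientGroup.lift (scalars H) MulAut.conj (by
    rintro _ ⟨c, rfl⟩
    ext1 U
    change scalar H c * U * (scalar H c)⁻¹ = U
    rw [← scalar_comm, mul_inv_cancel_right])

@[simp]
theorem puAct_Ad (V U : UnitaryGp H) : puAct (Ad V) U = V * U * V⁻¹ := rfl

theorem Ad_puAct (v : PU H) (U : UnitaryGp H) : Ad (puAct v U) = v * Ad U * v⁻¹ := by
  obtain ⟨V, rfl⟩ := Ad_surjective v
  simp

theorem unitaryTensor_scalar (c d : Circle) :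
    unitaryTensor (scalar H c) (scalar K d) = scalar (HTensor H K) (c * d) :=
  unitary_ext fun x y => by
    rw [unitaryTensor_htmul, scalar_apply, scalar_apply, scalar_apply, htmul, htmul,
      ← Completion.coe_smul, TensorProduct.tmul_smul, ← TensorProduct.smul_tmul', smul_smul,
      Circle.coe_mul, mul_comm]

theorem continuous_unitaryTensor :
    Continuous fun p : UnitaryGp H × UnitaryGp K => unitaryTensor p.1 p.2 := by
  refine continuous_unitary_iff.mpr fun t => ?_
  have h0 : ∀ a : H ⊗[ℂ] K, Continuous fun p : UnitaryGp H × UnitaryGp K =>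
      unitaryTensor p.1 p.2 (a : Completion (H ⊗[ℂ] K)) := by
    intro a
    induction a using TensorProduct.induction_on with
    | zero => simpa using continuous_const
    | tmul x y =>
      have h1 : Continuous fun p : UnitaryGp H × UnitaryGp K => htmul (p.1 x) (p.2 y) :=
        (Completion.continuous_coe _).comp (TensorProduct.continuous_tmul.comp
          (((continuous_unitary_apply x).comp continuous_fst).prodMk
            ((continuous_unitary_apply y).comp continuous_snd)))
      exact h1.congr fun p => (unitaryTensor_htmul p.1 p.2 x y).symm
    | add a b ha hb =>
      simp only [Completion.coe_add, map_add]
      exact ha.add hb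
  refine continuous_of_uniform_approx_of_continuous fun u hu => ?_
  obtain ⟨ε, hε, hεu⟩ := Metric.mem_uniformity_dist.mp hu
  obtain ⟨a, ha⟩ := Completion.denseRange_coe.exists_dist_lt t hε
  exact ⟨_, h0 a, fun p => hεu (by rwa [LinearIsometryEquiv.dist_map])⟩

/-- The tensor product `PU(H) × PU(K) → PU(H ⊗ K)`. -/
def puTensor (p : PU H) (q : PU K) : PU (HTensor H K) :=
  Quotient.map₂ (fun (U : UnitaryGp H) (V : UnitaryGp K) => unitaryTensor U V) (by
    intro U U' hU V V' hV
    rw [← Quotient.eq_iff_equiv] at hU hV ⊢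
    obtain ⟨c, hc⟩ := QuotientGroup.eq.mp hU
    obtain ⟨d, hd⟩ := QuotientGroup.eq.mp hV
    refine QuotientGroup.eq.mpr ⟨c * d, ?_⟩
    rw [← unitaryTensor_scalar, hc, hd, eq_inv_mul_iff_mul_eq, ← unitaryTensor_mul,
      mul_inv_cancel_left, mul_inv_cancel_left]) p q

@[simp]
theorem puTensor_Ad (U : UnitaryGp H) (V : UnitaryGp K) :
    puTensor (Ad U) (Ad V) = Ad (unitaryTensor U V) := rfl

theorem puTensor_mul (p p' : PU H) (q q' : PU K) :
    puTensor (p * p') (q * q') = puTensor p q * puTensor p' q' := by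
  obtain ⟨U, rfl⟩ := Ad_surjective p
  obtain ⟨U', rfl⟩ := Ad_surjective p'
  obtain ⟨V, rfl⟩ := Ad_surjective q
  obtain ⟨V', rfl⟩ := Ad_surjective q'
  rw [← map_mul, ← map_mul, puTensor_Ad, unitaryTensor_mul, map_mul]
  rfl

theorem puTensor_one : puTensor (1 : PU H) (1 : PU K) = 1 := by
  rw [← map_one Ad, ← map_one Ad, puTensor_Ad, unitaryTensor_one, map_one]

theorem continuous_puTensor : Continuous fun p : PU H × PU K => puTensor p.1 p.2 := by
  have h : IsOpenQuotientMap (Prod.map (Ad : UnitaryGp H → PU H) (Ad : UnitaryGp K → PU K)) :=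
    Ad_isOpenQuotientMap.prodMap Ad_isOpenQuotientMap
  exact h.isQuotientMap.continuous_iff.mpr
    (Ad_isOpenQuotientMap.continuous.comp continuous_unitaryTensor)

end Unitary

set_option linter.unusedSectionVars false

/-! ### Dynamical triples -/

section Triples

variable {Γ Γ' G : Type u} [Group Γ] [Group Γ'] [CommGroup G] [TopologicalSpace G]
  [IsTopologicalGroup G] {N : Subgroup G}

/-- A dynamical triple `(χ, λ, μ)` with underlying Hilbert space `H` (in a chart): `Γ` acts on
`G/N × PU(H) → G/N` by `a · (z, U) = (z + χ(a), λ(a, z) U)`, `G` acts by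
`g · (z, U) = (z + gN, μ(g, z) U)`, and the two actions commute. The group `G` is written
multiplicatively. -/
structure TripleOn (χ : Γ →* G ⧸ N) (H : Type u) [NormedAddCommGroup H]
    [InnerProductSpace ℂ H] where
  lam : Γ → G ⧸ N → PU H
  mu : G → G ⧸ N → PU H
  continuous_lam : ∀ a, Continuous (lam a)
  continuous_mu : Continuous fun p : G × (G ⧸ N) => mu p.1 p.2
  lam_mul : ∀ b a z, lam (b * a) z = lam b (z * χ a) * lam a z
  mu_mul : ∀ (g h : G) z, mu (g * h) z = mu g (z * (h : G ⧸ N)) * mu h z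
  lam_mu : ∀ a (g : G) z, lam a (z * (g : G ⧸ N)) * mu g z = mu g (z * χ a) * lam a z

variable {χ : Γ →* G ⧸ N}

namespace TripleOn

variable {H K L : Type u}
  [NormedAddCommGroup H] [InnerProductSpace ℂ H] [NormedAddCommGroup K] [InnerProductSpace ℂ K]
  [NormedAddCommGroup L] [InnerProductSpace ℂ L]

/-- The translation action of `(a, g) ∈ Γ × G` on `G/N`: `z · (a, g) = z + χ(a) + gN`. -/
def act (χ : Γ →* G ⧸ N) (z : G ⧸ N) (x : Γ × G) : G ⧸ N := z * χ x.1 * (x.2 : G ⧸ N)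

/-- The cocycle `ν(a, g, z) = λ(a, z + gN) μ(g, z)` of the joint action of `Γ × G`. -/
def nu (S : TripleOn χ H) (x : Γ × G) (z : G ⧸ N) : PU H :=
  S.lam x.1 (z * (x.2 : G ⧸ N)) * S.mu x.2 z

/-- Isomorphism of dynamical triples, in charts: a unitary isomorphism `w : H → K`, a translation
`z ↦ z + z₀` of `G/N` and a continuous `v : G/N → PU(K)` such that the bundle isomorphism
`(z, U) ↦ (z + z₀, v(z) (w U w⁻¹))` is equivariant for `Γ` and `G`. -/
def Iso (S : TripleOn χ H) (T : TripleOn χ K) : Prop :=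
  ∃ (w : H ≃ₗᵢ[ℂ] K) (z₀ : G ⧸ N) (v : G ⧸ N → PU K), Continuous v ∧
    (∀ a z, v (z * χ a) * puConj w (S.lam a z) = T.lam a (z * z₀) * v z) ∧
    (∀ (g : G) z, v (z * (g : G ⧸ N)) * puConj w (S.mu g z) = T.mu g (z * z₀) * v z)

/-- `T` arises from `S` by a unitary cocycle: `ν_T = ν_S Ad(n)` for a continuous function
`n : Γ × G × G/N → U(H)` with `n(yx, z) = ν_S(x, z)⁻¹[n(y, z · x)] n(x, z)`. -/
def CocycleEquiv (S T : TripleOn χ H) : Prop :=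
  ∃ n : Γ × G → G ⧸ N → UnitaryGp H,
    (∀ a, Continuous fun p : G × (G ⧸ N) => n (a, p.1) p.2) ∧
    (∀ y x z, n (y * x) z = puAct (S.nu x z)⁻¹ (n y (act χ z x)) * n x z) ∧
    (∀ x z, T.nu x z = S.nu x z * Ad (n x z))

/-- Outer conjugation: isomorphism up to a unitary cocycle. -/
def OuterConj (S : TripleOn χ H) (T : TripleOn χ K) : Prop :=
  ∃ (M : Type u) (_ : NormedAddCommGroup M) (_ : InnerProductSpace ℂ M) (S' T' : TripleOn χ M),
    Iso S S' ∧ Iso T T' ∧ CocycleEquiv S' T'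

/-- The tensor product of dynamical triples with the same `χ`. -/
def tensor (S : TripleOn χ H) (T : TripleOn χ K) : TripleOn χ (HTensor H K) where
  lam a z := puTensor (S.lam a z) (T.lam a z)
  mu g z := puTensor (S.mu g z) (T.mu g z)
  continuous_lam a := continuous_puTensor.comp ((S.continuous_lam a).prodMk (T.continuous_lam a))
  continuous_mu := continuous_puTensor.comp (S.continuous_mu.prodMk T.continuous_mu)
  lam_mul b a z := by rw [S.lam_mul, T.lam_mul, puTensor_mul]
  mu_mul g h z := by rw [S.mu_mul, T.mu_mul, puTensor_mul]
  lam_mu a g z := by rw [← puTensor_mul, ← puTensor_mul, S.lam_mu, T.lam_mu]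

/-- The trivial dynamical triple on the Hilbert space `H`. -/
def trivial (χ : Γ →* G ⧸ N) (H : Type u) [NormedAddCommGroup H] [InnerProductSpace ℂ H] :
    TripleOn χ H where
  lam _ _ := 1
  mu _ _ := 1
  continuous_lam _ := continuous_const
  continuous_mu := continuous_const
  lam_mul _ _ _ := (one_mul 1).symm
  mu_mul _ _ _ := (one_mul 1).symm
  lam_mu _ _ _ := rfl

/-- The stabilisation `PU(H₀) ⊗ P` of a dynamical triple by a Hilbert space `H₀`. -/
def stab (H₀ : Type u) [NormedAddCommGroup H₀] [InnerProductSpace ℂ H₀] (S : TripleOn χ H) :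
    TripleOn χ (HTensor H₀ H) := (trivial χ H₀).tensor S

/-- Pullback of a dynamical triple along a homomorphism `Γ' → Γ`. -/
def pullback (f : Γ' →* Γ) (S : TripleOn χ H) : TripleOn (χ.comp f) H where
  lam a z := S.lam (f a) z
  mu := S.mu
  continuous_lam a := S.continuous_lam (f a)
  continuous_mu := S.continuous_mu
  lam_mul b a z := by rw [map_mul, S.lam_mul]; rfl
  mu_mul := S.mu_mul
  lam_mu a g z := S.lam_mu (f a) g z

/-! #### Stable outer conjugation is an equivalence relation -/

theorem nu_mul (S : TripleOn χ H) (y x : Γ × G) (z : G ⧸ N) :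
    S.nu (y * x) z = S.nu y (act χ z x) * S.nu x z := by
  obtain ⟨b, h⟩ := y
  obtain ⟨a, g⟩ := x
  simp only [nu, act, Prod.mk_mul_mk, QuotientGroup.mk_mul, S.lam_mul, S.mu_mul]
  have e1 : z * ((h : G ⧸ N) * (g : G ⧸ N)) * χ a = z * χ a * g * h := by
    simp only [mul_assoc, mul_comm, mul_left_comm]
  have e2 : z * ((h : G ⧸ N) * (g : G ⧸ N)) = z * g * h := by
    rw [mul_comm (h : G ⧸ N), mul_assoc]
  have e3 : z * χ a * (g : G ⧸ N) = z * g * χ a := mul_right_comm _ _ _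
  rw [e1, e2, e3, mul_assoc, ← mul_assoc (S.lam a _) (S.mu h _), S.lam_mu]
  simp only [mul_assoc]

theorem Iso.refl (S : TripleOn χ H) : Iso S S := by
  have h : ∀ p : PU H, puConj (LinearIsometryEquiv.refl ℂ H) p = p := by
    intro p
    obtain ⟨U, rfl⟩ := Ad_surjective p
    rfl
  exact ⟨LinearIsometryEquiv.refl ℂ H, 1, fun _ => 1, continuous_const,
    fun a z => by simp [h], fun g z => by simp [h]⟩

theorem puConj_symm_apply (w : H ≃ₗᵢ[ℂ] K) (p : PU H) : puConj w.symm (puConj w p) = p := by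
  obtain ⟨U, rfl⟩ := Ad_surjective p
  rw [puConj_Ad, puConj_Ad]
  congr 1
  ext x
  simp

theorem puConj_trans (w : H ≃ₗᵢ[ℂ] K) (w' : K ≃ₗᵢ[ℂ] L) (p : PU H) :
    puConj (w.trans w') p = puConj w' (puConj w p) := by
  obtain ⟨U, rfl⟩ := Ad_surjective p
  rfl

theorem Iso.symm {S : TripleOn χ H} {T : TripleOn χ K} (h : Iso S T) : Iso T S := by
  obtain ⟨w, z₀, v, hv, h1, h2⟩ := h
  refine ⟨w.symm, z₀⁻¹, fun z => (puConj w.symm (v (z * z₀⁻¹)))⁻¹,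
    ((continuous_puConj w.symm).comp (hv.comp (continuous_mul_const z₀⁻¹))).fun_inv, fun a z => ?_,
    fun g z => ?_⟩
  · have := congrArg (puConj w.symm) (h1 a (z * z₀⁻¹))
    simp only [map_mul, puConj_symm_apply, inv_mul_cancel_right] at this
    rw [inv_mul_eq_iff_eq_mul, ← mul_assoc, eq_mul_inv_iff_mul_eq, ← this, mul_right_comm z]
  · have := congrArg (puConj w.symm) (h2 g (z * z₀⁻¹))
    simp only [map_mul, puConj_symm_apply, inv_mul_cancel_right] at this
    rw [inv_mul_eq_iff_eq_mul, ← mul_assoc, eq_mul_inv_iff_mul_eq, ← this, mul_right_comm z]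

theorem Iso.trans {S : TripleOn χ H} {T : TripleOn χ K} {R : TripleOn χ L}
    (h : Iso S T) (h' : Iso T R) : Iso S R := by
  obtain ⟨w, z₀, v, hv, h1, h2⟩ := h
  obtain ⟨w', z₀', v', hv', h1', h2'⟩ := h'
  refine ⟨w.trans w', z₀ * z₀', fun z => v' (z * z₀) * puConj w' (v z),
    (hv'.comp (continuous_mul_const _)).mul ((continuous_puConj _).comp hv), fun a z => ?_,
    fun g z => ?_⟩
  · rw [puConj_trans, mul_assoc, ← map_mul, h1, map_mul, ← mul_assoc, mul_right_comm z,
      h1', mul_assoc, mul_assoc z]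
  · rw [puConj_trans, mul_assoc, ← map_mul, h2, map_mul, ← mul_assoc, mul_right_comm z,
      h2', mul_assoc, mul_assoc z]

/-- Isomorphism, expressed through the joint cocycle. -/
theorem iso_nu {S : TripleOn χ H} {T : TripleOn χ K} {w : H ≃ₗᵢ[ℂ] K} {z₀ : G ⧸ N}
    {v : G ⧸ N → PU K}
    (h1 : ∀ a z, v (z * χ a) * puConj w (S.lam a z) = T.lam a (z * z₀) * v z)
    (h2 : ∀ (g : G) z, v (z * (g : G ⧸ N)) * puConj w (S.mu g z) = T.mu g (z * z₀) * v z)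
    (x : Γ × G) (z : G ⧸ N) :
    v (act χ z x) * puConj w (S.nu x z) = T.nu x (z * z₀) * v z := by
  rw [nu, nu, act, map_mul, mul_right_comm z (χ x.1), ← mul_assoc, h1, mul_assoc, h2,
    mul_right_comm z z₀, mul_assoc (T.lam _ _)]

/-- Transport of a dynamical triple along a bundle isomorphism. -/
def transport (S : TripleOn χ H) (w : H ≃ₗᵢ[ℂ] K) (z₀ : G ⧸ N) (v : G ⧸ N → PU K)
    (hv : Continuous v) : TripleOn χ K where
  lam a z := v (z * z₀⁻¹ * χ a) * puConj w (S.lam a (z * z₀⁻¹)) * (v (z * z₀⁻¹))⁻¹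
  mu g z := v (z * z₀⁻¹ * (g : G ⧸ N)) * puConj w (S.mu g (z * z₀⁻¹)) * (v (z * z₀⁻¹))⁻¹
  continuous_lam a := by
    have h := S.continuous_lam a
    have h' := continuous_puConj w
    fun_prop
  continuous_mu := by
    have h := S.continuous_mu
    have h' := continuous_puConj w
    have h1 : Continuous fun p : G × (G ⧸ N) => puConj w (S.mu p.1 (p.2 * z₀⁻¹)) :=
      h'.comp (h.comp (continuous_fst.prodMk (continuous_snd.mul continuous_const)))
    have h2 : Continuous fun p : G × (G ⧸ N) => v (p.2 * z₀⁻¹ * (p.1 : G ⧸ N)) :=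
      hv.comp ((continuous_snd.mul continuous_const).mul
        (continuous_quot_mk.comp continuous_fst))
    have h3 : Continuous fun p : G × (G ⧸ N) => (v (p.2 * z₀⁻¹))⁻¹ :=
      (hv.comp (continuous_snd.mul continuous_const)).inv
    exact (h2.mul h1).mul h3
  lam_mul b a z := by
    rw [map_mul, S.lam_mul, map_mul, mul_right_comm z (χ a), mul_comm (χ b), ← mul_assoc]
    group
  mu_mul g h z := by
    rw [QuotientGroup.mk_mul, S.mu_mul, map_mul, mul_right_comm z (h : G ⧸ N),
      mul_comm (g : G ⧸ N), ← mul_assoc]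
    group
  lam_mu a g z := by
    have h := congrArg (puConj w) (S.lam_mu a g (z * z₀⁻¹))
    rw [map_mul, map_mul] at h
    rw [mul_right_comm z (g : G ⧸ N), mul_right_comm z (χ a), mul_right_comm (z * z₀⁻¹) (χ a)]
    simp only [mul_assoc, inv_mul_cancel_left]
    simp only [mul_assoc] at h
    rw [← mul_assoc (puConj w _) (puConj w _), h]
    simp only [mul_assoc]

theorem iso_transport (S : TripleOn χ H) (w : H ≃ₗᵢ[ℂ] K) (z₀ : G ⧸ N) (v : G ⧸ N → PU K)
    (hv : Continuous v) : Iso S (S.transport w z₀ v hv) :=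
  ⟨w, z₀, v, hv, fun a z => by simp [transport], fun g z => by simp [transport]⟩

theorem CocycleEquiv.refl (S : TripleOn χ H) : CocycleEquiv S S :=
  ⟨fun _ _ => 1, fun _ => continuous_const, fun _ _ _ => by simp, fun _ _ => by simp⟩

theorem puAct_mul_apply (p q : PU H) (U : UnitaryGp H) : puAct (p * q) U = puAct p (puAct q U) := by
  rw [map_mul]; rfl

theorem CocycleEquiv.trans {S T R : TripleOn χ H} (h : CocycleEquiv S T)
    (h' : CocycleEquiv T R) : CocycleEquiv S R := by
  obtain ⟨n, hc, hn, hS⟩ := h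
  obtain ⟨m, hc', hm, hT⟩ := h'
  refine ⟨fun x z => n x z * m x z, fun a => (hc a).mul (hc' a), fun y x z => ?_, fun x z => ?_⟩
  · dsimp only
    rw [hn, hm, hS, mul_inv_rev, puAct_mul_apply, map_mul, ← map_inv, puAct_Ad]
    simp [mul_assoc]
  · rw [hT, hS, map_mul, mul_assoc]

theorem CocycleEquiv.symm {S T : TripleOn χ H} (h : CocycleEquiv S T) : CocycleEquiv T S := by
  obtain ⟨n, hc, hn, hS⟩ := h
  refine ⟨fun x z => (n x z)⁻¹, fun a => (hc a).inv, fun y x z => ?_, fun x z => ?_⟩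
  · dsimp only
    rw [hn, hS, mul_inv_rev, mul_inv_rev, puAct_mul_apply, map_inv (puAct _), ← map_inv (Ad (H := H)), puAct_Ad]
    simp [mul_assoc]
  · rw [hS, map_inv, mul_inv_cancel_right]

theorem puAct_puConj (w : H ≃ₗᵢ[ℂ] K) (p : PU H) (U : UnitaryGp H) :
    puAct (puConj w p) (unitaryConj w U) = unitaryConj w (puAct p U) := by
  obtain ⟨V, rfl⟩ := Ad_surjective p
  rw [puConj_Ad, puAct_Ad, puAct_Ad, map_mul, map_mul, map_inv]

theorem continuous_puAct : Continuous fun p : PU H × UnitaryGp H => puAct p.1 p.2 := by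
  have h : IsOpenQuotientMap (Prod.map (Ad : UnitaryGp H → PU H) (id : UnitaryGp H → UnitaryGp H)) :=
    Ad_isOpenQuotientMap.prodMap IsOpenQuotientMap.id
  refine h.isQuotientMap.continuous_iff.mpr ?_
  change Continuous fun p : UnitaryGp H × UnitaryGp H => p.1 * p.2 * p.1⁻¹
  fun_prop

/-- Unitary cocycles can be transported along isomorphisms. -/
theorem CocycleEquiv.exchange {S T : TripleOn χ H} {S' : TripleOn χ K} (h : CocycleEquiv S T)
    (hS : Iso S S') : ∃ T' : TripleOn χ K, Iso T T' ∧ CocycleEquiv S' T' := by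
  obtain ⟨n, hc, hn, hST⟩ := h
  obtain ⟨w, z₀, v, hv, h1, h2⟩ := hS
  have hν := iso_nu h1 h2
  refine ⟨T.transport w z₀ v hv, iso_transport T w z₀ v hv,
    fun x z => puAct (v (z * z₀⁻¹)) (unitaryConj w (n x (z * z₀⁻¹))), fun a => ?_,
    fun y x z => ?_, fun x z => ?_⟩
  · have e1 : Continuous fun p : G × (G ⧸ N) => v (p.2 * z₀⁻¹) :=
      hv.comp (continuous_snd.mul continuous_const)
    have e2 : Continuous fun p : G × (G ⧸ N) => unitaryConj w (n (a, p.1) (p.2 * z₀⁻¹)) :=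
      (continuous_unitaryConj w).comp ((hc a).comp
        (continuous_fst.prodMk (continuous_snd.mul continuous_const)))
    exact continuous_puAct.comp (e1.prodMk e2)
  · have e := hν x (z * z₀⁻¹)
    rw [inv_mul_cancel_right] at e
    have e' : act χ z x * z₀⁻¹ = act χ (z * z₀⁻¹) x := by
      rw [act, act, mul_right_comm z z₀⁻¹, mul_right_comm _ z₀⁻¹]
    have e2 : (S'.nu x z)⁻¹ * v (act χ (z * z₀⁻¹) x) =
        v (z * z₀⁻¹) * (puConj w (S.nu x (z * z₀⁻¹)))⁻¹ := by
      rw [inv_mul_eq_iff_eq_mul, ← mul_assoc, ← e, mul_inv_cancel_right]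
    dsimp only
    rw [e', ← puAct_mul_apply, e2, puAct_mul_apply, ← map_inv (puConj w), puAct_puConj, ← map_mul,
      ← map_mul, ← hn]
  · have e := hν x (z * z₀⁻¹)
    rw [inv_mul_cancel_right] at e
    have e' := iso_nu (S := T) (T := T.transport w z₀ v hv) (w := w) (z₀ := z₀) (v := v)
      (fun a z => by simp [transport]) (fun g z => by simp [transport]) x (z * z₀⁻¹)
    rw [inv_mul_cancel_right, hST, map_mul, ← mul_assoc, e, puConj_Ad] at e'
    rw [Ad_puAct, ← mul_assoc, ← mul_assoc, eq_mul_inv_iff_mul_eq, ← e']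

theorem OuterConj.of_iso {S : TripleOn χ H} {T : TripleOn χ K} (h : Iso S T) : OuterConj S T :=
  ⟨K, _, _, T, T, h, Iso.refl T, CocycleEquiv.refl T⟩

theorem OuterConj.symm {S : TripleOn χ H} {T : TripleOn χ K} (h : OuterConj S T) :
    OuterConj T S := by
  obtain ⟨M, _, _, S', T', h1, h2, h3⟩ := h
  exact ⟨M, _, _, T', S', h2, h1, h3.symm⟩

theorem OuterConj.trans {S : TripleOn χ H} {T : TripleOn χ K} {R : TripleOn χ L}
    (h : OuterConj S T) (h' : OuterConj T R) : OuterConj S R := by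
  obtain ⟨M, _, _, S', T', h1, h2, h3⟩ := h
  obtain ⟨M', _, _, T'', R'', h1', h2', h3'⟩ := h'
  obtain ⟨S'', e1, e2⟩ := h3.symm.exchange (h2.symm.trans h1')
  exact ⟨M', _, _, S'', R'', h1.trans e1, h2', e2.symm.trans h3'⟩

section Stab

variable {H₀ H₁ : Type u} [NormedAddCommGroup H₀] [InnerProductSpace ℂ H₀]
  [NormedAddCommGroup H₁] [InnerProductSpace ℂ H₁]

theorem puTensor_puConj (w : H ≃ₗᵢ[ℂ] K) (w₀ : H₀ ≃ₗᵢ[ℂ] H₁) (p₀ : PU H₀) (p : PU H) :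
    puConj (unitaryTensor w₀ w) (puTensor p₀ p) = puTensor (puConj w₀ p₀) (puConj w p) := by
  obtain ⟨U, rfl⟩ := Ad_surjective p
  obtain ⟨U₀, rfl⟩ := Ad_surjective p₀
  rw [puTensor_Ad, puConj_Ad, puConj_Ad, puConj_Ad, puTensor_Ad]
  congr 1
  refine unitary_ext fun x y => ?_
  obtain ⟨x, rfl⟩ := w₀.surjective x
  obtain ⟨y, rfl⟩ := w.surjective y
  rw [unitaryConj_apply, ← unitaryTensor_htmul, LinearIsometryEquiv.symm_apply_apply]
  simp

theorem Iso.stab_map {S : TripleOn χ H} {T : TripleOn χ K} (w₀ : H₀ ≃ₗᵢ[ℂ] H₁) (h : Iso S T) :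
    Iso (S.stab H₀) (T.stab H₁) := by
  obtain ⟨w, z₀, v, hv, h1, h2⟩ := h
  refine ⟨unitaryTensor w₀ w, z₀, fun z => puTensor 1 (v z),
    continuous_puTensor.comp (continuous_const.prodMk hv), fun a z => ?_, fun g z => ?_⟩
  · change _ * puConj _ (puTensor 1 (S.lam a z)) = puTensor 1 (T.lam a _) * _
    rw [puTensor_puConj, map_one, ← puTensor_mul, ← puTensor_mul, h1]
  · change _ * puConj _ (puTensor 1 (S.mu g z)) = puTensor 1 (T.mu g _) * _
    rw [puTensor_puConj, map_one, ← puTensor_mul, ← puTensor_mul, h2]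

theorem puAct_tensor (p : PU H) (U : UnitaryGp H) :
    puAct (puTensor (1 : PU H₀) p) (unitaryTensor 1 U) = unitaryTensor 1 (puAct p U) := by
  obtain ⟨V, rfl⟩ := Ad_surjective p
  rw [← map_one Ad, puTensor_Ad, puAct_Ad, puAct_Ad, mul_inv_eq_iff_eq_mul, ← unitaryTensor_mul,
    ← unitaryTensor_mul, inv_mul_cancel_right]

theorem nu_stab (R : TripleOn χ H) (x : Γ × G) (z : G ⧸ N) :
    (R.stab H₀).nu x z = puTensor 1 (R.nu x z) := by
  have e : (R.stab H₀).nu x z =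
      puTensor 1 (R.lam x.1 (z * (x.2 : G ⧸ N))) * puTensor 1 (R.mu x.2 z) := rfl
  rw [e, ← puTensor_mul, one_mul, nu]

theorem puTensor_inv (p : PU H) : (puTensor (1 : PU H₀) p)⁻¹ = puTensor 1 p⁻¹ := by
  rw [inv_eq_iff_mul_eq_one, ← puTensor_mul, one_mul, mul_inv_cancel, puTensor_one]

theorem CocycleEquiv.stab {S T : TripleOn χ H} (h : CocycleEquiv S T) :
    CocycleEquiv (S.stab H₀) (T.stab H₀) := by
  obtain ⟨n, hc, hn, hST⟩ := h
  refine ⟨fun x z => unitaryTensor (1 : UnitaryGp H₀) (n x z), fun a => ?_, fun y x z => ?_,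
    fun x z => ?_⟩
  · have h1 : Continuous fun p : G × (G ⧸ N) => ((1 : UnitaryGp H₀), n (a, p.1) p.2) :=
      continuous_const.prodMk (hc a)
    have h2 := (continuous_unitaryTensor (H := H₀) (K := H)).comp h1
    simp only [Function.comp_def] at h2
    exact h2
  · dsimp only
    rw [nu_stab, puTensor_inv, puAct_tensor, ← unitaryTensor_mul, one_mul, hn]
  · rw [nu_stab, nu_stab, ← puTensor_Ad, ← puTensor_mul, map_one, one_mul, hST]

theorem OuterConj.stab {S : TripleOn χ H} {T : TripleOn χ K} (h : OuterConj S T) :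
    OuterConj (S.stab H₀) (T.stab H₀) := by
  obtain ⟨M, _, _, S', T', h1, h2, h3⟩ := h
  exact ⟨_, _, _, _, _, h1.stab_map (LinearIsometryEquiv.refl ℂ H₀),
    h2.stab_map (LinearIsometryEquiv.refl ℂ H₀), h3.stab⟩

theorem iso_of_conj {S : TripleOn χ H} {T : TripleOn χ K} (w : H ≃ₗᵢ[ℂ] K)
    (h1 : ∀ a z, puConj w (S.lam a z) = T.lam a z) (h2 : ∀ (g : G) z, puConj w (S.mu g z) = T.mu g z) :
    Iso S T :=
  ⟨w, 1, fun _ => 1, continuous_const, fun a z => by simp [h1], fun g z => by simp [h2]⟩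

theorem puConj_assoc (p : PU H) :
    puConj (tensorAssoc H₀ H₁ H) (puTensor (1 : PU (HTensor H₀ H₁)) p) =
      puTensor (1 : PU H₀) (puTensor (1 : PU H₁) p) := by
  obtain ⟨U, rfl⟩ := Ad_surjective p
  rw [← map_one Ad, ← map_one Ad, ← map_one Ad, puTensor_Ad, puConj_Ad, puTensor_Ad, puTensor_Ad]
  congr 1
  have : (tensorAssoc H₀ H₁ H).trans (unitaryConj (tensorAssoc H₀ H₁ H) (unitaryTensor 1 U)) =
      (tensorAssoc H₀ H₁ H).trans (unitaryTensor 1 (unitaryTensor 1 U)) :=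
    unitary_ext₃ fun x y z => by
      rw [LinearIsometryEquiv.trans_apply, LinearIsometryEquiv.trans_apply, unitaryConj_apply,
        LinearIsometryEquiv.symm_apply_apply, unitaryTensor_htmul, tensorAssoc_htmul,
        unitaryTensor_htmul, unitaryTensor_htmul]
      exact tensorAssoc_htmul x y (U z)
  ext t
  obtain ⟨t, rfl⟩ := (tensorAssoc H₀ H₁ H).surjective t
  exact DFunLike.congr_fun this t

theorem iso_stab_stab (S : TripleOn χ H) :
    Iso (S.stab (HTensor H₀ H₁)) ((S.stab H₁).stab H₀) :=
  iso_of_conj (tensorAssoc H₀ H₁ H) (fun _ _ => puConj_assoc _) (fun _ _ => puConj_assoc _)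

theorem iso_stab_comm (S : TripleOn χ H) :
    Iso ((S.stab H₁).stab H₀) ((S.stab H₀).stab H₁) :=
  (iso_stab_stab S).symm.trans (((Iso.refl S).stab_map (tensorComm H₀ H₁)).trans (iso_stab_stab S))

end Stab

end TripleOn

/-- A dynamical triple with fixed `χ`: an underlying nonzero separable Hilbert space together with
the cocycles `λ` and `μ`. -/
structure Triple (χ : Γ →* G ⧸ N) : Type (u + 1) where
  space : Type u
  [normed : NormedAddCommGroup space]
  [inner : InnerProductSpace ℂ space]
  [complete : CompleteSpace space]
  [separable : TopologicalSpace.SeparableSpace space]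
  [nontrivial : Nontrivial space]
  on : TripleOn χ space

attribute [instance] Triple.normed Triple.inner Triple.complete Triple.separable Triple.nontrivial

namespace Triple

/-- Stable outer conjugation of dynamical triples: outer conjugation after tensoring with some
separable Hilbert space `H₀`. -/
def StablyOuterConj (S T : Triple χ) : Prop :=
  ∃ (H₀ : Type u) (_ : NormedAddCommGroup H₀) (_ : InnerProductSpace ℂ H₀) (_ : CompleteSpace H₀)
    (_ : TopologicalSpace.SeparableSpace H₀) (_ : Nontrivial H₀),
    TripleOn.OuterConj (S.on.stab H₀) (T.on.stab H₀)

theorem stablyOuterConj_equivalence :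
    Equivalence (StablyOuterConj : Triple χ → Triple χ → Prop) where
  refl S := ⟨S.space, _, _, inferInstance, inferInstance, inferInstance,
    TripleOn.OuterConj.of_iso (TripleOn.Iso.refl _)⟩
  symm := by
    rintro S T ⟨H₀, _, _, i1, i2, i3, h⟩
    exact ⟨H₀, _, _, i1, i2, i3, h.symm⟩
  trans := by
    rintro S T R ⟨H₀, _, _, _, _, _, h⟩ ⟨H₁, _, _, _, _, _, h'⟩
    refine ⟨HTensor H₀ H₁, inferInstance, inferInstance, inferInstance, inferInstance,
      inferInstance, ?_⟩
    have a := (h.stab (H₀ := H₁))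
    have b := (h'.stab (H₀ := H₀))
    have eS := TripleOn.OuterConj.of_iso
      ((TripleOn.iso_stab_stab (H₀ := H₀) (H₁ := H₁) S.on).trans (TripleOn.iso_stab_comm S.on))
    have eT := TripleOn.OuterConj.of_iso
      (TripleOn.iso_stab_comm (H₀ := H₁) (H₁ := H₀) T.on)
    have eR := TripleOn.OuterConj.of_iso (TripleOn.iso_stab_stab (H₀ := H₀) (H₁ := H₁) R.on).symm
    exact (((eS.trans a).trans eT).trans b).trans eR

/-- The tensor product of dynamical triples. -/
def tensor (S T : Triple χ) : Triple χ where
  space := HTensor S.space T.space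
  on := S.on.tensor T.on

/-- Pullback along a homomorphism of finite groups. -/
def pullback (f : Γ' →* Γ) (S : Triple χ) : Triple (χ.comp f) where
  space := S.space
  on := S.on.pullback f

theorem StablyOuterConj.pullback (f : Γ' →* Γ) {S T : Triple χ} (h : StablyOuterConj S T) :
    StablyOuterConj (S.pullback f) (T.pullback f) := by
  have hiso : ∀ {H K : Type u} [NormedAddCommGroup H] [InnerProductSpace ℂ H]
      [NormedAddCommGroup K] [InnerProductSpace ℂ K] {A : TripleOn χ H} {B : TripleOn χ K},
      TripleOn.Iso A B → TripleOn.Iso (A.pullback f) (B.pullback f) := by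
    rintro H K _ _ _ _ A B ⟨w, z₀, v, hv, h1, h2⟩
    exact ⟨w, z₀, v, hv, fun a z => h1 (f a) z, h2⟩
  obtain ⟨H₀, _, _, i1, i2, i3, M, _, _, S', T', h1, h2, n, hc, hn, hν⟩ := h
  refine ⟨H₀, _, _, i1, i2, i3, M, _, _, S'.pullback f, T'.pullback f, hiso h1, hiso h2,
    fun x z => n (f x.1, x.2) z, fun a => hc (f a), fun y x z => ?_,
    fun x z => hν (f x.1, x.2) z⟩
  have h := hn (f y.1, y.2) (f x.1, x.2) z
  rw [Prod.mk_mul_mk, ← map_mul] at h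
  exact h

end Triple

/-- The setoid of stable outer conjugation. -/
instance tripleSetoid (χ : Γ →* G ⧸ N) : Setoid (Triple χ) :=
  ⟨Triple.StablyOuterConj, Triple.stablyOuterConj_equivalence⟩

/-- `Dyn(Γ, χ)`: the set of stable outer conjugation classes of dynamical triples with fixed
`χ`. -/
def Dyn (χ : Γ →* G ⧸ N) : Type (u + 1) := Quotient (tripleSetoid χ)

/-- The class of a dynamical triple in `Dyn(Γ, χ)`. -/
def Triple.cls (S : Triple χ) : Dyn χ := Quotient.mk _ S

/-- The pullback `Dyn(Γ, χ) → Dyn(Γ', χ ∘ f)`. -/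
def Dyn.pullback (f : Γ' →* Γ) : Dyn χ → Dyn (χ.comp f) :=
  Quotient.map (Triple.pullback f) fun _ _ h => h.pullback f

end Triples

/-! ### The Mackey obstruction and dualisable triples -/

section Mackey

variable {Γ Γ' G : Type u} [Group Γ] [Group Γ'] [CommGroup G] [TopologicalSpace G]
  [IsTopologicalGroup G] [LocallyCompactSpace G] {N : Subgroup G}

/-- `G/N` carries its Borel `σ`-algebra. -/
instance (N : Subgroup G) : MeasurableSpace (G ⧸ N) := borel (G ⧸ N)

instance (N : Subgroup G) : BorelSpace (G ⧸ N) := ⟨rfl⟩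

/-- The Haar measure of `G/N`. -/
def haarQuot (N : Subgroup G) : Measure (G ⧸ N) := Measure.haar

/-- `L^∞(G/N, U(H))`: measurable functions `G/N → U(H)` modulo equality almost everywhere. -/
abbrev LinftyUnitary (N : Subgroup G) (H : Type u) [NormedAddCommGroup H]
    [InnerProductSpace ℂ H] : Type u := (G ⧸ N) →ₘ[haarQuot N] UnitaryGp H

/-- `L^∞(G/N, U(1))`: measurable functions `G/N → U(1)` modulo equality almost everywhere. -/
abbrev LinftyCircle (N : Subgroup G) : Type u := (G ⧸ N) →ₘ[haarQuot N] Circle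

/-- The weak (equivalently, strong) operator topology on `L^∞(G/N, U(H))`, regarded as a set of
unitary multiplication operators on `L²(G/N, H)`. -/
@[reducible] def weakTopologyUnitary (N : Subgroup G) (H : Type u) [NormedAddCommGroup H]
    [InnerProductSpace ℂ H] : TopologicalSpace (LinftyUnitary N H) :=
  TopologicalSpace.induced
    (fun (f : LinftyUnitary N H) (p : Lp H 2 (haarQuot N) × Lp H 2 (haarQuot N)) =>
      ∫ z, inner ℂ (p.1 z) (f z (p.2 z)) ∂(haarQuot N)) inferInstance

/-- The weak (equivalently, strong) operator topology on `L^∞(G/N, U(1))`, regarded as a set of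
unitary multiplication operators on `L²(G/N)`. -/
@[reducible] def weakTopologyCircle (N : Subgroup G) : TopologicalSpace (LinftyCircle N) :=
  TopologicalSpace.induced
    (fun (f : LinftyCircle N) (p : Lp ℂ 2 (haarQuot N) × Lp ℂ 2 (haarQuot N)) =>
      ∫ z, inner ℂ (p.1 z) ((f z : ℂ) * p.2 z) ∂(haarQuot N)) inferInstance

/-- Borel functions `G → L^∞(G/N, U(H))`. -/
def IsBorelUnitary {H : Type u} [NormedAddCommGroup H] [InnerProductSpace ℂ H]
    (F : G → LinftyUnitary N H) : Prop :=
  @Measurable G (LinftyUnitary N H) (borel G) (@borel _ (weakTopologyUnitary N H)) F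

/-- Borel functions `G → L^∞(G/N, U(1))`, i.e. Borel `1`-cochains of `G`. -/
def IsBorelCircle (m : G → LinftyCircle N) : Prop :=
  @Measurable G (LinftyCircle N) (borel G) (@borel _ (weakTopologyCircle N)) m

variable {χ : Γ →* G ⧸ N}

/-- `F : G → L^∞(G/N, U(H))` is a Borel lift of the cocycle `μ` of `S`. -/
def TripleOn.IsBorelLift {H : Type u} [NormedAddCommGroup H] [InnerProductSpace ℂ H]
    (S : TripleOn χ H) (F : G → LinftyUnitary N H) : Prop :=
  IsBorelUnitary F ∧ ∀ g, ∀ᵐ z ∂(haarQuot N), Ad (F g z) = S.mu g z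

/-- `ω : G × G → L^∞(G/N, U(1))` is the obstruction of `F` to be a cocycle:
`F(h, z + gN) F(g, z) = F(g + h, z) ω(g, h, z)`. -/
def IsObstructionCocycle {H : Type u} [NormedAddCommGroup H] [InnerProductSpace ℂ H]
    (F : G → LinftyUnitary N H) (ω : G → G → LinftyCircle N) : Prop :=
  ∀ g h : G, ∀ᵐ z ∂(haarQuot N),
    F h (z * (g : G ⧸ N)) * F g z = F (g * h) z * scalar H (ω g h z)

/-- `ω` is the boundary of a Borel `1`-cochain, i.e. its class in
`H²_Bor(G, L^∞(G/N, U(1)))` vanishes. -/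
def IsBorelCoboundary (ω : G → G → LinftyCircle N) : Prop :=
  ∃ m : G → LinftyCircle N, IsBorelCircle m ∧
    ∀ g h : G, ∀ᵐ z ∂(haarQuot N), ω g h z = m h (z * (g : G ⧸ N)) / m (h * g) z * m g z

/-- A dynamical triple is dualisable if its Mackey obstruction `[ω]` vanishes. -/
def Triple.IsDualisable (S : Triple χ) : Prop :=
  ∃ (F : G → LinftyUnitary N S.space) (ω : G → G → LinftyCircle N),
    S.on.IsBorelLift F ∧ IsObstructionCocycle F ω ∧ IsBorelCoboundary ω

/-- `Dyn^†(Γ, χ)`: the stable outer conjugation classes of dualisable dynamical triples. -/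
def DynDag (χ : Γ →* G ⧸ N) : Type (u + 1) :=
  {c : Dyn χ // ∃ S : Triple χ, S.IsDualisable ∧ S.cls = c}

/-- The class of a dualisable triple in `Dyn^†(Γ, χ)`. -/
def DynDag.mk (S : Triple χ) (hS : S.IsDualisable) : DynDag χ := ⟨S.cls, S, hS, rfl⟩

/-- The pullback `Dyn^†(Γ, χ) → Dyn^†(Γ', χ ∘ f)`. -/
def DynDag.pullback (f : Γ' →* Γ) (c : DynDag χ) : DynDag (χ.comp f) :=
  ⟨c.1.pullback f, by
    obtain ⟨S, hS, hc⟩ := c.2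
    exact ⟨S.pullback f, hS, by rw [← hc]; rfl⟩⟩

end Mackey

/-! ### Continuous cohomology of the double complex -/

section Cohomology

/-! The boundary operators of the (nonstandard) inhomogeneous complex of a group `Q` with
coefficients in a multiplicatively written abelian group `A`, in degrees `0`, `1` and `2`. The map
`T a` is the action of `a⁻¹`. -/

section Boundary

variable {Q A : Type u} [Mul Q] [CommGroup A]

/-- `(δ f)(a) = a⁻¹ · f - f`. -/
def bd0 (T : Q → A →* A) (f : A) : Q → A := fun a => T a f / f

/-- `(δ f)(a, b) = a⁻¹ · f(b) - f(ba) + f(a)`. -/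
def bd1 (T : Q → A →* A) (f : Q → A) : Q → Q → A := fun a b => T a (f b) / f (b * a) * f a

/-- `(δ f)(a, b, c) = a⁻¹ · f(b, c) - f(ba, c) + f(a, cb) - f(a, b)`. -/
def bd2 (T : Q → A →* A) (f : Q → Q → A) : Q → Q → Q → A :=
  fun a b c => T a (f b c) / f (b * a) c * f a (c * b) / f a b

theorem bd0_mul (T : Q → A →* A) (f g : A) : bd0 T (f * g) = bd0 T f * bd0 T g := by
  funext a
  simp only [bd0, Pi.mul_apply, map_mul, mul_div_mul_comm]

theorem bd1_mul (T : Q → A →* A) (f g : Q → A) : bd1 T (f * g) = bd1 T f * bd1 T g := by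
  funext a b
  simp only [bd1, Pi.mul_apply, map_mul, mul_div_mul_comm, mul_mul_mul_comm]

theorem bd2_mul (T : Q → A →* A) (f g : Q → Q → A) : bd2 T (f * g) = bd2 T f * bd2 T g := by
  funext a b c
  simp only [bd2, Pi.mul_apply, map_mul, mul_div_mul_comm, mul_mul_mul_comm]

end Boundary

variable {Γ Γ' G : Type u} [Group Γ] [Group Γ'] [CommGroup G] [TopologicalSpace G]
  [IsTopologicalGroup G]

/-- The module `M = C(G/N, U(1))` with the compact-open topology. -/
abbrev Coeff (N : Subgroup G) : Type u := C(G ⧸ N, Circle)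

variable {N : Subgroup G}

/-- The shift `(t · f)(z) = f(z + t)` of functions on `G/N`. -/
def shift (t : G ⧸ N) : Coeff N →* Coeff N where
  toFun f := f.comp ⟨fun z => z * t, continuous_mul_const t⟩
  map_one' := rfl
  map_mul' _ _ := rfl

/-- The action of the inverse of an element of `G` on `C(G/N, U(1))`. -/
def shiftG (g : G) : Coeff N →* Coeff N := shift (g : G ⧸ N)

/-- The action of the inverse of an element of `Γ` on `M_χ = C(G/N, U(1))`. -/
def shiftΓ (χ : Γ →* G ⧸ N) (a : Γ) : Coeff N →* Coeff N := shift (χ a)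

/-- `M`-valued functions `(c, m)` in bidegrees `(1,0)` and `(0,1)`. -/
abbrev Fun1 (Γ : Type u) (N : Subgroup G) : Type u := (Γ → Coeff N) × (G → Coeff N)

/-- `M`-valued functions `(ψ, φ, ω)` in bidegrees `(2,0)`, `(1,1)` and `(0,2)`. -/
abbrev Fun2 (Γ : Type u) (N : Subgroup G) : Type u :=
  (Γ → Γ → Coeff N) × (Γ → G → Coeff N) × (G → G → Coeff N)

/-- `M`-valued functions in bidegrees `(3,0)`, `(2,1)`, `(1,2)` and `(0,3)`. -/
abbrev Fun3 (Γ : Type u) (N : Subgroup G) : Type u :=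
  (Γ → Γ → Γ → Coeff N) × (Γ → Γ → G → Coeff N) × (Γ → G → G → Coeff N) ×
    (G → G → G → Coeff N)

/-- The total boundary `∂_χ = d + (-1)^l δ_χ` (on bidegree `(k,l)`) from total degree `1` to `2`:
`∂(c, m) = (δ c, d c - δ m, d m)`. -/
def totalBd1 (χ : Γ →* G ⧸ N) : Fun1 Γ N →* Fun2 Γ N where
  toFun x :=
    (bd1 (shiftΓ χ) x.1,
      fun a g => bd0 shiftG (x.1 a) g / bd0 (shiftΓ χ) (x.2 g) a,
      bd1 shiftG x.2)
  map_one' := by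
    refine Prod.ext ?_ (Prod.ext ?_ ?_) <;> funext a b <;> simp [bd1, bd0]
  map_mul' x y := by
    refine Prod.ext (bd1_mul _ _ _) (Prod.ext ?_ (bd1_mul _ _ _))
    funext a g
    simp only [Prod.fst_mul, Prod.snd_mul, Pi.mul_apply, bd0_mul, mul_div_mul_comm]

/-- The total boundary from total degree `2` to `3`:
`∂(ψ, φ, ω) = (δ ψ, d ψ - δ φ, d φ + δ ω, d ω)`. -/
def totalBd2 (χ : Γ →* G ⧸ N) : Fun2 Γ N →* Fun3 Γ N where
  toFun x :=
    (bd2 (shiftΓ χ) x.1,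
      fun a b g => bd0 shiftG (x.1 a b) g / bd1 (shiftΓ χ) (fun c => x.2.1 c g) a b,
      fun a g h => bd1 shiftG (x.2.1 a) g h * bd0 (shiftΓ χ) (x.2.2 g h) a,
      bd2 shiftG x.2.2)
  map_one' := by
    refine Prod.ext ?_ (Prod.ext ?_ (Prod.ext ?_ ?_)) <;> funext a b c <;> simp [bd2, bd1, bd0]
  map_mul' x y := by
    refine Prod.ext (bd2_mul _ _ _) (Prod.ext ?_ (Prod.ext ?_ (bd2_mul _ _ _)))
    · funext a b g
      have h : bd1 (shiftΓ χ) (fun c => (x * y).2.1 c g) a b =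
          bd1 (shiftΓ χ) (fun c => x.2.1 c g) a b * bd1 (shiftΓ χ) (fun c => y.2.1 c g) a b :=
        congrFun (congrFun (bd1_mul (shiftΓ χ) (fun c => x.2.1 c g) fun c => y.2.1 c g) a) b
      simp only [h]
      simp only [Prod.fst_mul, Prod.snd_mul, Pi.mul_apply, bd0_mul, mul_div_mul_comm]
    · funext a g h
      simp only [Prod.fst_mul, Prod.snd_mul, Pi.mul_apply, bd0_mul, bd1_mul, mul_mul_mul_comm]

/-- Continuous `1`-cochains `C^{1,0} ⊕ C^{0,1}` (the finite group `Γ` is discrete). -/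
def cochains1 (Γ : Type u) (N : Subgroup G) : Subgroup (Fun1 Γ N) where
  carrier := {x | Continuous x.2}
  one_mem' := continuous_const
  mul_mem' hx hy := hx.mul hy
  inv_mem' hx := hx.inv

/-- Continuous `2`-cochains `C^{2,0} ⊕ C^{1,1} ⊕ C^{0,2}` (the finite group `Γ` is discrete). -/
def cochains2 (Γ : Type u) (N : Subgroup G) : Subgroup (Fun2 Γ N) where
  carrier := {x | (∀ a, Continuous (x.2.1 a)) ∧ Continuous fun p : G × G => x.2.2 p.1 p.2}
  one_mem' := ⟨fun _ => continuous_const, continuous_const⟩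
  mul_mem' hx hy := ⟨fun a => (hx.1 a).mul (hy.1 a), hx.2.mul hy.2⟩
  inv_mem' hx := ⟨fun a => (hx.1 a).inv, hx.2.inv⟩

/-- Continuous total `2`-cocycles. -/
def cocycles2 (χ : Γ →* G ⧸ N) : Subgroup (Fun2 Γ N) := cochains2 Γ N ⊓ (totalBd2 χ).ker

/-- Boundaries of continuous total `1`-cochains. -/
def coboundaries2 (χ : Γ →* G ⧸ N) : Subgroup (Fun2 Γ N) := (cochains1 Γ N).map (totalBd1 χ)

/-- The total continuous cohomology group `H²_cont(Γ, G, M_χ)`. -/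
abbrev H2 (χ : Γ →* G ⧸ N) : Type u :=
  cocycles2 χ ⧸ (coboundaries2 χ).subgroupOf (cocycles2 χ)

/-- Continuous `2`-cocycles of `G` with values in `C(G/N, U(1))`. -/
def cocycles2G (N : Subgroup G) : Subgroup (G → G → Coeff N) where
  carrier := {w | (Continuous fun p : G × G => w p.1 p.2) ∧ bd2 shiftG w = 1}
  one_mem' := ⟨continuous_const, by funext a b c; simp [bd2]⟩
  mul_mem' hx hy := ⟨hx.1.mul hy.1, by rw [bd2_mul, hx.2, hy.2, one_mul]⟩
  inv_mem' {x} hx := ⟨hx.1.inv, by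
    have h := bd2_mul shiftG x x⁻¹
    rw [mul_inv_cancel, hx.2, one_mul] at h
    rw [← h]
    funext a b c
    simp [bd2]⟩

/-- Boundaries of continuous `1`-cochains of `G` with values in `C(G/N, U(1))`. -/
def coboundaries2G (N : Subgroup G) : Subgroup (G → G → Coeff N) where
  carrier := {w | ∃ m : G → Coeff N, Continuous m ∧ bd1 shiftG m = w}
  one_mem' := ⟨1, continuous_const, by funext a b; simp [bd1]⟩
  mul_mem' := by
    rintro _ _ ⟨m, hm, rfl⟩ ⟨n, hn, rfl⟩
    exact ⟨m * n, hm.mul hn, bd1_mul _ _ _⟩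
  inv_mem' := by
    rintro _ ⟨m, hm, rfl⟩
    refine ⟨m⁻¹, hm.inv, eq_inv_of_mul_eq_one_left ?_⟩
    rw [← bd1_mul, inv_mul_cancel]
    funext a b
    simp [bd1]

/-- The continuous cohomology group `H²_cont(G, C(G/N, U(1)))`. -/
abbrev H2G (N : Subgroup G) : Type u :=
  cocycles2G N ⧸ (coboundaries2G N).subgroupOf (cocycles2G N)

/-- The map `(ψ, φ, ω) ↦ ω` on cocycles. -/
def forgetCocycle (χ : Γ →* G ⧸ N) : cocycles2 χ →* cocycles2G N where
  toFun x := ⟨x.1.2.2, x.2.1.2, congrArg (fun y : Fun3 Γ N => y.2.2.2) x.2.2⟩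
  map_one' := rfl
  map_mul' _ _ := rfl

/-- The forgetful map `H²_cont(Γ, G, M_χ) → H²_cont(G, C(G/N, U(1)))`. -/
def forget (χ : Γ →* G ⧸ N) : H2 χ →* H2G N :=
  QuotientGroup.map _ _ (forgetCocycle χ) (by
    rintro x ⟨y, hy, hxy⟩
    exact ⟨y.2, hy, congrArg (fun z : Fun2 Γ N => z.2.2) hxy⟩)

/-- `H^{2,†}_cont(Γ, G, M_χ)`: the kernel of the forgetful map. -/
abbrev H2Dag (χ : Γ →* G ⧸ N) : Subgroup (H2 χ) := (forget χ).ker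

/-- Pullback of cocycles along a homomorphism `f : Γ' → Γ`. -/
def pullbackCocycle (f : Γ' →* Γ) (χ : Γ →* G ⧸ N) : cocycles2 χ →* cocycles2 (χ.comp f) where
  toFun x := ⟨(fun a b => x.1.1 (f a) (f b), fun a g => x.1.2.1 (f a) g, x.1.2.2),
    ⟨fun a => x.2.1.1 (f a), x.2.1.2⟩, by
      have h : totalBd2 χ x.1 = 1 := x.2.2
      have h1 := congrArg (fun y : Fun3 Γ N => y.1) h
      have h2 := congrArg (fun y : Fun3 Γ N => y.2.1) h
      have h3 := congrArg (fun y : Fun3 Γ N => y.2.2.1) h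
      have h4 := congrArg (fun y : Fun3 Γ N => y.2.2.2) h
      refine Prod.ext ?_ (Prod.ext ?_ (Prod.ext ?_ h4))
      · funext a b c
        have e := congrFun (congrFun (congrFun h1 (f a)) (f b)) (f c)
        simpa [totalBd2, bd2, shiftΓ] using e
      · funext a b g
        have e := congrFun (congrFun (congrFun h2 (f a)) (f b)) g
        simpa [totalBd2, bd0, bd1, shiftΓ] using e
      · funext a g k
        exact congrFun (congrFun (congrFun h3 (f a)) g) k⟩
  map_one' := rfl
  map_mul' _ _ := rfl

/-- The pullback `H²_cont(Γ, G, M_χ) → H²_cont(Γ', G, M_{χ ∘ f})`. -/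
def H2.pullback (f : Γ' →* Γ) (χ : Γ →* G ⧸ N) : H2 χ →* H2 (χ.comp f) :=
  QuotientGroup.map _ _ (pullbackCocycle f χ) (by
    rintro x ⟨y, hy, hxy⟩
    refine ⟨(fun a => y.1 (f a), y.2), hy, ?_⟩
    have h1 := congrArg (fun z : Fun2 Γ N => z.1) hxy
    have h2 := congrArg (fun z : Fun2 Γ N => z.2.1) hxy
    have h3 := congrArg (fun z : Fun2 Γ N => z.2.2) hxy
    refine Prod.ext ?_ (Prod.ext ?_ h3)
    · funext a b
      have e := congrFun (congrFun h1 (f a)) (f b)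
      simpa [totalBd1, bd1, shiftΓ, pullbackCocycle] using e
    · funext a g
      exact congrFun (congrFun h2 (f a)) g)

/-- The pullback `H^{2,†}_cont(Γ, G, M_χ) → H^{2,†}_cont(Γ', G, M_{χ ∘ f})`. -/
def H2Dag.pullback (f : Γ' →* Γ) (χ : Γ →* G ⧸ N) : H2Dag χ →* H2Dag (χ.comp f) :=
  ((H2.pullback f χ).comp (H2Dag χ).subtype).codRestrict _ (by
    rintro ⟨c, hc⟩
    obtain ⟨x, rfl⟩ := QuotientGroup.mk_surjective c
    exact hc)

end Cohomology

/-! ### Continuous lifts and the associated classes -/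

section Classes

variable {Γ G : Type u} [Group Γ] [CommGroup G] [TopologicalSpace G]
  [IsTopologicalGroup G] {N : Subgroup G} {χ : Γ →* G ⧸ N}

/-- `lamBar` and `muBar` are continuous unitary lifts of the cocycles `λ` and `μ` of `S`, where
`muBar` is again a cocycle, and `(ψ, φ)` measures their failure to satisfy the remaining
identities:
`lamBar(b, z + χ(a)) lamBar(a, z) = lamBar(ba, z) ψ(a, b, z)` and
`lamBar(a, z + gN) muBar(g, z) = muBar(g, z + χ(a)) lamBar(a, z) φ(a, g, z)`. -/
structure TripleOn.IsLiftedBy {H : Type u} [NormedAddCommGroup H] [InnerProductSpace ℂ H]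
    (S : TripleOn χ H) (lamBar : Γ → G ⧸ N → UnitaryGp H) (muBar : G → G ⧸ N → UnitaryGp H)
    (ψ : Γ → Γ → Coeff N) (φ : Γ → G → Coeff N) : Prop where
  continuous_lamBar : ∀ a, Continuous (lamBar a)
  continuous_muBar : Continuous fun p : G × (G ⧸ N) => muBar p.1 p.2
  Ad_lamBar : ∀ a z, Ad (lamBar a z) = S.lam a z
  Ad_muBar : ∀ g z, Ad (muBar g z) = S.mu g z
  muBar_mul : ∀ (g h : G) z, muBar (g * h) z = muBar h (z * (g : G ⧸ N)) * muBar g z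
  lamBar_mul : ∀ a b z,
    lamBar b (z * χ a) * lamBar a z = lamBar (b * a) z * scalar H (ψ a b z)
  lamBar_muBar : ∀ a (g : G) z,
    lamBar a (z * (g : G ⧸ N)) * muBar g z =
      muBar g (z * χ a) * lamBar a z * scalar H (φ a g z)

end Classes

/-- The annihilator `N^⊥ ⊆ Ĝ` of a subgroup `N ⊆ G`. -/
def annihilator {G : Type u} [CommGroup G] [TopologicalSpace G] (N : Subgroup G) :
    Subgroup (PontryaginDual G) where
  carrier := {x | ∀ n ∈ N, x n = 1}
  one_mem' _ _ := rfl
  mul_mem' {x y} hx hy n hn := by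
    change x n * y n = 1
    rw [hx n hn, hy n hn, one_mul]
  inv_mem' {x} hx n hn := by
    change (x n)⁻¹ = 1
    rw [hx n hn, inv_one]

end

end EquivTriples

open EquivTriples

namespace EquivTriples

noncomputable section

set_option linter.unusedSectionVars false

/-! The classification rests on triples with continuous unitary lifts `lamBar`, `muBar` for which
`muBar` is a genuine cocycle (`TripleOn.IsLiftedBy`). For these the other two relations hold up to
scalar functions `ψ` and `φ`, and comparing scalars in the associativity relations makes `(ψ, φ, 1)`
a total cocycle. The relation `HasClass` records this assignment, and the work is to show that it is
a bijection between `DynDag χ` and `H2Dag χ`.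

Lifting over `G ⧸ N`. A projective function on `G ⧸ N` that intertwines two unitary cocycles lifts
along `G → G ⧸ N` by an explicit formula, and the lift changes under `N` by a character of `N`.
Extending that character continuously to `G` and dividing by it makes the lift descend
(`exists_continuous_lift`). The extension (`exists_extension_character`) comes from the induced
representation on equivariant functions, where `N` acts by scalars: a Gelfand character of the
bicommutant, made continuous by an `L¹` smoothing operator, restricts to the given one on `N`.

Well-definedness and injectivity. Isomorphisms and unitary cocycles carry lifts to lifts with the
same `(ψ, φ)`, and two lifts of one triple differ by scalars, that is by a boundary; the projective
function in an isomorphism is lifted by `exists_continuous_lift`. Conversely, lifts over one Hilbert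
space with equal `(ψ, φ)` differ by a unitary cocycle, and stabilisation by an infinite dimensional
space makes all underlying spaces isomorphic.

Every dualisable class contains a lifted triple. As `N` acts trivially on `G ⧸ N`, a vanishing
Mackey obstruction forces lifts of `μ(n, 1)` to commute. They form an abelian extension of `N` by
the divisible group `Circle`, which splits and gives a representation `σ` of `N`. On `L²(G) ⊗ H ≅
L²(G, H)`, conjugating translation by multiplication with `σ ∘ p`, for a Borel `N`-equivariant `p :
G → N`, extends `ρ|_N ⊗ σ` to a representation `R` of `G`. Tensoring with `ρ` does not change the
stable class, and an isomorphism then turns `μ` into the constant cocycle `Ad R`; now each `λ(a, ·)`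
intertwines `R` with itself and lifts.

Surjectivity. A class with `[ω] = 0` has a representative with `ω = 1`, which a twisted regular
representation on `ℓ²(Γ)` realises. The group law is transported through the bijection, and it is
the tensor product because tensoring lifts multiplies scalars. For the dual statement it is enough
that the annihilator is again discrete and cocompact, where cocompactness uses character extension
once more. -/

theorem isometry_circle_coe : Isometry ((↑) : Circle → ℂ) := fun _ _ => rfl

theorem continuous_circle_iff {X : Type*} [TopologicalSpace X] {f : X → Circle} :
    Continuous f ↔ Continuous fun x => (f x : ℂ) :=
  isometry_circle_coe.isEmbedding.continuous_iff

/-! ### Continuous characters from commuting unitaries, by Gelfand theory -/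

section CharacterOfRepresentation

variable {G E : Type*} [CommGroup G] [TopologicalSpace G] [IsTopologicalGroup G]
  [NormedAddCommGroup E] [InnerProductSpace ℂ E] [CompleteSpace E]

open scoped IsMulCommutative in
/-- A commuting family of unitary operators has a continuous joint spectral value as soon as it acts
norm continuously on some nonzero operator `a` in its bicommutant. -/
theorem exists_character_of_bicommutant (U : G →* (E →L[ℂ] E))
    (hstar : ∀ g, star (U g) = U g⁻¹) (a : E →L[ℂ] E) (ha : a ≠ 0)
    (hcomm : ∀ T : E →L[ℂ] E, (∀ g, U g * T = T * U g) → a * T = T * a)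
    (hcont : Continuous fun g => U g * a) :
    ∃ c : G →* Circle, Continuous c ∧
      ∀ (g : G) (k : Circle), U g = (k : ℂ) • (1 : E →L[ℂ] E) → c g = k := by
  let s : Set (E →L[ℂ] E) := Set.range U
  -- Unitarity makes the family self-adjoint, so the double star-centralizer is the ordinary
  -- bicommutant, which is closed and commutative.
  have hs : s ∪ star s = s := by
    refine Set.union_eq_self_of_subset_right fun T hT => ?_
    obtain ⟨g, hg⟩ := hT
    exact ⟨g⁻¹, by rw [← hstar, hg, star_star]⟩
  let A : StarSubalgebra ℂ (E →L[ℂ] E) :=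
    StarSubalgebra.centralizer ℂ (StarSubalgebra.centralizer ℂ s : Set (E →L[ℂ] E))
  have hA : (A : Set (E →L[ℂ] E)) = s.centralizer.centralizer := by
    have h := StarSubalgebra.coe_centralizer_centralizer ℂ s
    rwa [hs] at h
  have hAcl : IsClosed (A : Set (E →L[ℂ] E)) := by
    rw [hA]; exact Set.isClosed_centralizer _
  have hAcomm : IsMulCommutative A := by
    refine .of_setLike_mul_comm fun x hx y hy => ?_
    rw [← SetLike.mem_coe, hA] at hx hy
    refine Set.centralizer_centralizer_comm_of_comm ?_ _ hx _ hy
    rintro _ ⟨g, rfl⟩ _ ⟨h, rfl⟩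
    rw [← map_mul, ← map_mul, mul_comm]
  have hU : ∀ g, U g ∈ A := fun g => by
    rw [← SetLike.mem_coe, hA]
    exact Set.subset_centralizer_centralizer ⟨g, rfl⟩
  have haA : a ∈ A := by
    rw [← SetLike.mem_coe, hA]
    intro T hT
    exact (hcomm T fun g => hT _ ⟨g, rfl⟩).symm
  let _ : CommCStarAlgebra A := { (inferInstance : CStarAlgebra A) with
    mul_comm := mul_comm }
  let a' : A := ⟨a, haA⟩
  have ha' : a' ≠ 0 := fun h => ha (congrArg Subtype.val h)
  -- The Gelfand transform is isometric, hence some character does not vanish on `a`.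
  obtain ⟨τ, hτ⟩ : ∃ τ : WeakDual.characterSpace ℂ A, τ a' ≠ 0 := by
    by_contra! h
    refine ha' ((gelfandTransform_isometry A).injective ?_)
    ext τ
    simpa using h τ
  let V : G →* A :=
    { toFun := fun g => ⟨U g, hU g⟩
      map_one' := Subtype.ext (map_one U)
      map_mul' := fun g h => Subtype.ext (map_mul U g h) }
  have hVstar : ∀ g, star (V g) = V g⁻¹ := fun g => Subtype.ext (hstar g)
  have hnorm : ∀ g, ‖τ (V g)‖ = 1 := fun g => by
    have h1 : τ (star (V g)) = star (τ (V g)) := map_star τ _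
    have h2 : τ (star (V g)) * τ (V g) = 1 := by
      rw [← map_mul, hVstar, ← map_mul, inv_mul_cancel, map_one, map_one]
    rw [h1] at h2
    have h3 := congrArg norm h2
    rw [norm_mul, norm_star, norm_one] at h3
    nlinarith [norm_nonneg (τ (V g))]
  let c : G →* Circle :=
    { toFun := fun g => ⟨τ (V g), mem_sphere_zero_iff_norm.mpr (hnorm g)⟩
      map_one' := by ext; simp
      map_mul' := fun g h => by ext; simp; rfl }
  have hc : ∀ g, ((c g : Circle) : ℂ) = τ (V g) := fun g => rfl
  refine ⟨c, ?_, fun g k hk => ?_⟩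
  · rw [continuous_circle_iff]
    -- `U` itself need not be norm continuous, but `U g * a` is, and `τ a' ≠ 0` may be divided out.
    have h1 : (fun g => ((c g : Circle) : ℂ)) = fun g => τ (V g * a') / τ a' := by
      funext g
      rw [map_mul, mul_div_cancel_right₀ _ hτ]
      rfl
    rw [h1]
    have h2 : Continuous fun g => V g * a' := Continuous.subtype_mk hcont _
    exact ((map_continuous τ).comp h2).div_const _
  · ext
    rw [hc]
    have : V g = algebraMap ℂ A (k : ℂ) := by
      refine Subtype.ext ?_
      change U g = algebraMap ℂ (E →L[ℂ] E) (k : ℂ)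
      rw [hk, Algebra.algebraMap_eq_smul_one]
    rw [this, AlgHomClass.commutes]
    rfl

end CharacterOfRepresentation

/-! ### Smoothing a strongly continuous representation by integrable functions -/

section Smoothing

variable {G E : Type u} [CommGroup G] [TopologicalSpace G] [IsTopologicalGroup G]
  [T2Space G] [LocallyCompactSpace G] [SecondCountableTopology G] [MeasurableSpace G] [BorelSpace G]
  [NormedAddCommGroup E] [InnerProductSpace ℂ E] [CompleteSpace E]

theorem integrable_smul_rep {R : G →* UnitaryGp E} (hR : Continuous R)
    (f : Lp ℂ 1 (Measure.haar (G := G))) (x : E) :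
    Integrable (fun h => f h • R h x) Measure.haar := by
  have h1 : Continuous fun h => R h x := (continuous_unitary_apply x).comp hR
  refine ((L1.integrable_coeFn f).norm.mul_const ‖x‖).mono'
    ((Lp.aestronglyMeasurable f).smul h1.aestronglyMeasurable) ?_
  exact Filter.Eventually.of_forall fun h => by
    rw [norm_smul, LinearIsometryEquiv.norm_map]

theorem norm_integral_smul_rep_le (R : G →* UnitaryGp E)
    (f : Lp ℂ 1 (Measure.haar (G := G))) (x : E) :
    ‖∫ h, f h • R h x ∂Measure.haar‖ ≤ ‖f‖ * ‖x‖ := by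
  refine (norm_integral_le_integral_norm _).trans (le_of_eq ?_)
  rw [L1.norm_eq_integral_norm, ← integral_mul_const]
  simp only [norm_smul, LinearIsometryEquiv.norm_map]

/-- The smoothing operator `x ↦ ∫ f(h) R(h) x dh` of an integrable function `f`. -/
def smoothing {R : G →* UnitaryGp E} (hR : Continuous R) (f : Lp ℂ 1 (Measure.haar (G := G))) :
    E →L[ℂ] E :=
  LinearMap.mkContinuous
    { toFun := fun x => ∫ h, f h • R h x ∂Measure.haar
      map_add' := fun x y => by
        simp only [map_add, smul_add]
        exact integral_add (integrable_smul_rep hR f x) (integrable_smul_rep hR f y)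
      map_smul' := fun k x => by
        simp only [map_smul, smul_comm _ k, integral_smul, RingHom.id_apply] } ‖f‖
    (norm_integral_smul_rep_le R f)

theorem smoothing_apply {R : G →* UnitaryGp E} (hR : Continuous R)
    (f : Lp ℂ 1 (Measure.haar (G := G))) (x : E) :
    smoothing hR f x = ∫ h, f h • R h x ∂Measure.haar := rfl

theorem norm_smoothing_sub_le {R : G →* UnitaryGp E} (hR : Continuous R)
    (f f' : Lp ℂ 1 (Measure.haar (G := G))) :
    ‖smoothing hR f - smoothing hR f'‖ ≤ ‖f - f'‖ := by
  refine ContinuousLinearMap.opNorm_le_bound _ (norm_nonneg _) fun x => ?_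
  refine le_trans (le_of_eq ?_) (norm_integral_smul_rep_le R (f - f') x)
  rw [sub_apply, smoothing_apply, smoothing_apply,
    ← integral_sub (integrable_smul_rep hR f x) (integrable_smul_rep hR f' x)]
  congr 1
  refine integral_congr_ae ?_
  filter_upwards [Lp.coeFn_sub f f'] with h hh
  rw [hh, Pi.sub_apply, sub_smul]

theorem continuous_smoothing {R : G →* UnitaryGp E} (hR : Continuous R) :
    Continuous (smoothing hR) :=
  (LipschitzWith.of_dist_le_mul (K := 1) fun f f' => by
    rw [dist_eq_norm, dist_eq_norm, NNReal.coe_one, one_mul]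
    exact norm_smoothing_sub_le hR f f').continuous

/-- A unitary operator as a bounded operator. -/
def unitaryOp : UnitaryGp E →* (E →L[ℂ] E) where
  toFun U := (U.toContinuousLinearEquiv : E →L[ℂ] E)
  map_one' := rfl
  map_mul' _ _ := rfl

theorem star_unitaryOp (U : UnitaryGp E) : star (unitaryOp U) = unitaryOp U⁻¹ := by
  rw [ContinuousLinearMap.star_eq_adjoint]
  refine ((ContinuousLinearMap.eq_adjoint_iff _ _).mpr fun x y => ?_).symm
  change inner ℂ (U.symm x) y = inner ℂ x (U y)
  rw [← U.inner_map_map, LinearIsometryEquiv.apply_symm_apply]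

/-- Substituting `h ↦ g⁻¹ * h` moves `R g` onto the function `f`. Translation is norm continuous on
`L¹`, so strong continuity of `R` becomes norm continuity after multiplying by a smoothing operator.
-/
theorem unitaryOp_mul_smoothing {R : G →* UnitaryGp E} (hR : Continuous R)
    (f : Lp ℂ 1 (Measure.haar (G := G))) (g : G) :
    unitaryOp (R g) * smoothing hR f = smoothing hR (DomMulAct.mk g⁻¹ • f) := by
  ext x
  change R g (∫ h, f h • R h x ∂Measure.haar) =
    ∫ h, (DomMulAct.mk g⁻¹ • f : Lp ℂ 1 (Measure.haar (G := G))) h • R h x ∂Measure.haar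
  have h1 : R g (∫ h, f h • R h x ∂Measure.haar) =
      ∫ h, R g (f h • R h x) ∂Measure.haar :=
    ((unitaryOp (R g)).integral_comp_comm (integrable_smul_rep hR f x)).symm
  rw [h1, ← integral_mul_left_eq_self _ g⁻¹]
  refine integral_congr_ae ?_
  filter_upwards [DomMulAct.smul_Lp_ae_eq (DomMulAct.mk g⁻¹) f] with h hh
  rw [hh, map_smul]
  congr 1
  change (R g * R (g⁻¹ * h)) x = _
  rw [← map_mul, mul_inv_cancel_left]

/-- Take the indicator of a compact neighbourhood `V` of `1` on which `R h x` stays within `‖x‖ / 2`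
of `x`. If `∫_V R h x` were zero, then `‖x‖` times the measure of `V` would be at most half of
itself. -/
theorem exists_smoothing_ne_zero [Nontrivial E] {R : G →* UnitaryGp E} (hR : Continuous R) :
    ∃ f, smoothing hR f ≠ 0 := by
  obtain ⟨x, hx⟩ := exists_ne (0 : E)
  have h1 : Continuous fun h => R h x := (continuous_unitary_apply x).comp hR
  have h2 : {h : G | ‖R h x - x‖ < ‖x‖ / 2} ∈ nhds (1 : G) := by
    refine (isOpen_lt (h1.sub continuous_const).norm continuous_const).mem_nhds ?_
    change ‖R 1 x - x‖ < ‖x‖ / 2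
    rw [map_one]
    change ‖x - x‖ < ‖x‖ / 2
    rw [sub_self, norm_zero]
    exact half_pos (norm_pos_iff.mpr hx)
  obtain ⟨V, hV, hV2, hVc⟩ := local_compact_nhds h2
  have hVm : MeasurableSet V := hVc.isClosed.measurableSet
  have hVf : (Measure.haar : Measure G) V ≠ ⊤ := hVc.measure_lt_top.ne
  have hV0 : 0 < (Measure.haar : Measure G).real V :=
    ENNReal.toReal_pos (Measure.measure_pos_of_mem_nhds _ hV).ne' hVf
  refine ⟨indicatorConstLp 1 hVm hVf 1, fun h => ?_⟩
  have h3 : ∫ h in V, R h x ∂Measure.haar = 0 := by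
    have e := DFunLike.congr_fun h x
    rw [smoothing_apply] at e
    rw [← integral_indicator hVm]
    refine Eq.trans (integral_congr_ae ?_) e
    filter_upwards [indicatorConstLp_coeFn (p := 1) (hs := hVm) (hμs := hVf) (c := (1 : ℂ))]
      with h hh
    rw [hh]
    by_cases hm : h ∈ V <;> simp [hm]
  have h4 : IntegrableOn (fun h => R h x) V Measure.haar :=
    h1.continuousOn.integrableOn_compact hVc
  have h5 : ‖∫ h in V, (R h x - x) ∂Measure.haar‖ ≤ ‖x‖ / 2 * (Measure.haar : Measure G).real V :=
    norm_setIntegral_le_of_norm_le_const hVc.measure_lt_top fun h hh => (hV2 hh).le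
  rw [integral_sub h4 (integrableOn_const hVf), h3, zero_sub, norm_neg, setIntegral_const,
    norm_smul, Real.norm_of_nonneg hV0.le] at h5
  have := norm_pos_iff.mpr hx
  nlinarith

/-- A strongly continuous unitary representation of an abelian group admits a continuous character
which restricts to the central character wherever the representation is scalar. -/
theorem exists_character_of_rep {G E : Type u} [CommGroup G] [TopologicalSpace G]
    [IsTopologicalGroup G] [T2Space G] [LocallyCompactSpace G] [SecondCountableTopology G]
    [NormedAddCommGroup E] [InnerProductSpace ℂ E] [CompleteSpace E] [Nontrivial E]
    {R : G →* UnitaryGp E} (hR : Continuous R) :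
    ∃ c : G →* Circle, Continuous c ∧ ∀ (g : G) (k : Circle), R g = scalar E k → c g = k := by
  borelize G
  obtain ⟨f, hf⟩ := exists_smoothing_ne_zero hR
  obtain ⟨c, hc, hk⟩ := exists_character_of_bicommutant (unitaryOp.comp R)
    (fun g => by
      change star (unitaryOp (R g)) = unitaryOp (R g⁻¹)
      rw [star_unitaryOp, map_inv R])
    (smoothing hR f) hf
    (fun T hT => by
      ext x
      change ∫ h, f h • R h (T x) ∂Measure.haar = T (∫ h, f h • R h x ∂Measure.haar)
      rw [← T.integral_comp_comm (integrable_smul_rep hR f x)]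
      congr 1
      funext h
      rw [map_smul]
      exact congrArg _ (DFunLike.congr_fun (hT h) x))
    (by
      have : (fun g => (unitaryOp.comp R) g * smoothing hR f) =
          fun g => smoothing hR (DomMulAct.mk g⁻¹ • f) :=
        funext fun g => unitaryOp_mul_smoothing hR f g
      rw [this]
      refine (continuous_smoothing hR).comp ?_
      have h1 : Continuous fun g : G => (DomMulAct.mk g⁻¹ : Gᵈᵐᵃ) :=
        DomMulAct.continuous_mk.comp continuous_inv
      have : Fact ((1 : ENNReal) ≠ ⊤) := ⟨ENNReal.one_ne_top⟩
      exact h1.smul continuous_const)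
  refine ⟨c, hc, fun g k h => hk g k ?_⟩
  change unitaryOp (R g) = _
  rw [h]
  rfl

end Smoothing

instance {G : Type u} [CommGroup G] [TopologicalSpace G] [IsTopologicalGroup G]
    [LocallyCompactSpace G] (N : Subgroup G) : (haarQuot N).IsHaarMeasure :=
  inferInstanceAs Measure.haar.IsHaarMeasure

/-! ### The induced representation on functions equivariant under a character of `N` -/

section EquivariantFunctions

variable {G : Type u} [CommGroup G] [TopologicalSpace G] [IsTopologicalGroup G]
  {N : Subgroup G}

/-- The continuous functions `F` on `G` with `F(g + n) = κ(n) F(g)` for `n ∈ N`. -/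
def equivariantFuns (κ : N →* Circle) : Submodule ℂ C(G, ℂ) where
  carrier := {F | ∀ (g : G) (n : N), F (g * n) = (κ n : ℂ) * F g}
  zero_mem' _ _ := by simp
  add_mem' hx hy g n := by simp [hx g n, hy g n, mul_add]
  smul_mem' k x hx g n := by simp [hx g n, mul_left_comm]

/-- The space `equivariantFuns κ`, as a type that is to carry the `L²` inner product. -/
def EquivariantFun (κ : N →* Circle) : Type u := equivariantFuns κ

variable {κ : N →* Circle}

instance : AddCommGroup (EquivariantFun κ) := inferInstanceAs (AddCommGroup (equivariantFuns κ))

instance : Module ℂ (EquivariantFun κ) := inferInstanceAs (Module ℂ (equivariantFuns κ))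

namespace EquivariantFun

/-- The underlying continuous function. -/
def toMap (F : EquivariantFun κ) : C(G, ℂ) := Subtype.val (p := (· ∈ equivariantFuns κ)) F

theorem toMap_mul (F : EquivariantFun κ) (g : G) (n : N) :
    F.toMap (g * n) = (κ n : ℂ) * F.toMap g :=
  Subtype.prop (p := (· ∈ equivariantFuns κ)) F g n

theorem toMap_injective : Function.Injective (toMap : EquivariantFun κ → C(G, ℂ)) :=
  Subtype.val_injective

@[simp]
theorem toMap_add (F F' : EquivariantFun κ) : (F + F').toMap = F.toMap + F'.toMap := rfl

@[simp]
theorem toMap_smul (k : ℂ) (F : EquivariantFun κ) : (k • F).toMap = k • F.toMap := rfl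

@[simp]
theorem toMap_sub (F F' : EquivariantFun κ) : (F - F').toMap = F.toMap - F'.toMap := rfl

/-- The function `z ↦ conj (F z) F' z` on `G/N`. -/
def pairing (F F' : EquivariantFun κ) : C(G ⧸ N, ℂ) where
  toFun := Quotient.lift (fun g => starRingEnd ℂ (F.toMap g) * F'.toMap g) (by
    intro g g' h
    obtain ⟨n, hn⟩ : ∃ n : N, g' = g * n :=
      ⟨⟨g⁻¹ * g', QuotientGroup.leftRel_apply.mp h⟩, (mul_inv_cancel_left g g').symm⟩
    have e : starRingEnd ℂ (κ n : ℂ) * (κ n : ℂ) = 1 := by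
      rw [mul_comm, Complex.mul_conj, Circle.normSq_coe, Complex.ofReal_one]
    change _ = starRingEnd ℂ (F.toMap g') * F'.toMap g'
    rw [hn, toMap_mul, toMap_mul, map_mul, mul_mul_mul_comm, e, one_mul])
  continuous_toFun := continuous_quot_lift _ (by fun_prop)

@[simp]
theorem pairing_mk (F F' : EquivariantFun κ) (g : G) :
    pairing F F' (g : G ⧸ N) = starRingEnd ℂ (F.toMap g) * F'.toMap g := rfl

variable [LocallyCompactSpace G] [CompactSpace (G ⧸ N)]

theorem integrable_pairing (F F' : EquivariantFun κ) : Integrable (pairing F F') (haarQuot N) :=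
  (pairing F F').continuous.integrable_of_hasCompactSupport (HasCompactSupport.of_compactSpace _)

/-- The `L²` inner product. -/
@[reducible] def core (κ : N →* Circle) : InnerProductSpace.Core ℂ (EquivariantFun κ) where
  inner F F' := ∫ z, pairing F F' z ∂haarQuot N
  conj_inner_symm F F' := by
    rw [← integral_conj]
    congr 1
    funext z
    obtain ⟨g, rfl⟩ := QuotientGroup.mk_surjective z
    simp [mul_comm]
  re_inner_nonneg F := by
    change 0 ≤ Complex.re _
    rw [← Complex.reCLM_apply, ← Complex.reCLM.integral_comp_comm (integrable_pairing F F)]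
    refine integral_nonneg fun z => ?_
    obtain ⟨g, rfl⟩ := QuotientGroup.mk_surjective z
    rw [Complex.reCLM_apply, pairing_mk, mul_comm, Complex.mul_conj, Complex.ofReal_re]
    exact Complex.normSq_nonneg _
  add_left F F' F'' := by
    rw [← integral_add (integrable_pairing _ _) (integrable_pairing _ _)]
    congr 1
    funext z
    obtain ⟨g, rfl⟩ := QuotientGroup.mk_surjective z
    simp [add_mul]
  smul_left F F' k := by
    rw [← integral_const_mul]
    congr 1
    funext z
    obtain ⟨g, rfl⟩ := QuotientGroup.mk_surjective z
    simp [mul_assoc]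
  definite F h := by
    have h1 : ∫ z, ‖pairing F F z‖ ∂haarQuot N = 0 := by
      have h2 : ∀ z, pairing F F z = (‖pairing F F z‖ : ℂ) := fun z => by
        obtain ⟨g, rfl⟩ := QuotientGroup.mk_surjective z
        rw [pairing_mk, mul_comm, Complex.mul_conj, Complex.norm_real,
          Real.norm_of_nonneg (Complex.normSq_nonneg _)]
      have h3 : ∫ z, ((‖pairing F F z‖ : ℝ) : ℂ) ∂haarQuot N = 0 := by
        rw [← h]
        exact integral_congr_ae (Filter.Eventually.of_forall fun z => (h2 z).symm)
      rw [integral_complex_ofReal] at h3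
      exact_mod_cast h3
    rw [integral_eq_zero_iff_of_nonneg (fun _ => norm_nonneg _) (integrable_pairing F F).norm] at h1
    -- Haar measure charges nonempty open sets, so a continuous function vanishing almost everywhere
    -- vanishes.
    have h4 := (Continuous.ae_eq_iff_eq (haarQuot N) (pairing F F).continuous.norm
      continuous_const).mp h1
    refine toMap_injective (ContinuousMap.ext fun g => ?_)
    have h5 := congrFun h4 (g : G ⧸ N)
    rw [pairing_mk, norm_mul] at h5
    have h6 : ‖F.toMap g‖ = 0 := by
      rw [RCLike.norm_conj] at h5
      exact mul_self_eq_zero.mp h5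
    exact norm_eq_zero.mp h6

instance : NormedAddCommGroup (EquivariantFun κ) :=
  @InnerProductSpace.Core.toNormedAddCommGroup ℂ _ _ _ _ (core κ)

instance : InnerProductSpace ℂ (EquivariantFun κ) := InnerProductSpace.ofCore (core κ).toCore

theorem inner_eq (F F' : EquivariantFun κ) :
    inner ℂ F F' = ∫ z, pairing F F' z ∂haarQuot N := rfl

/-- Translation of equivariant functions by `g`. -/
def translate (g : G) : EquivariantFun κ →ₗᵢ[ℂ] EquivariantFun κ :=
  LinearMap.isometryOfInner
    { toFun := fun F => ⟨F.toMap.comp ⟨fun h => h * g, continuous_mul_const g⟩, fun h n => by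
        change F.toMap (h * n * g) = _ * F.toMap (h * g)
        rw [mul_right_comm, toMap_mul]⟩
      map_add' := fun _ _ => rfl
      map_smul' := fun _ _ => rfl } (fun F F' => by
    rw [inner_eq, inner_eq]
    rw [← integral_mul_right_eq_self (μ := haarQuot N) (fun z => pairing F F' z) (g : G ⧸ N)]
    refine integral_congr_ae (Filter.Eventually.of_forall fun z => ?_)
    obtain ⟨h, rfl⟩ := QuotientGroup.mk_surjective z
    rfl)

@[simp]
theorem translate_toMap (g h : G) (F : EquivariantFun κ) :
    (translate g F).toMap h = F.toMap (h * g) := rfl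

/-- The squared norm of a difference of translates is the integral over the compact space `G ⧸ N` of
a jointly continuous function, so it depends continuously on `g`; at `g₀` it is zero. -/
theorem continuous_translate [SecondCountableTopology G]
    (F : EquivariantFun κ) : Continuous fun g => translate g F := by
  have h0 : ∀ g₀ : G, Continuous fun g => ‖translate g F - translate g₀ F‖ := fun g₀ => by
    have h1 : Continuous fun p : G × (G ⧸ N) =>
        pairing (translate p.1 F - translate g₀ F) (translate p.1 F - translate g₀ F) p.2 := by
      have hq : IsOpenQuotientMap (Prod.map (id : G → G) (QuotientGroup.mk : G → G ⧸ N)) :=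
        IsOpenQuotientMap.id.prodMap QuotientGroup.isOpenQuotientMap_mk
      rw [hq.isQuotientMap.continuous_iff]
      change Continuous fun p : G × G => starRingEnd ℂ (F.toMap (p.2 * p.1) - F.toMap (p.2 * g₀)) *
        (F.toMap (p.2 * p.1) - F.toMap (p.2 * g₀))
      fun_prop
    have h2 := continuous_parametric_integral_of_continuous (μ := haarQuot N)
      (f := fun (g : G) (z : G ⧸ N) =>
        pairing (translate g F - translate g₀ F) (translate g F - translate g₀ F) z)
      h1 isCompact_univ
    rw [Measure.restrict_univ] at h2
    have h3 : (fun g => ‖translate g F - translate g₀ F‖) = fun g => √(Complex.re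
        (∫ z, pairing (translate g F - translate g₀ F) (translate g F - translate g₀ F) z
          ∂haarQuot N)) := by
      funext g
      rw [← inner_eq, norm_eq_sqrt_re_inner (𝕜 := ℂ)]
      rfl
    rw [h3]
    exact (Complex.continuous_re.comp h2).sqrt
  rw [continuous_iff_continuousAt]
  intro g₀
  rw [ContinuousAt, tendsto_iff_norm_sub_tendsto_zero]
  simpa using (h0 g₀).tendsto g₀

/-- Translation of equivariant functions, as a unitary representation of `G`. -/
def translateUnitary (κ : N →* Circle) : G →* UnitaryGp (EquivariantFun κ) where
  toFun g := LinearIsometryEquiv.ofSurjective (translate g) fun F =>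
    ⟨translate g⁻¹ F, toMap_injective (ContinuousMap.ext fun h => by
      rw [translate_toMap, translate_toMap, mul_inv_cancel_right])⟩
  map_one' := LinearIsometryEquiv.ext fun F => toMap_injective (ContinuousMap.ext fun h => by
    change F.toMap (h * 1) = F.toMap h
    rw [mul_one])
  map_mul' g g' := LinearIsometryEquiv.ext fun F => toMap_injective (ContinuousMap.ext fun h => by
    change F.toMap (h * (g * g')) = F.toMap (h * g * g')
    rw [mul_assoc])

/-- There are nonzero equivariant functions. -/
theorem exists_apply_one_ne_zero [T2Space G] [DiscreteTopology N] (κ : N →* Circle) :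
    ∃ F : EquivariantFun κ, F.toMap 1 ≠ 0 := by
  obtain ⟨U, hU, hUN⟩ : ∃ U ∈ nhds (1 : G), U ∩ N = {1} := by
    have h := (discreteTopology_subtype_iff'.mp
      (inferInstanceAs (DiscreteTopology (N : Set G)))) 1 N.one_mem
    obtain ⟨U, hU, hUN⟩ := h
    exact ⟨U, hU.mem_nhds (by
      have : (1 : G) ∈ U ∩ N := by rw [hUN]; rfl
      exact this.1), hUN⟩
  have hcont : Continuous fun p : (G × G) × (G × G) => p.1.1 * p.1.2 * (p.2.1 * p.2.2)⁻¹ := by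
    fun_prop
  -- Quotients of two products from `V` land in `U`, which meets `N` only in `1`; this shape is what
  -- local finiteness of the averaged sum needs.
  obtain ⟨V, hVo, hV1, hVU⟩ : ∃ V : Set G, IsOpen V ∧ 1 ∈ V ∧
      ∀ a ∈ V, ∀ b ∈ V, ∀ c ∈ V, ∀ d ∈ V, a * b * (c * d)⁻¹ ∈ U := by
    have h1 : (fun p : (G × G) × (G × G) => p.1.1 * p.1.2 * (p.2.1 * p.2.2)⁻¹) ⁻¹' U ∈
        nhds (((1, 1), (1, 1)) : (G × G) × (G × G)) :=
      hcont.continuousAt.preimage_mem_nhds (by simpa using hU)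
    rw [nhds_prod_eq, Filter.mem_prod_same_iff] at h1
    obtain ⟨W, hW, hWU⟩ := h1
    rw [nhds_prod_eq, Filter.mem_prod_same_iff] at hW
    obtain ⟨V, hV, hVW⟩ := hW
    obtain ⟨V', hV', ho, h1'⟩ := mem_nhds_iff.mp hV
    exact ⟨V', ho, h1', fun a ha b hb c hc d hd =>
      hWU (Set.mk_mem_prod (hVW (Set.mk_mem_prod (hV' ha) (hV' hb)))
        (hVW (Set.mk_mem_prod (hV' hc) (hV' hd))))⟩
  obtain ⟨φ, hφ0, hφ1, -⟩ := exists_continuous_zero_one_of_isCompact' (X := G) (s := {1})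
    (t := Vᶜ) isCompact_singleton hVo.isClosed_compl
    (Set.disjoint_singleton_left.mpr fun h => h hV1)
  have hφV : ∀ g, φ g ≠ 0 → g ∈ V := fun g hg => by
    by_contra h
    exact hg (hφ0 h)
  -- The equivariant function is the `κ`-twisted sum over `N` of translates of a bump function
  -- supported near `1`.
  let f : N → G → ℂ := fun n g => (κ n : ℂ) * (φ (g * (n : G)⁻¹) : ℂ)
  have hf : ∀ n, Continuous (f n) := fun n => by
    have := φ.continuous
    fun_prop
  have hfV : ∀ n g, f n g ≠ 0 → g * (n : G)⁻¹ ∈ V := fun n g h =>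
    hφV _ fun h0 => h (by simp [f, h0])
  have hlf : LocallyFinite fun n => Function.support (f n) := fun g => by
    refine ⟨(fun x => x * g⁻¹) ⁻¹' V, ?_, ?_⟩
    · exact (hVo.preimage (continuous_mul_const _)).mem_nhds (by simpa using hV1)
    · refine Set.Subsingleton.finite ?_
      rintro n ⟨x, hx1, hx2⟩ m ⟨y, hy1, hy2⟩
      -- If the supports of the `n`-th and `m`-th summands both meet the neighbourhood `V * g` of
      -- `g`, then `m * n⁻¹` is a quotient of two products from `V`, so it lies in `U ∩ N` and is
      -- `1`.
      have h1 := hVU _ (hfV n x hx1) _ hy2 _ (hfV m y hy1) _ hx2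
      have h2 : x * (n : G)⁻¹ * (y * g⁻¹) * (y * (m : G)⁻¹ * (x * g⁻¹))⁻¹ = (m * n⁻¹ : N) := by
        push_cast
        simp only [mul_inv_rev, inv_inv]
        rw [show x * (n : G)⁻¹ * (y * g⁻¹) * (g * x⁻¹ * (m * y⁻¹)) =
          (x * x⁻¹) * (y * y⁻¹) * (g⁻¹ * g) * (m * (n : G)⁻¹) by
            simp only [mul_comm, mul_left_comm, mul_assoc]]
        simp
      rw [h2] at h1
      have h3 : ((m * n⁻¹ : N) : G) ∈ U ∩ N := ⟨h1, (m * n⁻¹ : N).2⟩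
      rw [hUN] at h3
      have h4 : (m * n⁻¹ : N) = 1 := Subtype.ext h3
      exact (mul_inv_eq_one.mp h4).symm
  refine ⟨⟨⟨fun g => ∑ᶠ n, f n g, continuous_finsum hf hlf⟩, fun g m => ?_⟩, ?_⟩
  · change ∑ᶠ n, f n (g * m) = (κ m : ℂ) * ∑ᶠ n, f n g
    have h1 : (κ m : ℂ) * ∑ᶠ n, f n g = ∑ᶠ n, (κ m : ℂ) * f n g :=
      smul_finsum (κ m : ℂ) fun n => f n g
    rw [h1, ← finsum_comp_equiv (Equiv.mulRight m)]
    refine finsum_congr fun n => ?_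
    simp only [f, Equiv.coe_mulRight, map_mul, Circle.coe_mul, Subgroup.coe_mul]
    have h2 : g * (m : G) * ((n : G) * m)⁻¹ = g * (n : G)⁻¹ := by
      rw [mul_inv_rev, mul_assoc, mul_inv_cancel_left]
    rw [h2]
    ring
  · change ∑ᶠ n, f n 1 ≠ 0
    rw [finsum_eq_single (fun n => f n 1) 1]
    · have : φ 1 = 1 := hφ1 rfl
      simp [f, this]
    · intro n hn
      by_contra h
      refine hn ?_
      have h1 := hVU _ (hfV n 1 h) 1 hV1 1 hV1 1 hV1
      have h2 : ((n⁻¹ : N) : G) ∈ U ∩ N := ⟨by simpa using h1, (n⁻¹ : N).2⟩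
      rw [hUN] at h2
      exact inv_eq_one.mp (Subtype.ext h2)

end EquivariantFun

end EquivariantFunctions

/-! ### Extending unitary representations to the completion -/

section CompletionUnitary

variable {E : Type u} [NormedAddCommGroup E] [InnerProductSpace ℂ E]

/-- The extension of a unitary automorphism to the completion. -/
def completionEquiv (U : UnitaryGp E) : UnitaryGp (Completion E) :=
  U.toLinearEquiv.extendOfIsometry
    (Completion.toComplₗᵢ (𝕜 := ℂ) (E := E)).toLinearMap
    (Completion.toComplₗᵢ (𝕜 := ℂ) (E := E)).toLinearMap
    (denseRange_toCompl _) (denseRange_toCompl _)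
    (fun x => by
      change ‖((U x : E) : Completion E)‖ = ‖(x : Completion E)‖
      rw [Completion.norm_coe, Completion.norm_coe, LinearIsometryEquiv.norm_map])

theorem completionEquiv_coe (U : UnitaryGp E) (x : E) :
    completionEquiv U (x : Completion E) = ((U x : E) : Completion E) :=
  LinearEquiv.extendOfIsometry_eq _ _ _ _ _ _ _

theorem unitary_completion_ext {U V : UnitaryGp (Completion E)}
    (h : ∀ x : E, U (x : Completion E) = V (x : Completion E)) : U = V :=
  LinearIsometryEquiv.ext fun t => Completion.induction_on t
    (isClosed_eq (LinearIsometryEquiv.continuous _) (LinearIsometryEquiv.continuous _)) h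

/-- The extension of unitary automorphisms to the completion. -/
def completionUnitary (E : Type u) [NormedAddCommGroup E] [InnerProductSpace ℂ E] :
    UnitaryGp E →* UnitaryGp (Completion E) where
  toFun := completionEquiv
  map_one' := unitary_completion_ext fun a => completionEquiv_coe 1 a
  map_mul' U V := unitary_completion_ext fun a => by
    rw [completionEquiv_coe]
    change _ = completionEquiv U (completionEquiv V a)
    rw [completionEquiv_coe, completionEquiv_coe]
    rfl

@[simp]
theorem completionUnitary_coe (U : UnitaryGp E) (x : E) :
    completionUnitary E U (x : Completion E) = ((U x : E) : Completion E) :=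
  completionEquiv_coe U x

theorem continuous_completionUnitary : Continuous (completionUnitary E) := by
  refine continuous_unitary_iff.mpr fun t => ?_
  refine continuous_of_uniform_approx_of_continuous fun u hu => ?_
  obtain ⟨ε, hε, hεu⟩ := Metric.mem_uniformity_dist.mp hu
  obtain ⟨a, ha⟩ := Completion.denseRange_coe.exists_dist_lt t hε
  refine ⟨fun U => completionUnitary E U (a : Completion E), ?_, fun p => hεu (by
    rwa [LinearIsometryEquiv.dist_map])⟩
  simp only [completionUnitary_coe]
  exact (Completion.continuous_coe _).comp (continuous_unitary_apply a)

end CompletionUnitary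

/-! ### Extension of characters from `N` to `G` -/

section Extension

variable {G : Type u} [CommGroup G] [TopologicalSpace G] [IsTopologicalGroup G]
  [T2Space G] [LocallyCompactSpace G] [SecondCountableTopology G]
  {N : Subgroup G} [DiscreteTopology N] [CompactSpace (G ⧸ N)]

/-- Characters of a discrete cocompact subgroup extend to continuous characters. -/
theorem exists_extension_character (κ : N →* Circle) :
    ∃ c : G →* Circle, Continuous c ∧ ∀ n : N, c n = κ n := by
  obtain ⟨F, hF⟩ := EquivariantFun.exists_apply_one_ne_zero κ
  have : Nontrivial (Completion (EquivariantFun κ)) :=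
    ⟨⟨F, 0, fun h => hF (by
      rw [← Completion.coe_zero, Completion.coe_inj] at h
      rw [h]; rfl)⟩⟩
  have hR : Continuous ((completionUnitary (EquivariantFun κ)).comp
      (EquivariantFun.translateUnitary κ)) :=
    continuous_completionUnitary.comp
      (continuous_unitary_iff.mpr fun F => EquivariantFun.continuous_translate F)
  obtain ⟨c, hc, hk⟩ := exists_character_of_rep hR
  -- Equivariance says exactly that translation by `n` is the scalar `κ n`, on which the joint
  -- spectral value is forced.
  refine ⟨c, hc, fun n => hk n (κ n) ?_⟩
  refine unitary_completion_ext fun a => ?_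
  change completionUnitary _ (EquivariantFun.translateUnitary κ n) a = _
  rw [completionUnitary_coe, scalar_apply, ← Completion.coe_smul]
  congr 1
  exact EquivariantFun.toMap_injective (ContinuousMap.ext fun h => EquivariantFun.toMap_mul a h n)

end Extension

/-! ### Scalars in the unitary group -/

section Scalars

variable {H : Type u} [NormedAddCommGroup H] [InnerProductSpace ℂ H]

theorem continuous_scalar : Continuous (scalar H) :=
  continuous_unitary_iff.mpr fun x => by
    change Continuous fun c : Circle => (c : ℂ) • x
    have : Continuous fun c : Circle => (c : ℂ) := isometry_circle_coe.continuous
    fun_prop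

theorem circle_eq_of_smul_eq {c d : Circle} {x : H} (hx : x ≠ 0)
    (h : (c : ℂ) • x = (d : ℂ) • x) : c = d :=
  Circle.ext (smul_left_injective ℂ hx h)

theorem scalar_injective [Nontrivial H] : Function.Injective (scalar H) := fun c d h => by
  obtain ⟨x, hx⟩ := exists_ne (0 : H)
  exact circle_eq_of_smul_eq hx (DFunLike.congr_fun h x)

/-- The scalar is recovered from its operator as the matrix coefficient at a nonzero vector `x`,
divided by `⟨x, x⟩`. -/
theorem continuous_of_continuous_scalar [Nontrivial H] {Y : Type*} [TopologicalSpace Y]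
    {c : Y → Circle} (h : Continuous fun y => scalar H (c y)) : Continuous c := by
  obtain ⟨x, hx⟩ := exists_ne (0 : H)
  have h1 : Continuous fun y => (c y : ℂ) • x := (continuous_unitary_apply x).comp h
  have h2 : (inner ℂ x x : ℂ) ≠ 0 := inner_self_ne_zero.mpr hx
  rw [continuous_circle_iff]
  have h3 : (fun y => (c y : ℂ)) = fun y => inner ℂ x ((c y : ℂ) • x) / inner ℂ x x := by
    funext y
    rw [inner_smul_right, mul_div_cancel_right₀ _ h2]
  rw [h3]
  exact (continuous_const.inner h1).div_const _

theorem Ad_eq_Ad_iff {U V : UnitaryGp H} : Ad U = Ad V ↔ ∃ c : Circle, V = U * scalar H c := by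
  rw [Ad, QuotientGroup.mk'_apply, QuotientGroup.mk'_apply, QuotientGroup.eq]
  constructor
  · rintro ⟨c, hc⟩
    exact ⟨c, by rw [hc, mul_inv_cancel_left]⟩
  · rintro ⟨c, rfl⟩
    exact ⟨c, by rw [inv_mul_cancel_left]⟩

/-- Two continuous families of unitaries with the same image in `PU(H)` differ by a continuous
family of scalars. -/
theorem exists_continuous_scalar [Nontrivial H] {Y : Type*} [TopologicalSpace Y]
    {U V : Y → UnitaryGp H} (hU : Continuous U) (hV : Continuous V)
    (h : ∀ y, Ad (U y) = Ad (V y)) :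
    ∃ c : C(Y, Circle), ∀ y, V y = U y * scalar H (c y) := by
  choose c hc using fun y => Ad_eq_Ad_iff.mp (h y)
  refine ⟨⟨c, continuous_of_continuous_scalar (H := H) ?_⟩, hc⟩
  have : (fun y => scalar H (c y)) = fun y => (U y)⁻¹ * V y := by
    funext y
    rw [hc, inv_mul_cancel_left]
  rw [this]
  exact hU.inv.mul hV

end Scalars

/-! ### Continuous unitary lifts of projective functions on `G ⧸ N` -/

section Lifting

variable {G : Type u} [CommGroup G] [TopologicalSpace G] [IsTopologicalGroup G]
  [T2Space G] [LocallyCompactSpace G] [SecondCountableTopology G]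
  {N : Subgroup G} [DiscreteTopology N] [CompactSpace (G ⧸ N)]
  {H : Type u} [NormedAddCommGroup H] [InnerProductSpace ℂ H] [Nontrivial H]

/-- A map `G/N → PU(H)` that intertwines two continuous unitary cocycles lifts to `U(H)`. -/
theorem exists_continuous_lift (f : G ⧸ N → PU H) (α β : G → G ⧸ N → UnitaryGp H)
    (hα : Continuous fun g => α g 1) (hβ : Continuous fun g => β g 1)
    (hα' : ∀ (g h : G) z, α (g * h) z = α h (z * (g : G ⧸ N)) * α g z)
    (hβ' : ∀ (g h : G) z, β (g * h) z = β h (z * (g : G ⧸ N)) * β g z)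
    (hf : ∀ (g : G) z, f (z * (g : G ⧸ N)) * Ad (β g z) = Ad (α g z) * f z) :
    ∃ F : G ⧸ N → UnitaryGp H, Continuous F ∧ ∀ z, Ad (F z) = f z := by
  obtain ⟨V, hV⟩ := Ad_surjective (f 1)
  -- The intertwining relation at the base point determines `f` on each coset from `f 1`. Used with
  -- unitaries, it gives a continuous lift on `G`.
  let F₀ : G → UnitaryGp H := fun g => α g 1 * V * (β g 1)⁻¹
  have hF₀ : Continuous F₀ := (hα.mul continuous_const).mul hβ.inv
  have hAd : ∀ g, Ad (F₀ g) = f (g : G ⧸ N) := fun g => by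
    have h := hf g 1
    rw [one_mul] at h
    simp only [F₀, map_mul, map_inv, hV]
    rw [← h, mul_inv_cancel_right]
  have hN : ∀ n : N, ((n : G) : G ⧸ N) = 1 := fun n => (QuotientGroup.eq_one_iff _).mpr n.2
  have hαN : ∀ g (n : N), α (g * n) 1 = α g 1 * α n 1 := fun g n => by
    rw [mul_comm, hα', hN, one_mul]
  have hβN : ∀ g (n : N), β (g * n) 1 = β g 1 * β n 1 := fun g n => by
    rw [mul_comm, hβ', hN, one_mul]
  -- At `n ∈ N` both `F₀ n` and `V` lift `f 1`, so they differ by a scalar; this is the obstruction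
  -- to descending along `G → G ⧸ N`.
  have hκ : ∀ n : N, ∃ c : Circle, α n 1 * V * (β n 1)⁻¹ = V * scalar H c := fun n =>
    Ad_eq_Ad_iff.mp (by rw [hV, hAd, hN])
  choose κ hκ using hκ
  have hmul : ∀ g (n : N), F₀ (g * n) = F₀ g * scalar H (κ n) := fun g n => by
    have h := hκ n
    simp only [F₀, hαN, hβN, mul_inv_rev]
    rw [mul_assoc (α g 1), ← mul_assoc (α g 1 * (α n 1 * V)), mul_assoc (α g 1), h]
    simp only [mul_assoc]
    rw [scalar_comm (κ n) (β g 1)⁻¹]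
  have hκmul : ∀ n m, κ (n * m) = κ n * κ m := fun n m => by
    refine scalar_injective (H := H) (mul_left_cancel (a := F₀ 1) ?_)
    rw [← hmul, map_mul, ← mul_assoc, ← hmul, ← hmul, Subgroup.coe_mul, mul_assoc]
  -- Dividing by an extension of `κ` to `G` removes the obstruction without changing the projective
  -- class.
  obtain ⟨c, hc, hcκ⟩ := exists_extension_character (MonoidHom.mk' κ hκmul)
  have hc' : Continuous fun g => F₀ g * scalar H (c g)⁻¹ :=
    hF₀.mul (continuous_scalar.comp hc.inv)
  refine ⟨Quotient.lift (fun g => F₀ g * scalar H (c g)⁻¹) ?_, continuous_quot_lift _ hc', ?_⟩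
  · intro g g' h
    obtain ⟨n, rfl⟩ : ∃ n : N, g' = g * n :=
      ⟨⟨g⁻¹ * g', QuotientGroup.leftRel_apply.mp h⟩, (mul_inv_cancel_left g g').symm⟩
    have h1 : c n = κ n := hcκ n
    change F₀ g * scalar H (c g)⁻¹ = F₀ (g * n) * scalar H (c (g * n))⁻¹
    rw [hmul, mul_assoc (F₀ g), ← map_mul, map_mul c, h1, mul_inv_rev, mul_inv_cancel_left]
  · intro z
    obtain ⟨g, rfl⟩ := QuotientGroup.mk_surjective z
    change Ad (F₀ g * scalar H (c g)⁻¹) = _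
    rw [map_mul, Ad_scalar, mul_one, hAd]

end Lifting

/-! ### The total cocycle of a lifted triple -/

section Lifts

variable {Γ Γ' G : Type u} [Group Γ] [Group Γ'] [CommGroup G] [TopologicalSpace G]
  [IsTopologicalGroup G] {N : Subgroup G} {χ : Γ →* G ⧸ N}
  {H K : Type u} [NormedAddCommGroup H] [InnerProductSpace ℂ H] [NormedAddCommGroup K]
  [InnerProductSpace ℂ K]

namespace TripleOn

theorem mu_one (S : TripleOn χ H) (z : G ⧸ N) : S.mu 1 z = 1 := by
  have h := S.mu_mul 1 1 z
  rw [QuotientGroup.mk_one, mul_one, mul_one] at h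
  exact left_eq_mul.mp h

theorem lam_one (S : TripleOn χ H) (z : G ⧸ N) : S.lam 1 z = 1 := by
  have h := S.lam_mul 1 1 z
  rw [map_one, mul_one, mul_one] at h
  exact left_eq_mul.mp h

theorem nu_left (S : TripleOn χ H) (a : Γ) (z : G ⧸ N) : S.nu (a, 1) z = S.lam a z := by
  rw [nu, mu_one, mul_one, QuotientGroup.mk_one, mul_one]

theorem nu_right (S : TripleOn χ H) (g : G) (z : G ⧸ N) : S.nu (1, g) z = S.mu g z := by
  rw [nu, lam_one, one_mul]

namespace IsLiftedBy

variable {S : TripleOn χ H} {lamBar : Γ → G ⧸ N → UnitaryGp H} {muBar : G → G ⧸ N → UnitaryGp H}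
  {ψ : Γ → Γ → Coeff N} {φ : Γ → G → Coeff N}

theorem lam_lam_apply (h : S.IsLiftedBy lamBar muBar ψ φ) (a b : Γ) (z : G ⧸ N) (x : H) :
    lamBar b (z * χ a) (lamBar a z x) = (ψ a b z : ℂ) • lamBar (b * a) z x := by
  have e := DFunLike.congr_fun (h.lamBar_mul a b z) x
  simp only [LinearIsometryEquiv.coe_mul, Function.comp_apply, scalar_apply, map_smul] at e
  exact e

theorem lam_mu_apply (h : S.IsLiftedBy lamBar muBar ψ φ) (a : Γ) (g : G) (z : G ⧸ N) (x : H) :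
    lamBar a (z * (g : G ⧸ N)) (muBar g z x) =
      (φ a g z : ℂ) • muBar g (z * χ a) (lamBar a z x) := by
  have e := DFunLike.congr_fun (h.lamBar_muBar a g z) x
  simp only [LinearIsometryEquiv.coe_mul, Function.comp_apply, scalar_apply, map_smul] at e
  exact e

theorem mu_mu_apply (h : S.IsLiftedBy lamBar muBar ψ φ) (g k : G) (z : G ⧸ N) (x : H) :
    muBar k (z * (g : G ⧸ N)) (muBar g z x) = muBar (g * k) z x :=
  (DFunLike.congr_fun (h.muBar_mul g k z) x).symm

/-- Joint continuity of the scalar in `(g, z)` suffices for the compact-open topology, and the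
scalar is the quotient of the two jointly continuous sides of the mixed relation. -/
theorem continuous_phi [Nontrivial H] (h : S.IsLiftedBy lamBar muBar ψ φ) (a : Γ) :
    Continuous (φ a) := by
  refine ContinuousMap.continuous_of_continuous_uncurry _
    (continuous_of_continuous_scalar (H := H) ?_)
  have e : (fun p : G × (G ⧸ N) => scalar H (Function.uncurry (fun g z => φ a g z) p)) =
      fun p => (muBar p.1 (p.2 * χ a) * lamBar a p.2)⁻¹ *
        (lamBar a (p.2 * (p.1 : G ⧸ N)) * muBar p.1 p.2) := by
    funext p
    rw [h.lamBar_muBar, inv_mul_cancel_left]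
    rfl
  rw [e]
  have h1 := h.continuous_muBar
  have h2 := h.continuous_lamBar a
  have h3 : Continuous fun p : G × (G ⧸ N) => muBar p.1 (p.2 * χ a) :=
    h1.comp (continuous_fst.prodMk (continuous_snd.mul continuous_const))
  have h4 : Continuous fun p : G × (G ⧸ N) => lamBar a (p.2 * (p.1 : G ⧸ N)) :=
    h2.comp (continuous_snd.mul (continuous_quot_mk.comp continuous_fst))
  exact (h3.mul (h2.comp continuous_snd)).inv.mul (h4.mul h1)

/-- Each identity comes from evaluating a triple product of lifts at a nonzero vector in two ways
and comparing scalars. The triple products are of types `lamBar`-`lamBar`-`lamBar`,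
`lamBar`-`lamBar`-`muBar` and `lamBar`-`muBar`-`muBar`; the component in bidegree `(0, 3)` is
trivial. -/
theorem mem_cocycles2 [Nontrivial H] (h : S.IsLiftedBy lamBar muBar ψ φ) :
    (ψ, φ, 1) ∈ cocycles2 χ := by
  obtain ⟨x, hx⟩ := exists_ne (0 : H)
  refine ⟨⟨h.continuous_phi, continuous_const⟩, ?_⟩
  refine Prod.ext ?_ (Prod.ext ?_ (Prod.ext ?_ ?_))
  · funext a b c
    ext1 z
    change ψ b c (z * χ a) / ψ (b * a) c z * ψ a (c * b) z / ψ a b z = 1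
    have e : (ψ (b * a) c z * ψ a b z : Circle) = ψ b c (z * χ a) * ψ a (c * b) z := by
      refine circle_eq_of_smul_eq (x := lamBar (c * b * a) z x)
        ((map_ne_zero_iff _ (LinearIsometryEquiv.injective _)).mpr hx) ?_
      have e1 := h.lam_lam_apply b c (z * χ a) (lamBar a z x)
      have e2 : z * χ a * χ b = z * χ (b * a) := by rw [map_mul, mul_assoc, mul_comm (χ b)]
      rw [h.lam_lam_apply a b, e2, map_smul, h.lam_lam_apply (b * a) c, h.lam_lam_apply a (c * b),
        smul_smul, smul_smul,
        ← Circle.coe_mul, ← Circle.coe_mul, ← mul_assoc] at e1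
      rw [mul_comm (ψ (b * a) c z), e1]
    rw [div_mul_eq_mul_div, ← e, mul_div_cancel_left, div_self']
  · funext a b g
    ext1 z
    change ψ a b (z * (g : G ⧸ N)) / ψ a b z /
      (φ b g (z * χ a) / φ (b * a) g z * φ a g z) = 1
    have e : (φ (b * a) g z * ψ a b (z * (g : G ⧸ N)) : Circle) =
        φ b g (z * χ a) * φ a g z * ψ a b z := by
      refine circle_eq_of_smul_eq (x := muBar g (z * χ (b * a)) (lamBar (b * a) z x))
        ((map_ne_zero_iff _ (LinearIsometryEquiv.injective _)).mpr
          ((map_ne_zero_iff _ (LinearIsometryEquiv.injective _)).mpr hx)) ?_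
      have e1 := h.lam_lam_apply a b (z * g) (muBar g z x)
      have e2 : z * χ a * χ b = z * χ (b * a) := by rw [map_mul, mul_assoc, mul_comm (χ b)]
      rw [h.lam_mu_apply, h.lam_mu_apply, mul_right_comm z, map_smul, h.lam_mu_apply, e2,
        h.lam_lam_apply, map_smul, smul_smul, smul_smul, smul_smul, ← Circle.coe_mul,
        ← Circle.coe_mul, ← Circle.coe_mul] at e1
      rw [mul_comm (φ (b * a) g z), ← e1]
      congr 2
      rw [mul_comm (φ b g _)]
    rw [div_div, div_mul_eq_mul_div, mul_div_assoc', mul_comm (ψ a b z), ← e, mul_div_cancel_left,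
      div_self']
  · funext a g k
    ext1 z
    change φ a k (z * (g : G ⧸ N)) / φ a (k * g) z * φ a g z * (1 / 1) = 1
    have e : (φ a (g * k) z : Circle) = φ a k (z * (g : G ⧸ N)) * φ a g z := by
      refine circle_eq_of_smul_eq (x := muBar (g * k) (z * χ a) (lamBar a z x))
        ((map_ne_zero_iff _ (LinearIsometryEquiv.injective _)).mpr
          ((map_ne_zero_iff _ (LinearIsometryEquiv.injective _)).mpr hx)) ?_
      have e1 := h.lam_mu_apply a k (z * g) (muBar g z x)
      have e2 : z * (g : G ⧸ N) * (k : G ⧸ N) = z * ((g * k : G) : G ⧸ N) := by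
        rw [QuotientGroup.mk_mul, mul_assoc]
      rw [h.mu_mu_apply, e2, h.lam_mu_apply, h.lam_mu_apply, map_smul, mul_right_comm z (g : G ⧸ N),
        h.mu_mu_apply, smul_smul, ← Circle.coe_mul] at e1
      exact e1
    rw [mul_comm k g, e, div_self', mul_one, div_mul_eq_mul_div, div_self']
  · funext a b c
    ext1 z
    simp [bd2, totalBd2]

/-- Two lifts of the same triple have cohomologous cocycles. -/
theorem exists_coboundary [Nontrivial H] {lamBar' : Γ → G ⧸ N → UnitaryGp H}
    {muBar' : G → G ⧸ N → UnitaryGp H} {ψ' : Γ → Γ → Coeff N} {φ' : Γ → G → Coeff N}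
    (h : S.IsLiftedBy lamBar muBar ψ φ) (h' : S.IsLiftedBy lamBar' muBar' ψ' φ') :
    ∃ y ∈ cochains1 Γ N, ((ψ', φ', 1) : Fun2 Γ N) = (ψ, φ, 1) * totalBd1 χ y := by
  obtain ⟨x, hx⟩ := exists_ne (0 : H)
  choose c hc using fun a => exists_continuous_scalar (h.continuous_lamBar a)
    (h'.continuous_lamBar a) fun z => by rw [h.Ad_lamBar, h'.Ad_lamBar]
  -- The comparison is made on `G × G ⧸ N` at once, so that `m` is jointly continuous and curries to
  -- a continuous `1`-cochain. Since `muBar` and `muBar'` are both cocycles, its boundary in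
  -- bidegree `(0, 2)` is trivial.
  obtain ⟨m, hm⟩ := exists_continuous_scalar h.continuous_muBar h'.continuous_muBar fun p => by
    rw [h.Ad_muBar, h'.Ad_muBar]
  have hc' : ∀ a z y, lamBar' a z y = (c a z : ℂ) • lamBar a z y := fun a z y => by
    rw [hc]
    exact (lamBar a z).map_smul _ _
  have hm' : ∀ g z y, muBar' g z y = (m (g, z) : ℂ) • muBar g z y := fun g z y => by
    rw [hm (g, z)]
    exact (muBar g z).map_smul _ _
  have hne : ∀ (U : UnitaryGp H) {y : H}, y ≠ 0 → U y ≠ 0 := fun U y hy =>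
    (map_ne_zero_iff _ (LinearIsometryEquiv.injective _)).mpr hy
  refine ⟨(c, m.curry), m.curry.continuous, Prod.ext ?_ (Prod.ext ?_ ?_)⟩
  · funext a b
    ext1 z
    change ψ' a b z = ψ a b z * (c b (z * χ a) / c (b * a) z * c a z)
    have e : (ψ' a b z * c (b * a) z : Circle) = ψ a b z * (c b (z * χ a) * c a z) := by
      refine circle_eq_of_smul_eq (x := lamBar (b * a) z x) (hne _ hx) ?_
      have e1 := h'.lam_lam_apply a b z x
      rw [hc', hc', hc', map_smul, h.lam_lam_apply, smul_smul, smul_smul, smul_smul,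
        ← Circle.coe_mul, ← Circle.coe_mul, ← Circle.coe_mul] at e1
      rw [← e1, mul_comm (ψ a b z)]
    rw [div_mul_eq_mul_div, mul_div_assoc', ← e, mul_div_cancel_right]
  · funext a g
    ext1 z
    change φ' a g z = φ a g z * (c a (z * (g : G ⧸ N)) / c a z /
      (m (g, z * χ a) / m (g, z)))
    have e : (φ' a g z * (m (g, z * χ a) * c a z) : Circle) =
        φ a g z * (c a (z * (g : G ⧸ N)) * m (g, z)) := by
      refine circle_eq_of_smul_eq (x := muBar g (z * χ a) (lamBar a z x)) (hne _ (hne _ hx)) ?_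
      have e1 := h'.lam_mu_apply a g z x
      rw [hc', hm', hm', hc', map_smul, map_smul, h.lam_mu_apply, smul_smul, smul_smul, smul_smul,
        smul_smul, ← Circle.coe_mul, ← Circle.coe_mul, ← Circle.coe_mul, ← Circle.coe_mul] at e1
      rw [← mul_assoc (φ' a g z), ← e1, mul_comm (φ a g z)]
    rw [div_div_div_eq, mul_div_assoc', ← e, mul_comm (c a z), mul_div_cancel_right]
  · funext g k
    ext1 z
    change 1 = 1 * (m (k, z * (g : G ⧸ N)) / m (k * g, z) * m (g, z))
    have e : (m (k * g, z) : Circle) = m (k, z * (g : G ⧸ N)) * m (g, z) := by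
      refine circle_eq_of_smul_eq (x := muBar (g * k) z x) (hne _ hx) ?_
      have e1 := h'.mu_mu_apply g k z x
      rw [hm', hm', hm', map_smul, h.mu_mu_apply, smul_smul, ← Circle.coe_mul] at e1
      rw [mul_comm k g, ← e1]
    rw [e, one_mul, div_mul_eq_mul_div, div_self']

end IsLiftedBy

end TripleOn

end Lifts

/-! ### Transfer of lifts under isomorphism, cocycles, tensor products and pullback -/

section TransferOfLifts

variable {Γ Γ' G : Type u} [Group Γ] [Group Γ'] [CommGroup G] [TopologicalSpace G]
  [IsTopologicalGroup G] {N : Subgroup G} {χ : Γ →* G ⧸ N}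
  {H K : Type u} [NormedAddCommGroup H] [InnerProductSpace ℂ H] [NormedAddCommGroup K]
  [InnerProductSpace ℂ K]

namespace TripleOn

/-- Isomorphic triples are isomorphic over the identity of `G/N`. -/
theorem Iso.exists_over_id {S : TripleOn χ H} {T : TripleOn χ K} (h : Iso S T) :
    ∃ (w : H ≃ₗᵢ[ℂ] K) (v : G ⧸ N → PU K), Continuous v ∧
      (∀ a z, v (z * χ a) * puConj w (S.lam a z) = T.lam a z * v z) ∧
      (∀ (g : G) z, v (z * (g : G ⧸ N)) * puConj w (S.mu g z) = T.mu g z * v z) := by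
  obtain ⟨w, z₀, v, hv, h1, h2⟩ := h
  obtain ⟨k, rfl⟩ := QuotientGroup.mk_surjective z₀
  have hμ : Continuous fun z => T.mu k z := T.continuous_mu.comp (Continuous.prodMk_right k)
  -- The action of `k` on `T` covers translation by `z₀` and commutes with both actions because `G`
  -- is abelian; composing with its inverse removes the translation.
  refine ⟨w, fun z => (T.mu k z)⁻¹ * v z, hμ.inv.mul hv, fun a z => ?_, fun g z => ?_⟩
  · dsimp only
    rw [mul_assoc, h1, inv_mul_eq_iff_eq_mul, ← mul_assoc, ← mul_assoc, ← T.lam_mu,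
      mul_assoc _ (T.mu k z), mul_inv_cancel, mul_one]
  · dsimp only
    have e : T.mu g (z * k) * T.mu k z = T.mu k (z * g) * T.mu g z := by
      rw [← T.mu_mul, ← T.mu_mul, mul_comm]
    rw [mul_assoc, h2, inv_mul_eq_iff_eq_mul, ← mul_assoc, ← mul_assoc, ← e,
      mul_assoc _ (T.mu k z), mul_inv_cancel, mul_one]

theorem mul_scalar_mul_mul_scalar (U V : UnitaryGp H) (c d : Circle) :
    U * scalar H c * (V * scalar H d) = U * V * (scalar H c * scalar H d) := by
  rw [mul_assoc, ← mul_assoc (scalar H c), ← scalar_comm]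
  simp only [mul_assoc]

theorem continuous_unitaryTensor_comp {Y : Type*} [TopologicalSpace Y] {f : Y → UnitaryGp H}
    {g : Y → UnitaryGp K} (hf : Continuous f) (hg : Continuous g) :
    Continuous fun y => unitaryTensor (f y) (g y) := by
  have h := (continuous_unitaryTensor (H := H) (K := K)).comp (hf.prodMk hg)
  simp only [Function.comp_def] at h
  exact h

namespace IsLiftedBy

variable {S : TripleOn χ H} {lamBar : Γ → G ⧸ N → UnitaryGp H} {muBar : G → G ⧸ N → UnitaryGp H}
  {ψ : Γ → Γ → Coeff N} {φ : Γ → G → Coeff N}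

/-- The unitary lift `λ̄(a, z + gN) μ̄(g, z)` of the joint cocycle. -/
def nuBar (lamBar : Γ → G ⧸ N → UnitaryGp H) (muBar : G → G ⧸ N → UnitaryGp H) (x : Γ × G)
    (z : G ⧸ N) : UnitaryGp H := lamBar x.1 (z * (x.2 : G ⧸ N)) * muBar x.2 z

theorem Ad_nuBar (h : S.IsLiftedBy lamBar muBar ψ φ) (x : Γ × G) (z : G ⧸ N) :
    Ad (nuBar lamBar muBar x z) = S.nu x z := by
  rw [nuBar, map_mul, h.Ad_lamBar, h.Ad_muBar, nu]

theorem continuous_nuBar (h : S.IsLiftedBy lamBar muBar ψ φ) (a : Γ) :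
    Continuous fun p : G × (G ⧸ N) => nuBar lamBar muBar (a, p.1) p.2 :=
  ((h.continuous_lamBar a).comp (continuous_snd.mul (continuous_quot_mk.comp continuous_fst))).mul
    h.continuous_muBar

/-- The cocycle identity for `n` holds in the unitary group, not just projectively, so twisting by
`n` creates no new scalars. The mixed relation results from expanding `n (a, g)` through `(a, 1) *
(1, g)` and through `(1, g) * (a, 1)`. -/
theorem of_cocycle {T : TripleOn χ H} (h : S.IsLiftedBy lamBar muBar ψ φ)
    {n : Γ × G → G ⧸ N → UnitaryGp H}
    (hc : ∀ a, Continuous fun p : G × (G ⧸ N) => n (a, p.1) p.2)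
    (hn : ∀ y x z, n (y * x) z = puAct (S.nu x z)⁻¹ (n y (act χ z x)) * n x z)
    (hT : ∀ x z, T.nu x z = S.nu x z * Ad (n x z)) :
    T.IsLiftedBy (fun a z => lamBar a z * n (a, 1) z) (fun g z => muBar g z * n (1, g) z) ψ φ := by
  have hl : ∀ y (a : Γ) z, lamBar a z * n (y * (a, 1)) z =
      n y (z * χ a) * lamBar a z * n (a, 1) z := fun y a z => by
    rw [hn, nu_left, ← h.Ad_lamBar, ← map_inv, puAct_Ad, inv_inv, act, QuotientGroup.mk_one,
      mul_one]
    simp only [mul_assoc, mul_inv_cancel_left]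
  have hm : ∀ y (g : G) z, muBar g z * n (y * (1, g)) z =
      n y (z * (g : G ⧸ N)) * muBar g z * n (1, g) z := fun y g z => by
    rw [hn, nu_right, ← h.Ad_muBar, ← map_inv, puAct_Ad, inv_inv, act, map_one, mul_one]
    simp only [mul_assoc, mul_inv_cancel_left]
  refine ⟨fun a => ?_, h.continuous_muBar.mul (hc 1), fun a z => ?_, fun g z => ?_,
    fun g k z => ?_, fun a b z => ?_, fun a g z => ?_⟩
  · exact (h.continuous_lamBar a).mul ((hc a).comp (Continuous.prodMk_right (1 : G)))
  · rw [map_mul, h.Ad_lamBar, ← nu_left, ← hT, nu_left]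
  · rw [map_mul, h.Ad_muBar, ← nu_right, ← hT, nu_right]
  · have e := hm (1, k) g z
    rw [Prod.mk_mul_mk, one_mul, mul_comm k g] at e
    rw [h.muBar_mul, mul_assoc, e]
    simp only [mul_assoc]
  · have e := hl (b, 1) a z
    rw [Prod.mk_mul_mk, one_mul] at e
    rw [mul_assoc (lamBar b _), ← mul_assoc (n (b, 1) _), ← e, ← mul_assoc, h.lamBar_mul,
      mul_assoc, mul_assoc, scalar_comm (ψ a b z) (n _ z)]
  · have e1 := hl (1, g) a z
    have e2 := hm (a, 1) g z
    rw [Prod.mk_mul_mk, one_mul, mul_one] at e1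
    rw [Prod.mk_mul_mk, one_mul, mul_one] at e2
    rw [mul_assoc (lamBar a _), ← mul_assoc (n (a, 1) _), ← e2, ← mul_assoc, h.lamBar_muBar,
      mul_assoc (muBar g _) (n (1, g) _), ← mul_assoc (n (1, g) _), ← e1]
    simp only [mul_assoc]
    rw [scalar_comm (φ a g z) (n _ z)]

/-- With a unitary lift `V` of the bundle isomorphism, the factors `V` telescope in every relation
and scalars pass through conjugation unchanged, so `(ψ, φ)` is preserved. -/
theorem of_iso {T : TripleOn χ K} (h : S.IsLiftedBy lamBar muBar ψ φ) (w : H ≃ₗᵢ[ℂ] K)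
    {V : G ⧸ N → UnitaryGp K} (hV : Continuous V)
    (h1 : ∀ a z, Ad (V (z * χ a)) * puConj w (S.lam a z) = T.lam a z * Ad (V z))
    (h2 : ∀ (g : G) z, Ad (V (z * (g : G ⧸ N))) * puConj w (S.mu g z) = T.mu g z * Ad (V z)) :
    T.IsLiftedBy (fun a z => V (z * χ a) * unitaryConj w (lamBar a z) * (V z)⁻¹)
      (fun g z => V (z * (g : G ⧸ N)) * unitaryConj w (muBar g z) * (V z)⁻¹) ψ φ := by
  have hw := continuous_unitaryConj w
  refine ⟨fun a => ?_, ?_, fun a z => ?_, fun g z => ?_, fun g k z => ?_, fun a b z => ?_,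
    fun a g z => ?_⟩
  · exact ((hV.comp (continuous_mul_const _)).mul (hw.comp (h.continuous_lamBar a))).mul hV.inv
  · exact ((hV.comp (continuous_snd.mul (continuous_quot_mk.comp continuous_fst))).mul
      (hw.comp h.continuous_muBar)).mul (hV.comp continuous_snd).inv
  · rw [map_mul, map_mul, map_inv, ← puConj_Ad, h.Ad_lamBar, h1, mul_inv_cancel_right]
  · rw [map_mul, map_mul, map_inv, ← puConj_Ad, h.Ad_muBar, h2, mul_inv_cancel_right]
  · rw [h.muBar_mul, map_mul, QuotientGroup.mk_mul]
    simp only [mul_assoc, inv_mul_cancel_left]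
  · have e := congrArg (unitaryConj w) (h.lamBar_mul a b z)
    rw [map_mul, map_mul, unitaryConj_scalar] at e
    simp only [mul_assoc, inv_mul_cancel_left]
    rw [← mul_assoc (unitaryConj w (lamBar b _)), e, map_mul, mul_comm (χ b)]
    simp only [mul_assoc]
    rw [scalar_comm]
  · have e := congrArg (unitaryConj w) (h.lamBar_muBar a g z)
    rw [map_mul, map_mul, map_mul, unitaryConj_scalar] at e
    simp only [mul_assoc, inv_mul_cancel_left]
    rw [← mul_assoc (unitaryConj w (lamBar a _)), e, mul_comm (χ a)]
    simp only [mul_assoc]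
    rw [scalar_comm]

theorem tensor {T : TripleOn χ K} {lamBar' : Γ → G ⧸ N → UnitaryGp K}
    {muBar' : G → G ⧸ N → UnitaryGp K} {ψ' : Γ → Γ → Coeff N} {φ' : Γ → G → Coeff N}
    (h : S.IsLiftedBy lamBar muBar ψ φ) (h' : T.IsLiftedBy lamBar' muBar' ψ' φ') :
    (S.tensor T).IsLiftedBy (fun a z => unitaryTensor (lamBar a z) (lamBar' a z))
      (fun g z => unitaryTensor (muBar g z) (muBar' g z)) (ψ * ψ') (φ * φ') := by
  refine ⟨fun a => ?_, ?_, fun a z => ?_, fun g z => ?_, fun g k z => ?_, fun a b z => ?_,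
    fun a g z => ?_⟩
  · exact continuous_unitaryTensor_comp (h.continuous_lamBar a) (h'.continuous_lamBar a)
  · exact continuous_unitaryTensor_comp h.continuous_muBar h'.continuous_muBar
  · rw [← puTensor_Ad, h.Ad_lamBar, h'.Ad_lamBar]
    rfl
  · rw [← puTensor_Ad, h.Ad_muBar, h'.Ad_muBar]
    rfl
  · rw [h.muBar_mul, h'.muBar_mul, unitaryTensor_mul]
  · change _ = _ * scalar _ (ψ a b z * ψ' a b z)
    rw [← unitaryTensor_scalar, ← unitaryTensor_mul, ← unitaryTensor_mul, h.lamBar_mul,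
      h'.lamBar_mul]
  · change _ = _ * scalar _ (φ a g z * φ' a g z)
    rw [← unitaryTensor_scalar, ← unitaryTensor_mul, ← unitaryTensor_mul, ← unitaryTensor_mul,
      h.lamBar_muBar, h'.lamBar_muBar]

theorem trivial (χ : Γ →* G ⧸ N) (H : Type u) [NormedAddCommGroup H] [InnerProductSpace ℂ H] :
    (TripleOn.trivial χ H).IsLiftedBy (fun _ _ => 1) (fun _ _ => 1) 1 1 := by
  refine ⟨fun _ => continuous_const, continuous_const, fun _ _ => map_one _, fun _ _ => map_one _,
    fun _ _ _ => (one_mul 1).symm, fun _ _ _ => ?_, fun _ _ _ => ?_⟩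
  · change (1 : UnitaryGp H) * 1 = 1 * scalar H 1
    rw [map_one]
  · change (1 : UnitaryGp H) * 1 = 1 * 1 * scalar H 1
    rw [map_one, mul_one, mul_one]

theorem stab (H₀ : Type u) [NormedAddCommGroup H₀] [InnerProductSpace ℂ H₀]
    (h : S.IsLiftedBy lamBar muBar ψ φ) :
    (S.stab H₀).IsLiftedBy (fun a z => unitaryTensor 1 (lamBar a z))
      (fun g z => unitaryTensor 1 (muBar g z)) ψ φ := by
  have e := (trivial χ H₀).tensor h
  rwa [one_mul, one_mul] at e

theorem pullback (f : Γ' →* Γ) (h : S.IsLiftedBy lamBar muBar ψ φ) :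
    (S.pullback f).IsLiftedBy (fun a => lamBar (f a)) muBar (fun a b => ψ (f a) (f b))
      (fun a => φ (f a)) :=
  ⟨fun a => h.continuous_lamBar (f a), h.continuous_muBar, fun a => h.Ad_lamBar (f a), h.Ad_muBar,
    h.muBar_mul, fun a b z => by
      rw [map_mul]
      exact h.lamBar_mul (f a) (f b) z, fun a => h.lamBar_muBar (f a)⟩

/-- Changing the lifts by scalar functions changes `(ψ, φ)` by a coboundary. -/
theorem smul [LocallyCompactSpace G] (h : S.IsLiftedBy lamBar muBar ψ φ) {y : Fun1 Γ N}
    (hy : y ∈ cochains1 Γ N) (hm : bd1 shiftG y.2 = 1) :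
    S.IsLiftedBy (fun a z => lamBar a z * scalar H (y.1 a z))
      (fun g z => muBar g z * scalar H (y.2 g z)) (ψ * (totalBd1 χ y).1)
      (φ * (totalBd1 χ y).2.1) := by
  have hm' : ∀ (g k : G) z, y.2 (g * k) z = y.2 k (z * (g : G ⧸ N)) * y.2 g z := fun g k z => by
    have e : y.2 k (z * (g : G ⧸ N)) / y.2 (k * g) z * y.2 g z = 1 :=
      DFunLike.congr_fun (congrFun (congrFun hm g) k) z
    rw [div_mul_eq_mul_div, div_eq_one] at e
    rw [e, mul_comm k g]
  have hy' : Continuous fun p : G × (G ⧸ N) => y.2 p.1 p.2 :=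
    ContinuousMap.continuous_uncurry_of_continuous ⟨y.2, hy⟩
  refine ⟨fun a => ?_, ?_, fun a z => ?_, fun g z => ?_, fun g k z => ?_, fun a b z => ?_,
    fun a g z => ?_⟩
  · exact (h.continuous_lamBar a).mul (continuous_scalar.comp (y.1 a).continuous)
  · exact h.continuous_muBar.mul (continuous_scalar.comp hy')
  · rw [map_mul, Ad_scalar, mul_one, h.Ad_lamBar]
  · rw [map_mul, Ad_scalar, mul_one, h.Ad_muBar]
  · rw [hm', h.muBar_mul, map_mul]
    simp only [mul_assoc]
    rw [← mul_assoc (muBar g z) (scalar H _), scalar_comm _ (muBar g z), mul_assoc]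
  · change _ = lamBar (b * a) z * scalar H (y.1 (b * a) z) *
      scalar H (ψ a b z * (y.1 b (z * χ a) / y.1 (b * a) z * y.1 a z))
    have e : y.1 (b * a) z * (ψ a b z * (y.1 b (z * χ a) / y.1 (b * a) z * y.1 a z)) =
        ψ a b z * (y.1 b (z * χ a) * y.1 a z) := by
      rw [div_mul_eq_mul_div, mul_left_comm, mul_div_cancel]
    rw [mul_assoc (lamBar (b * a) z), ← map_mul, e, map_mul (scalar H),
      ← mul_assoc (lamBar (b * a) z), ← h.lamBar_mul, map_mul (scalar H)]
    rw [mul_scalar_mul_mul_scalar]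
  · change _ = muBar g (z * χ a) * scalar H (y.2 g (z * χ a)) *
      (lamBar a z * scalar H (y.1 a z)) * scalar H (φ a g z *
        (y.1 a (z * (g : G ⧸ N)) / y.1 a z / (y.2 g (z * χ a) / y.2 g z)))
    have e : y.2 g (z * χ a) * (y.1 a z * (φ a g z *
        (y.1 a (z * (g : G ⧸ N)) / y.1 a z / (y.2 g (z * χ a) / y.2 g z)))) =
        φ a g z * (y.1 a (z * (g : G ⧸ N)) * y.2 g z) := by
      rw [div_div_div_eq, ← mul_assoc, mul_left_comm, mul_comm (y.2 g _) (y.1 a z), mul_div_cancel]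
    rw [mul_scalar_mul_mul_scalar, mul_scalar_mul_mul_scalar, mul_assoc _ _ (scalar H _),
      mul_assoc (scalar H (y.2 _ _)), ← map_mul (scalar H), ← map_mul (scalar H),
      ← map_mul (scalar H), e, map_mul (scalar H) (φ a g z),
      ← mul_assoc (muBar g _ * lamBar a z), ← h.lamBar_muBar]

end IsLiftedBy

end TripleOn

end TransferOfLifts

/-! ### Invariance of the cohomology class -/

section Invariance

variable {Γ G : Type u} [Group Γ] [CommGroup G] [TopologicalSpace G]
  [IsTopologicalGroup G] [T2Space G] [LocallyCompactSpace G] [SecondCountableTopology G]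
  {N : Subgroup G} [DiscreteTopology N] [CompactSpace (G ⧸ N)] {χ : Γ →* G ⧸ N}

open TripleOn

/-- Lifted triples that are stably outer conjugate have cohomologous cocycles. -/
theorem Triple.StablyOuterConj.exists_coboundary {S T : Triple χ} (hST : S.StablyOuterConj T)
    {lamBar : Γ → G ⧸ N → UnitaryGp S.space} {muBar : G → G ⧸ N → UnitaryGp S.space}
    {ψ : Γ → Γ → Coeff N} {φ : Γ → G → Coeff N}
    {lamBar' : Γ → G ⧸ N → UnitaryGp T.space} {muBar' : G → G ⧸ N → UnitaryGp T.space}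
    {ψ' : Γ → Γ → Coeff N} {φ' : Γ → G → Coeff N}
    (h : S.on.IsLiftedBy lamBar muBar ψ φ) (h' : T.on.IsLiftedBy lamBar' muBar' ψ' φ') :
    ∃ y ∈ cochains1 Γ N, ((ψ', φ', 1) : Fun2 Γ N) = (ψ, φ, 1) * totalBd1 χ y := by
  obtain ⟨H₀, _, _, _, _, _, M, _, _, S', T', h1, h2, h3⟩ := hST
  -- The unitary cocycle is moved to the stabilisation of `S` itself, where lifts are available; one
  -- isomorphism over the identity onto the stabilisation of `T` remains.
  obtain ⟨T'', e1, n, hc, hn, hT⟩ := h3.exchange h1.symm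
  obtain ⟨w, v, -, hl, hm⟩ := (e1.symm.trans h2.symm).exists_over_id
  have hS2 := (h.stab H₀).of_cocycle hc hn hT
  have hT1 := h'.stab H₀
  generalize (fun (a : Γ) z => unitaryTensor (1 : UnitaryGp H₀) (lamBar a z) * n (a, 1) z) = lS
    at hS2
  generalize (fun g z => unitaryTensor (1 : UnitaryGp H₀) (muBar g z) * n (1, g) z) = mS at hS2
  generalize (fun (a : Γ) z => unitaryTensor (1 : UnitaryGp H₀) (lamBar' a z)) = lT at hT1
  generalize (fun g z => unitaryTensor (1 : UnitaryGp H₀) (muBar' g z)) = mT at hT1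
  -- The projective function `v` intertwines the cocycles lifted by `mS` (conjugated by `w`) and
  -- `mT`, which is the situation in which it lifts to unitaries.
  obtain ⟨V, hV, hVv⟩ := exists_continuous_lift v mT (fun g z => unitaryConj w (mS g z))
    (hT1.continuous_muBar.comp (Continuous.prodMk_left 1))
    ((continuous_unitaryConj w).comp (hS2.continuous_muBar.comp (Continuous.prodMk_left 1)))
    hT1.muBar_mul (fun g k z => by rw [hS2.muBar_mul, map_mul]) (fun g z => by
      rw [← puConj_Ad, hS2.Ad_muBar, hT1.Ad_muBar, hm])
  have hT2 := hS2.of_iso w hV (fun a z => by rw [hVv, hVv, hl]) (fun g z => by rw [hVv, hVv, hm])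
  exact hT2.exists_coboundary hT1

end Invariance

/-! ### Infinite dimensional separable Hilbert spaces -/

section SeparableHilbert

/-- Orthonormal vectors are at distance `√2`, so balls of radius `1 / 2` around them are disjoint
nonempty open sets in a separable space. -/
theorem countable_of_orthonormal {ι E : Type*} [NormedAddCommGroup E] [InnerProductSpace ℂ E]
    [TopologicalSpace.SeparableSpace E] {v : ι → E} (hv : Orthonormal ℂ v) : Countable ι := by
  have hd : ∀ i j, i ≠ j → 1 ≤ dist (v i) (v j) := fun i j hij => by
    have h1 : ‖v i - v j‖ ^ 2 = 2 := by
      rw [@norm_sub_sq ℂ, hv.1, hv.1, hv.2 hij]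
      norm_num
    rw [dist_eq_norm]
    nlinarith [norm_nonneg (v i - v j)]
  have h : Pairwise (Function.onFun Disjoint fun i => Metric.ball (v i) (1 / 2)) :=
    fun i j hij => Metric.ball_disjoint_ball (by linarith [hd i j hij])
  exact Pairwise.countable_of_isOpen_disjoint h (fun _ => Metric.isOpen_ball)
    fun i => ⟨v i, Metric.mem_ball_self (by norm_num)⟩

theorem exists_hilbertBasis_nat (E : Type*) [NormedAddCommGroup E] [InnerProductSpace ℂ E]
    [CompleteSpace E] [TopologicalSpace.SeparableSpace E] (hE : ¬ FiniteDimensional ℂ E) :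
    Nonempty (HilbertBasis ℕ ℂ E) := by
  obtain ⟨w, b, -⟩ := exists_hilbertBasis ℂ E
  have : Countable w := countable_of_orthonormal b.orthonormal
  have : Infinite w := by
    by_contra h
    rw [not_infinite_iff_finite] at h
    have := Fintype.ofFinite w
    exact hE b.toOrthonormalBasis.toBasis.finiteDimensional_of_finite
  obtain ⟨e⟩ := nonempty_denumerable w
  let f : ℕ ≃ w := (Denumerable.eqv w).symm
  refine ⟨HilbertBasis.mk (b.orthonormal.comp f f.injective) ?_⟩
  rw [Set.range_comp, f.surjective.range_eq, Set.image_univ, b.dense_span]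

/-- All infinite dimensional separable Hilbert spaces are isomorphic. -/
theorem nonempty_unitary (E F : Type*) [NormedAddCommGroup E] [InnerProductSpace ℂ E]
    [CompleteSpace E] [TopologicalSpace.SeparableSpace E] [NormedAddCommGroup F]
    [InnerProductSpace ℂ F] [CompleteSpace F] [TopologicalSpace.SeparableSpace F]
    (hE : ¬ FiniteDimensional ℂ E) (hF : ¬ FiniteDimensional ℂ F) : Nonempty (E ≃ₗᵢ[ℂ] F) := by
  obtain ⟨b⟩ := exists_hilbertBasis_nat E hE
  obtain ⟨c⟩ := exists_hilbertBasis_nat F hF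
  exact ⟨b.repr.trans c.repr.symm⟩

/-- The standard infinite dimensional separable Hilbert space, in the universe `u`. -/
abbrev StdHilbert : Type u := lp (fun _ : ULift.{u} ℕ => ℂ) 2

/-- The standard basis. -/
def stdBasis : HilbertBasis (ULift.{u} ℕ) ℂ StdHilbert.{u} :=
  HilbertBasis.ofRepr (LinearIsometryEquiv.refl ℂ _)

instance : TopologicalSpace.SeparableSpace StdHilbert.{u} := by
  have h1 : TopologicalSpace.IsSeparable (closure
      (Submodule.span ℂ (Set.range (stdBasis.{u} : ULift.{u} ℕ → StdHilbert.{u})) :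
        Set StdHilbert.{u})) :=
    (Set.countable_range _).isSeparable.span.closure
  rw [← Submodule.topologicalClosure_coe, stdBasis.dense_span, Submodule.top_coe] at h1
  exact TopologicalSpace.isSeparable_univ_iff.mp h1

theorem stdHilbert_infinite : ¬ FiniteDimensional ℂ StdHilbert.{u} := fun h => by
  have := stdBasis.{u}.orthonormal.linearIndependent.finite
  exact (not_finite (ULift.{u} ℕ))

instance : Nontrivial StdHilbert.{u} := by
  by_contra h
  rw [not_nontrivial_iff_subsingleton] at h
  exact stdHilbert_infinite.{u} inferInstance

/-- Tensoring with a fixed vector. -/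
def htmulRight {H K : Type u} [NormedAddCommGroup H] [InnerProductSpace ℂ H]
    [NormedAddCommGroup K] [InnerProductSpace ℂ K] (y : K) : H →ₗ[ℂ] HTensor H K :=
  (Completion.toComplₗᵢ (𝕜 := ℂ) (E := H ⊗[ℂ] K)).toLinearMap ∘ₗ
    (TensorProduct.mk ℂ H K).flip y

theorem norm_htmul {H K : Type u} [NormedAddCommGroup H] [InnerProductSpace ℂ H]
    [NormedAddCommGroup K] [InnerProductSpace ℂ K] (x : H) (y : K) :
    ‖htmul x y‖ = ‖x‖ * ‖y‖ := by
  simp [htmul]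

theorem htensor_infinite {H K : Type u} [NormedAddCommGroup H] [InnerProductSpace ℂ H]
    [NormedAddCommGroup K] [InnerProductSpace ℂ K] [Nontrivial K]
    (hH : ¬ FiniteDimensional ℂ H) : ¬ FiniteDimensional ℂ (HTensor H K) := fun h => by
  obtain ⟨y, hy⟩ := exists_ne (0 : K)
  refine hH (FiniteDimensional.of_injective (htmulRight y) ?_)
  rw [injective_iff_map_eq_zero]
  intro x hx
  have h1 : ‖htmul x y‖ = 0 := by
    rw [norm_eq_zero]
    exact hx
  rw [norm_htmul] at h1
  exact norm_eq_zero.mp ((mul_eq_zero.mp h1).resolve_right (norm_ne_zero_iff.mpr hy))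

end SeparableHilbert

/-! ### Cohomologous lifted triples are stably outer conjugate -/

section Stability

variable {Γ G : Type u} [Group Γ] [CommGroup G] [TopologicalSpace G]
  [IsTopologicalGroup G] {N : Subgroup G} {χ : Γ →* G ⧸ N}

open TripleOn

theorem Triple.StablyOuterConj.of_outerConj {S T : Triple χ} (h : OuterConj S.on T.on) :
    S.StablyOuterConj T :=
  ⟨StdHilbert.{u}, _, _, inferInstance, inferInstance, inferInstance, h.stab⟩

/-- The stabilisation of a triple by a separable Hilbert space. -/
def Triple.stab (K : Type u) [NormedAddCommGroup K] [InnerProductSpace ℂ K]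
    [TopologicalSpace.SeparableSpace K] [Nontrivial K] (S : Triple χ) : Triple χ where
  space := HTensor K S.space
  on := S.on.stab K

/-- An infinite dimensional separable space absorbs `K` in the tensor product, so after stabilising
by it the additional factor `K` disappears. -/
theorem Triple.stablyOuterConj_stab (K : Type u) [NormedAddCommGroup K] [InnerProductSpace ℂ K]
    [TopologicalSpace.SeparableSpace K] [Nontrivial K] (S : Triple χ) :
    S.StablyOuterConj (S.stab K) := by
  obtain ⟨w⟩ := nonempty_unitary StdHilbert.{u} (HTensor StdHilbert.{u} K)
    stdHilbert_infinite (htensor_infinite stdHilbert_infinite)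
  exact ⟨StdHilbert.{u}, _, _, inferInstance, inferInstance, inferInstance,
    OuterConj.of_iso (((Iso.refl S.on).stab_map w).trans (iso_stab_stab S.on))⟩

/-- Lifts with the same `(ψ, φ)` over the same Hilbert space differ by a unitary cocycle. -/
theorem TripleOn.IsLiftedBy.cocycleEquiv {H : Type u} [NormedAddCommGroup H]
    [InnerProductSpace ℂ H] {S T : TripleOn χ H}
    {lamBar : Γ → G ⧸ N → UnitaryGp H} {muBar : G → G ⧸ N → UnitaryGp H}
    {ψ : Γ → Γ → Coeff N} {φ : Γ → G → Coeff N}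
    {lamBar' : Γ → G ⧸ N → UnitaryGp H} {muBar' : G → G ⧸ N → UnitaryGp H}
    (h : S.IsLiftedBy lamBar muBar ψ φ) (h' : T.IsLiftedBy lamBar' muBar' ψ φ) :
    CocycleEquiv S T := by
  -- The failure of `nuBar` to be a cocycle is a scalar depending on `ψ` and `φ` only, so it is the
  -- same for both lifts.
  have key : ∀ {S : TripleOn χ H} {lamBar : Γ → G ⧸ N → UnitaryGp H}
      {muBar : G → G ⧸ N → UnitaryGp H} (_ : S.IsLiftedBy lamBar muBar ψ φ) (y x : Γ × G)
      (z : G ⧸ N), nuBar lamBar muBar y (act χ z x) * nuBar lamBar muBar x z =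
        nuBar lamBar muBar (y * x) z * scalar H ((φ x.1 y.2 (z * (x.2 : G ⧸ N)))⁻¹ *
          ψ x.1 y.1 (z * ((x.2 * y.2 : G) : G ⧸ N))) := by
    intro S lamBar muBar h ⟨b, k⟩ ⟨a, g⟩ z
    have e1 := h.lamBar_muBar a k (z * g)
    have e2 := h.lamBar_mul a b (z * ((g * k : G) : G ⧸ N))
    have e3 := h.muBar_mul g k z
    have c1 : z * (g : G ⧸ N) * (k : G ⧸ N) = z * ((g * k : G) : G ⧸ N) := by
      rw [QuotientGroup.mk_mul, mul_assoc]
    have c2 : act χ z (a, g) * (k : G ⧸ N) = z * ((g * k : G) : G ⧸ N) * χ a := by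
      rw [act, QuotientGroup.mk_mul, mul_right_comm z, mul_right_comm _ (χ a), mul_assoc z]
    have c3 : act χ z (a, g) = z * g * χ a := by
      rw [act, mul_right_comm]
    have e1' : muBar k (z * g * χ a) * lamBar a (z * g) =
        lamBar a (z * ((g * k : G) : G ⧸ N)) * muBar k (z * g) *
          scalar H (φ a k (z * g))⁻¹ := by
      rw [← c1, e1, mul_assoc _ (scalar H _), ← map_mul, mul_inv_cancel, map_one, mul_one]
    have e4 : muBar (k * g) z = muBar k (z * g) * muBar g z := by rw [mul_comm, e3]
    simp only [nuBar, Prod.mk_mul_mk, c2]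
    rw [c3, mul_assoc (lamBar b _), ← mul_assoc (muBar k _), e1', e4, mul_comm k g]
    have e5 : ∀ (A B C D : UnitaryGp H) (c : Circle), A * (B * C * scalar H c * D) =
        A * B * (C * D) * scalar H c := fun A B C D c => by
      simp only [mul_assoc]
      rw [← scalar_comm]
    rw [e5, e2, mul_assoc (lamBar (b * a) _) (scalar H _), ← scalar_comm, map_mul (scalar H)]
    simp only [mul_assoc]
    rw [← map_mul (scalar H), ← map_mul (scalar H), mul_comm (ψ a b _)]
  -- In the quotient of the two joint lifts these equal scalar defects cancel, leaving an exact
  -- unitary cocycle.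
  refine ⟨fun x z => (nuBar lamBar muBar x z)⁻¹ * nuBar lamBar' muBar' x z, fun a =>
    (h.continuous_nuBar a).inv.mul (h'.continuous_nuBar a), fun y x z => ?_, fun x z => ?_⟩
  · have e := key h y x z
    have e' := key h' y x z
    dsimp only
    rw [← h.Ad_nuBar, ← map_inv (Ad (H := H)), puAct_Ad, inv_inv]
    have h1 : ∀ (A B P A' B' P' : UnitaryGp H) (c : Circle), A * B = P * scalar H c →
        A' * B' = P' * scalar H c → P⁻¹ * P' = B⁻¹ * (A⁻¹ * A') * B * (B⁻¹ * B') := by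
      intro A B P A' B' P' c h1 h2
      have h3 : B⁻¹ * (A⁻¹ * A') * B * (B⁻¹ * B') = (A * B)⁻¹ * (A' * B') := by group
      rw [h3, h1, h2, mul_inv_rev, mul_assoc, ← mul_assoc P⁻¹ P', ← map_inv (scalar H),
        ← mul_assoc, ← scalar_comm, mul_assoc, ← map_mul (scalar H), inv_mul_cancel, map_one,
        mul_one]
    exact h1 _ _ _ _ _ _ _ e e'
  · rw [map_mul, map_inv, h.Ad_nuBar, h'.Ad_nuBar, mul_inv_cancel_left]

/-- Lifted triples with cohomologous cocycles are stably outer conjugate. -/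
theorem Triple.stablyOuterConj_of_coboundary [LocallyCompactSpace G] {S T : Triple χ}
    {lamBar : Γ → G ⧸ N → UnitaryGp S.space} {muBar : G → G ⧸ N → UnitaryGp S.space}
    {ψ : Γ → Γ → Coeff N} {φ : Γ → G → Coeff N}
    {lamBar' : Γ → G ⧸ N → UnitaryGp T.space} {muBar' : G → G ⧸ N → UnitaryGp T.space}
    {ψ' : Γ → Γ → Coeff N} {φ' : Γ → G → Coeff N}
    (h : S.on.IsLiftedBy lamBar muBar ψ φ) (h' : T.on.IsLiftedBy lamBar' muBar' ψ' φ')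
    {y : Fun1 Γ N} (hy : y ∈ cochains1 Γ N)
    (hc : ((ψ', φ', 1) : Fun2 Γ N) = (ψ, φ, 1) * totalBd1 χ y) : S.StablyOuterConj T := by
  have h1 : ψ' = ψ * (totalBd1 χ y).1 := congrArg (fun x : Fun2 Γ N => x.1) hc
  have h2 : φ' = φ * (totalBd1 χ y).2.1 := congrArg (fun x : Fun2 Γ N => x.2.1) hc
  -- Both cocycles have trivial last entry, so the rescaled `muBar` remains a cocycle.
  have h3 : bd1 shiftG y.2 = 1 := by
    have e : (1 : G → G → Coeff N) = 1 * bd1 shiftG y.2 :=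
      congrArg (fun x : Fun2 Γ N => x.2.2) hc
    rw [e, one_mul]
  have hS := (h.smul hy h3).stab StdHilbert.{u}
  rw [← h1, ← h2] at hS
  have hT := h'.stab StdHilbert.{u}
  -- Stabilising makes both spaces infinite dimensional and separable, so they can be identified and
  -- the two lifts compared over a single space.
  obtain ⟨w⟩ := nonempty_unitary (HTensor StdHilbert.{u} S.space) (HTensor StdHilbert.{u} T.space)
    (htensor_infinite stdHilbert_infinite) (htensor_infinite stdHilbert_infinite)
  have hS' := hS.of_iso (T := (S.on.stab StdHilbert.{u}).transport w 1 (fun _ => 1) continuous_const) w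
    (V := fun _ => 1) continuous_const (fun a z => by simp [transport])
    (fun g z => by simp [transport])
  exact ⟨StdHilbert.{u}, _, _, inferInstance, inferInstance, inferInstance, _, _, _, _, _,
    iso_transport _ w 1 (fun _ => 1) continuous_const, Iso.refl _, hS'.cocycleEquiv hT⟩

end Stability

/-! ### Compatibility of tensor products with stable outer conjugation -/

section TensorCompatibility

variable {Γ Γ' G : Type u} [Group Γ] [Group Γ'] [CommGroup G] [TopologicalSpace G]
  [IsTopologicalGroup G] {N : Subgroup G} {χ : Γ →* G ⧸ N}
  {H K L : Type u} [NormedAddCommGroup H] [InnerProductSpace ℂ H] [NormedAddCommGroup K]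
  [InnerProductSpace ℂ K] [NormedAddCommGroup L] [InnerProductSpace ℂ L]

namespace TripleOn

theorem puConj_refl (p : PU H) : puConj (LinearIsometryEquiv.refl ℂ H) p = p := by
  obtain ⟨U, rfl⟩ := Ad_surjective p
  rfl

theorem puConj_tensorComm (p : PU H) (q : PU K) :
    puConj (tensorComm H K) (puTensor p q) = puTensor q p := by
  obtain ⟨U, rfl⟩ := Ad_surjective p
  obtain ⟨V, rfl⟩ := Ad_surjective q
  rw [puTensor_Ad, puConj_Ad, puTensor_Ad]
  congr 1
  have : (tensorComm H K).trans (unitaryConj (tensorComm H K) (unitaryTensor U V)) =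
      (tensorComm H K).trans (unitaryTensor V U) :=
    unitary_ext fun x y => by
      rw [LinearIsometryEquiv.trans_apply, LinearIsometryEquiv.trans_apply, unitaryConj_apply,
        LinearIsometryEquiv.symm_apply_apply, unitaryTensor_htmul, tensorComm_htmul,
        tensorComm_htmul, unitaryTensor_htmul]
  ext t
  obtain ⟨t, rfl⟩ := (tensorComm H K).surjective t
  exact DFunLike.congr_fun this t

theorem puConj_tensorAssoc (p : PU H) (q : PU K) (r : PU L) :
    puConj (tensorAssoc H K L) (puTensor (puTensor p q) r) = puTensor p (puTensor q r) := by
  obtain ⟨U, rfl⟩ := Ad_surjective p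
  obtain ⟨V, rfl⟩ := Ad_surjective q
  obtain ⟨W, rfl⟩ := Ad_surjective r
  rw [puTensor_Ad, puTensor_Ad, puConj_Ad, puTensor_Ad, puTensor_Ad]
  congr 1
  have : (tensorAssoc H K L).trans
      (unitaryConj (tensorAssoc H K L) (unitaryTensor (unitaryTensor U V) W)) =
      (tensorAssoc H K L).trans (unitaryTensor U (unitaryTensor V W)) :=
    unitary_ext₃ fun x y z => by
      rw [LinearIsometryEquiv.trans_apply, LinearIsometryEquiv.trans_apply, unitaryConj_apply,
        LinearIsometryEquiv.symm_apply_apply, unitaryTensor_htmul, unitaryTensor_htmul,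
        tensorAssoc_htmul, tensorAssoc_htmul, unitaryTensor_htmul, unitaryTensor_htmul]
  ext t
  obtain ⟨t, rfl⟩ := (tensorAssoc H K L).surjective t
  exact DFunLike.congr_fun this t

theorem iso_tensor_comm (S : TripleOn χ H) (T : TripleOn χ K) : Iso (S.tensor T) (T.tensor S) :=
  iso_of_conj (tensorComm H K) (fun _ _ => puConj_tensorComm _ _)
    (fun _ _ => puConj_tensorComm _ _)

theorem iso_stab_tensor (H₀ : Type u) [NormedAddCommGroup H₀] [InnerProductSpace ℂ H₀]
    (S : TripleOn χ H) (T : TripleOn χ K) :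
    Iso ((S.stab H₀).tensor T) ((S.tensor T).stab H₀) :=
  iso_of_conj (tensorAssoc H₀ H K) (fun a z => puConj_tensorAssoc 1 (S.lam a z) (T.lam a z))
    (fun g z => puConj_tensorAssoc 1 (S.mu g z) (T.mu g z))

/-- The factor `T` is left alone, so the isomorphism on the other factor must not translate `G ⧸ N`;
`Iso.exists_over_id` arranges this. -/
theorem Iso.tensor_right {S : TripleOn χ H} {S' : TripleOn χ K} (h : Iso S S')
    (T : TripleOn χ L) : Iso (S.tensor T) (S'.tensor T) := by
  obtain ⟨w, v, hv, h1, h2⟩ := h.exists_over_id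
  refine ⟨unitaryTensor w (LinearIsometryEquiv.refl ℂ L), 1, fun z => puTensor (v z) 1,
    continuous_puTensor.comp (hv.prodMk continuous_const), fun a z => ?_, fun g z => ?_⟩
  · change _ * puConj _ (puTensor (S.lam a z) (T.lam a z)) =
      puTensor (S'.lam a _) (T.lam a _) * _
    rw [puTensor_puConj, puConj_refl, ← puTensor_mul, ← puTensor_mul, mul_one, h1, one_mul, mul_one]
  · change _ * puConj _ (puTensor (S.mu g z) (T.mu g z)) =
      puTensor (S'.mu g _) (T.mu g _) * _
    rw [puTensor_puConj, puConj_refl, ← puTensor_mul, ← puTensor_mul, mul_one, h2, one_mul, mul_one]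

theorem nu_tensor (S : TripleOn χ H) (T : TripleOn χ K) (x : Γ × G) (z : G ⧸ N) :
    (S.tensor T).nu x z = puTensor (S.nu x z) (T.nu x z) := by
  have e : (S.tensor T).nu x z =
      puTensor (S.lam x.1 (z * (x.2 : G ⧸ N))) (T.lam x.1 (z * (x.2 : G ⧸ N))) *
        puTensor (S.mu x.2 z) (T.mu x.2 z) := rfl
  rw [e, ← puTensor_mul, nu, nu]

theorem puTensor_inv_inv (p : PU H) (q : PU K) : (puTensor p q)⁻¹ = puTensor p⁻¹ q⁻¹ := by
  rw [inv_eq_iff_mul_eq_one, ← puTensor_mul, mul_inv_cancel, mul_inv_cancel, puTensor_one]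

theorem puAct_tensor_one (p : PU H) (q : PU K) (U : UnitaryGp H) :
    puAct (puTensor p q) (unitaryTensor U 1) = unitaryTensor (puAct p U) 1 := by
  obtain ⟨V, rfl⟩ := Ad_surjective p
  obtain ⟨W, rfl⟩ := Ad_surjective q
  rw [puTensor_Ad, puAct_Ad, puAct_Ad, mul_inv_eq_iff_eq_mul, ← unitaryTensor_mul,
    ← unitaryTensor_mul, inv_mul_cancel_right, one_mul, mul_one]

theorem CocycleEquiv.tensor_right {S S' : TripleOn χ H} (h : CocycleEquiv S S')
    (T : TripleOn χ L) : CocycleEquiv (S.tensor T) (S'.tensor T) := by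
  obtain ⟨n, hc, hn, hST⟩ := h
  refine ⟨fun x z => unitaryTensor (n x z) 1, fun a => ?_, fun y x z => ?_, fun x z => ?_⟩
  · exact continuous_unitaryTensor_comp (hc a) continuous_const
  · dsimp only
    rw [nu_tensor, puTensor_inv_inv, puAct_tensor_one, ← unitaryTensor_mul, one_mul, hn]
  · rw [nu_tensor, nu_tensor, ← puTensor_Ad, ← puTensor_mul, map_one, mul_one, hST]

theorem OuterConj.tensor_right {S : TripleOn χ H} {S' : TripleOn χ K} (h : OuterConj S S')
    (T : TripleOn χ L) : OuterConj (S.tensor T) (S'.tensor T) := by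
  obtain ⟨M, _, _, R, R', h1, h2, h3⟩ := h
  exact ⟨_, _, _, _, _, h1.tensor_right T, h2.tensor_right T, h3.tensor_right T⟩

end TripleOn

open TripleOn

namespace Triple

theorem StablyOuterConj.symm {S T : Triple χ} (h : S.StablyOuterConj T) : T.StablyOuterConj S :=
  stablyOuterConj_equivalence.symm h

theorem StablyOuterConj.trans {S T R : Triple χ} (h : S.StablyOuterConj T)
    (h' : T.StablyOuterConj R) : S.StablyOuterConj R :=
  stablyOuterConj_equivalence.trans h h'

theorem StablyOuterConj.tensor_right {S S' : Triple χ} (h : S.StablyOuterConj S')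
    (T : Triple χ) : (S.tensor T).StablyOuterConj (S'.tensor T) := by
  obtain ⟨H₀, _, _, _, _, _, h⟩ := h
  exact ⟨H₀, _, _, inferInstance, inferInstance, inferInstance,
    ((OuterConj.of_iso (iso_stab_tensor H₀ S.on T.on).symm).trans (h.tensor_right T.on)).trans
      (OuterConj.of_iso (iso_stab_tensor H₀ S'.on T.on))⟩

theorem stablyOuterConj_tensor_comm (S T : Triple χ) :
    (S.tensor T).StablyOuterConj (T.tensor S) :=
  .of_outerConj (.of_iso (iso_tensor_comm S.on T.on))

theorem StablyOuterConj.tensor {S S' T T' : Triple χ} (h : S.StablyOuterConj S')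
    (h' : T.StablyOuterConj T') : (S.tensor T).StablyOuterConj (S'.tensor T') :=
  (h.tensor_right T).trans ((stablyOuterConj_tensor_comm S' T).trans
    ((h'.tensor_right S').trans (stablyOuterConj_tensor_comm T' S')))

end Triple

end TensorCompatibility

/-! ### Splitting abelian extensions by the circle -/

section CentralExtension

/-- The circle is divisible. -/
@[reducible]
def divisibleByCircle : DivisibleBy (Additive Circle) ℤ :=
  Function.Surjective.divisibleBy (A := ℝ) (α := ℤ) (Circle.expHom : ℝ →+ Additive Circle)
    (fun c => by
      obtain ⟨t, ht⟩ := Circle.exp_surjective (Additive.toMul c)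
      exact ⟨t, ht⟩) (fun a n => map_zsmul _ _ _)

/-- Characters of subgroups of abelian groups extend. -/
theorem exists_extension_of_injective {A B : Type*} [CommGroup A] [CommGroup B] (i : A →* B)
    (hi : Function.Injective i) (f : A →* Circle) : ∃ r : B →* Circle, ∀ a, r (i a) = f a := by
  let _ := divisibleByCircle
  obtain ⟨r, hr⟩ := (Module.Baer.of_divisible (A := Additive Circle)).extension_property_addMonoidHom
    (MonoidHom.toAdditive i) hi (MonoidHom.toAdditive f)
  exact ⟨MonoidHom.toAdditive.symm r, fun a => DFunLike.congr_fun hr (Additive.ofMul a)⟩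

/-- A projective representation of an abelian group whose lifts commute can be linearised. -/
theorem exists_lift_of_commute {A U P : Type*} [CommGroup A] [Group U] [Group P] (s : Circle →* U)
    (hs : Function.Injective s) (q : U →* P) (hq : ∀ u, q u = 1 ↔ ∃ c, s c = u)
    (hq' : Function.Surjective q) (μ : A →* P)
    (hc : ∀ (a b : A) (u v : U), q u = μ a → q v = μ b → u * v = v * u) :
    ∃ σ : A →* U, ∀ a, q (σ a) = μ a := by
  -- The pullback of `q` along `μ` is an extension of `A` by `Circle`; the commutation hypothesis
  -- makes it abelian.
  let E : Subgroup (A × U) :=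
    { carrier := {x | q x.2 = μ x.1}
      one_mem' := by simp
      mul_mem' := fun {x y} hx hy => by
        change q (x.2 * y.2) = μ (x.1 * y.1)
        rw [map_mul, map_mul, hx, hy]
      inv_mem' := fun {x} hx => by
        change q (x.2)⁻¹ = μ (x.1)⁻¹
        rw [map_inv, map_inv, hx] }
  let _ : CommGroup E :=
    { (inferInstance : Group E) with
      mul_comm := fun x y => Subtype.ext (Prod.ext (mul_comm _ _) (hc _ _ _ _ x.2 y.2)) }
  let i : Circle →* E :=
    { toFun := fun c => ⟨(1, s c), by
        change q (s c) = μ 1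
        rw [map_one, (hq _).mpr ⟨c, rfl⟩]⟩
      map_one' := Subtype.ext (Prod.ext rfl (map_one s))
      map_mul' := fun c d => Subtype.ext (Prod.ext (one_mul 1).symm (map_mul s c d)) }
  have hi : Function.Injective i := fun c d h => hs (congrArg (fun e : E => e.1.2) h)
  -- Divisibility of the circle gives a retraction of `E` onto its central circle.
  obtain ⟨r, hr⟩ := exists_extension_of_injective i hi (MonoidHom.id Circle)
  have hsc : ∀ (c : Circle) (a : A) (u : U), q u = μ a → s c * u = u * s c := fun c a u hu =>
    hc 1 a _ _ (by rw [map_one, (hq _).mpr ⟨c, rfl⟩]) hu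
  -- Dividing by the retraction kills the circle, so `f` depends only on the component in `A` and
  -- thus defines the lift.
  let f : E → U := fun e => e.1.2 * s (r e)⁻¹
  have hf : ∀ e e', f (e * e') = f e * f e' := fun e e' => by
    change e.1.2 * e'.1.2 * s (r (e * e'))⁻¹ = e.1.2 * s (r e)⁻¹ * (e'.1.2 * s (r e')⁻¹)
    rw [map_mul, mul_inv_rev, mul_comm (r e')⁻¹, map_mul, mul_assoc, mul_assoc, ← mul_assoc (s _)
      e'.1.2, hsc _ e'.1.1 _ e'.2, mul_assoc]
  have hf1 : ∀ c, f (i c) = 1 := fun c => by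
    change s c * s (r (i c))⁻¹ = 1
    rw [hr, MonoidHom.id_apply, ← map_mul, mul_inv_cancel, map_one]
  have hf2 : ∀ e e' : E, e.1.1 = e'.1.1 → f e = f e' := fun e e' h => by
    obtain ⟨c, hcc⟩ := (hq (e'.1.2⁻¹ * e.1.2)).mp (by
      rw [map_mul, map_inv, e.2, e'.2, h, inv_mul_cancel])
    have : e = e' * i c := Subtype.ext (Prod.ext (h.trans (mul_one _).symm) (by
      change e.1.2 = e'.1.2 * s c
      rw [hcc, mul_inv_cancel_left]))
    rw [this, hf, hf1, mul_one]
  choose u hu using fun a => hq' (μ a)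
  let e : A → E := fun a => ⟨(a, u a), hu a⟩
  refine ⟨MonoidHom.mk' (fun a => f (e a)) fun a b => ?_, fun a => ?_⟩
  · rw [← hf]
    exact hf2 _ _ rfl
  · change q (u a * s _) = μ a
    rw [map_mul, hu, (hq _).mpr ⟨_, rfl⟩, mul_one]

end CentralExtension

/-! ### From a vanishing Mackey obstruction to a representation of `N` -/

section MackeyObstruction

variable {Γ G : Type u} [Group Γ] [CommGroup G] [TopologicalSpace G]
  [IsTopologicalGroup G] [LocallyCompactSpace G] {N : Subgroup G}
  {χ : Γ →* G ⧸ N}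

open TripleOn

theorem coe_subgroup_eq_one (n : N) : ((n : G) : G ⧸ N) = 1 :=
  (QuotientGroup.eq_one_iff _).mpr n.2

/-- Replacing unitaries by others with the same projective classes multiplies both orders of the
product by the same scalar. -/
theorem commute_of_Ad_eq {H : Type u} [NormedAddCommGroup H] [InnerProductSpace ℂ H]
    {U V U' V' : UnitaryGp H} (hU : Ad U = Ad U') (hV : Ad V = Ad V') (h : U * V = V * U) :
    U' * V' = V' * U' := by
  obtain ⟨c, rfl⟩ := Ad_eq_Ad_iff.mp hU
  obtain ⟨d, rfl⟩ := Ad_eq_Ad_iff.mp hV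
  rw [mul_scalar_mul_mul_scalar, mul_scalar_mul_mul_scalar, h, ← map_mul (scalar H),
    ← map_mul (scalar H), mul_comm c]

/-- If the Mackey obstruction vanishes, then lifts of `μ(n, 1)`, `n ∈ N`, commute. -/
theorem Triple.IsDualisable.commute {S : Triple χ} (hS : S.IsDualisable) (n k : N)
    {U V : UnitaryGp S.space} (hU : Ad U = S.on.mu n 1) (hV : Ad V = S.on.mu k 1) :
    U * V = V * U := by
  obtain ⟨F, ω, ⟨-, hF⟩, hω, m, -, hm⟩ := hS
  have : NeZero (haarQuot N) := inferInstance
  -- Elements of `N` do not move `z`, so the boundary expression for `ω` is symmetric in `n` and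
  -- `k`.
  have hae : ∀ᵐ z ∂(haarQuot N), F k z * F n z = F n z * F k z := by
    filter_upwards [hω n k, hω k n, hm n k, hm k n] with z h1 h2 h3 h4
    rw [coe_subgroup_eq_one, mul_one] at h1 h2 h3 h4
    rw [h1, h2, h3, h4, mul_comm (k : G) n, div_mul_eq_mul_div, div_mul_eq_mul_div,
      mul_comm (m k z)]
  -- Haar measure is nonzero, so one point exists where all three almost sure statements hold.
  obtain ⟨z, hz, hn, hk⟩ := (hae.and ((hF n).and (hF k))).exists
  obtain ⟨h, rfl⟩ := QuotientGroup.mk_surjective z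
  obtain ⟨W, hW⟩ := Ad_surjective (S.on.mu h 1)
  -- Commutativity of `G` shows that `μ(l, ·)` at the chosen point and at the base point are
  -- conjugate by `μ(h, 1)`, which carries the relation to the base point.
  have key : ∀ (l : N), S.on.mu l h * S.on.mu h 1 = S.on.mu h 1 * S.on.mu l 1 := fun l => by
    have e1 := S.on.mu_mul l h 1
    have e2 := S.on.mu_mul h l 1
    rw [coe_subgroup_eq_one, one_mul] at e2
    rw [one_mul] at e1
    rw [← e1, ← e2, mul_comm]
  have hU' : Ad (F n h) = Ad (W * U * W⁻¹) := by
    rw [hn, map_mul, map_mul, map_inv, hW, hU, ← key, mul_inv_cancel_right]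
  have hV' : Ad (F k h) = Ad (W * V * W⁻¹) := by
    rw [hk, map_mul, map_mul, map_inv, hW, hV, ← key, mul_inv_cancel_right]
  have e := commute_of_Ad_eq hV' hU' hz
  have e' : W * (V * U) * W⁻¹ = W * (U * V) * W⁻¹ := by
    simpa only [mul_assoc, inv_mul_cancel_left] using e
  exact (mul_left_cancel (mul_right_cancel e')).symm

/-- If the Mackey obstruction vanishes, then `n ↦ μ(n, 1)` lifts to a unitary representation
of `N`. -/
theorem Triple.IsDualisable.exists_rep {S : Triple χ} (hS : S.IsDualisable) :
    ∃ σ : N →* UnitaryGp S.space, ∀ n : N, Ad (σ n) = S.on.mu n 1 := by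
  let μ : N →* PU S.space := MonoidHom.mk' (fun n => S.on.mu n 1) fun n k => by
    have e := S.on.mu_mul n k 1
    rw [coe_subgroup_eq_one, one_mul] at e
    exact e
  refine exists_lift_of_commute (scalar S.space) scalar_injective Ad (fun u => ?_) Ad_surjective μ
    fun n k U V hU hV => hS.commute n k hU hV
  exact QuotientGroup.eq_one_iff u

end MackeyObstruction

/-! ### Hilbert space tensor products and vector-valued `L²` spaces -/

section BilinearIsometry

variable {H K M : Type u} [NormedAddCommGroup H] [InnerProductSpace ℂ H] [NormedAddCommGroup K]
  [InnerProductSpace ℂ K] [NormedAddCommGroup M] [InnerProductSpace ℂ M]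

/-- A bilinear map preserving inner products is isometric on the algebraic tensor product. -/
def liftIsometry (B : H →ₗ[ℂ] K →ₗ[ℂ] M)
    (hB : ∀ x x' y y', inner ℂ (B x y) (B x' y') = inner ℂ x x' * inner ℂ y y') :
    H ⊗[ℂ] K →ₗᵢ[ℂ] M :=
  (TensorProduct.lift B).isometryOfInner fun s t => by
    induction s using TensorProduct.induction_on with
    | zero => simp
    | tmul x y =>
      induction t using TensorProduct.induction_on with
      | zero => simp
      | tmul x' y' => rw [lift.tmul, lift.tmul, hB, TensorProduct.inner_tmul]
      | add a b ha hb => rw [map_add, inner_add_right, inner_add_right, ha, hb]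
    | add a b ha hb => rw [map_add, inner_add_left, inner_add_left, ha, hb]

/-- A bilinear map with dense span preserving inner products identifies its target with the
Hilbert space tensor product. -/
theorem exists_unitary_of_bilinear [CompleteSpace M] (B : H →ₗ[ℂ] K →ₗ[ℂ] M)
    (hB : ∀ x x' y y', inner ℂ (B x y) (B x' y') = inner ℂ x x' * inner ℂ y y')
    (hd : Dense (Submodule.span ℂ {m | ∃ x y, B x y = m} : Set M)) :
    ∃ J : HTensor H K ≃ₗᵢ[ℂ] M, ∀ x y, J (htmul x y) = B x y := by
  have hd' : DenseRange (liftIsometry B hB).toLinearMap := by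
    refine hd.mono ?_
    rw [← LinearMap.coe_range, SetLike.coe_subset_coe, Submodule.span_le]
    rintro _ ⟨x, y, rfl⟩
    exact ⟨x ⊗ₜ y, lift.tmul _ _⟩
  refine ⟨(LinearEquiv.refl ℂ (H ⊗[ℂ] K)).extendOfIsometry
    (Completion.toComplₗᵢ (𝕜 := ℂ) (E := H ⊗[ℂ] K)).toLinearMap
    (liftIsometry B hB).toLinearMap (denseRange_toCompl _) hd' (fun t => ?_), fun x y => ?_⟩
  · change ‖liftIsometry B hB t‖ = ‖(t : Completion (H ⊗[ℂ] K))‖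
    rw [LinearIsometry.norm_map, Completion.norm_coe]
  · refine (LinearEquiv.extendOfIsometry_eq (LinearEquiv.refl ℂ (H ⊗[ℂ] K))
      (Completion.toComplₗᵢ (𝕜 := ℂ) (E := H ⊗[ℂ] K)).toLinearMap
      (liftIsometry B hB).toLinearMap (denseRange_toCompl _) hd' _ (x ⊗ₜ y)).trans ?_
    exact lift.tmul _ _

end BilinearIsometry

section VectorValued

variable {X : Type u} [MeasurableSpace X] (μ : Measure X) {H : Type u} [NormedAddCommGroup H]
  [InnerProductSpace ℂ H]

/-- The bilinear map `(f, x) ↦ f(·) x`. -/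
def lpSMul : Lp ℂ 2 μ →ₗ[ℂ] H →ₗ[ℂ] Lp H 2 μ :=
  LinearMap.mk₂ ℂ (fun f x => (ContinuousLinearMap.toSpanSingleton ℂ x).compLp f)
    (fun f g x => map_add ((ContinuousLinearMap.toSpanSingleton ℂ x).compLpₗ 2 μ) f g)
    (fun c f x => map_smul ((ContinuousLinearMap.toSpanSingleton ℂ x).compLpₗ 2 μ) c f)
    (fun f x y => by
      rw [ContinuousLinearMap.toSpanSingleton_add, ContinuousLinearMap.add_compLp])
    (fun c f x => by
      rw [ContinuousLinearMap.toSpanSingleton_smul, ContinuousLinearMap.smul_compLp])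

theorem lpSMul_ae (f : Lp ℂ 2 μ) (x : H) : ∀ᵐ a ∂μ, lpSMul μ f x a = f a • x :=
  ContinuousLinearMap.coeFn_compLp (ContinuousLinearMap.toSpanSingleton ℂ x) f

theorem inner_lpSMul (f f' : Lp ℂ 2 μ) (x x' : H) :
    inner ℂ (lpSMul μ f x) (lpSMul μ f' x') = inner ℂ f f' * inner ℂ x x' := by
  rw [L2.inner_def, L2.inner_def, ← integral_mul_const]
  refine integral_congr_ae ?_
  filter_upwards [lpSMul_ae μ f x, lpSMul_ae μ f' x'] with a h1 h2
  rw [h1, h2, inner_smul_left, inner_smul_right, RCLike.inner_apply]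
  ring

/-- Vector-valued indicator functions are themselves of the form `f(·) x`, and sums of such
functions are dense in `L²`. -/
theorem dense_span_lpSMul :
    Dense (Submodule.span ℂ {m | ∃ (f : Lp ℂ 2 μ) (x : H), lpSMul μ f x = m} :
      Set (Lp H 2 μ)) := by
  intro m
  refine Lp.induction ENNReal.ofNat_ne_top (motive := fun m => m ∈ closure (Submodule.span ℂ
    {m | ∃ (f : Lp ℂ 2 μ) (x : H), lpSMul μ f x = m} : Set (Lp H 2 μ))) ?_ ?_ isClosed_closure m
  · intro c s hs hμs
    refine subset_closure (Submodule.subset_span ⟨indicatorConstLp 2 hs hμs.ne 1, c, ?_⟩)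
    rw [Lp.simpleFunc.coe_indicatorConst]
    refine Lp.ext ?_
    filter_upwards [lpSMul_ae μ (indicatorConstLp 2 hs hμs.ne (1 : ℂ)) c,
      indicatorConstLp_coeFn (p := 2) (hs := hs) (hμs := hμs.ne) (c := (1 : ℂ)),
      indicatorConstLp_coeFn (p := 2) (hs := hs) (hμs := hμs.ne) (c := c)] with a h1 h2 h3
    rw [h1, h2, h3]
    by_cases ha : a ∈ s
    · rw [Set.indicator_of_mem ha, Set.indicator_of_mem ha, one_smul]
    · rw [Set.indicator_of_notMem ha, Set.indicator_of_notMem ha, zero_smul]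
  · intro f g hf hg _ h1 h2
    rw [← Submodule.topologicalClosure_coe] at h1 h2 ⊢
    exact Submodule.add_mem _ h1 h2

/-- `L²(X) ⊗ H ≅ L²(X, H)`. -/
theorem exists_unitary_lp [CompleteSpace H] :
    ∃ J : HTensor (Lp ℂ 2 μ) H ≃ₗᵢ[ℂ] Lp H 2 μ, ∀ f x, J (htmul f x) = lpSMul μ f x :=
  exists_unitary_of_bilinear _ (inner_lpSMul μ) (dense_span_lpSMul μ)

variable [TopologicalSpace.SeparableSpace H]

/-- As `A` is countable, joint measurability of `(a, x) ↦ τ a x` reduces to continuity of each `τ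
a`; no regularity of `τ` in `a` is involved. -/
theorem aestronglyMeasurable_unitary_apply {A : Type*} [Countable A] [MeasurableSpace A]
    [MeasurableSingletonClass A] {p : X → A} (hp : Measurable p) (τ : A → UnitaryGp H) {f : X → H}
    (hf : AEStronglyMeasurable f μ) : AEStronglyMeasurable (fun a => τ (p a) (f a)) μ := by
  borelize H
  have : SecondCountableTopology H := UniformSpace.secondCountable_of_separable H
  have h : Measurable fun q : A × H => τ q.1 q.2 :=
    measurable_from_prod_countable_right fun a => (τ a).continuous.measurable
  have h2 : AEMeasurable (fun a => (p a, f a)) μ :=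
    hp.aemeasurable.prodMk hf.aemeasurable
  exact (h.comp_aemeasurable h2).aestronglyMeasurable

theorem memLp_unitary_apply {A : Type*} [Countable A] [MeasurableSpace A]
    [MeasurableSingletonClass A] {p : X → A} (hp : Measurable p) (τ : A → UnitaryGp H)
    (f : Lp H 2 μ) : MemLp (fun a => τ (p a) (f a)) 2 μ :=
  (Lp.memLp f).congr_norm
    (aestronglyMeasurable_unitary_apply μ hp τ (Lp.aestronglyMeasurable f))
    (.of_forall fun a => ((τ (p a)).norm_map _).symm)

/-- Pointwise multiplication by a countably valued measurable field of unitaries. -/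
theorem exists_multiplication_unitary {A : Type*} [Countable A] [MeasurableSpace A]
    [MeasurableSingletonClass A] {p : X → A} (hp : Measurable p) (τ : A → UnitaryGp H) :
    ∃ W : UnitaryGp (Lp H 2 μ), ∀ f, ∀ᵐ a ∂μ, W f a = τ (p a) (f a) := by
  let T : (A → UnitaryGp H) → Lp H 2 μ → Lp H 2 μ := fun τ f => (memLp_unitary_apply μ hp τ f).toLp
  have hT : ∀ τ f, ∀ᵐ a ∂μ, T τ f a = τ (p a) (f a) := fun τ f => MemLp.coeFn_toLp _
  have hinv : ∀ (τ τ' : A → UnitaryGp H) f, (∀ a x, τ a (τ' a x) = x) → T τ (T τ' f) = f := by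
    intro τ τ' f h
    refine Lp.ext ?_
    filter_upwards [hT τ (T τ' f), hT τ' f] with a h1 h2
    rw [h1, h2, h]
  refine ⟨
    { toFun := T τ
      invFun := T fun a => (τ a)⁻¹
      left_inv := fun f => hinv _ _ f fun a x => (τ a).symm_apply_apply x
      right_inv := fun f => hinv _ _ f fun a x => (τ a).apply_symm_apply x
      map_add' := fun f g => Lp.ext (by
        filter_upwards [hT τ (f + g), hT τ f, hT τ g, Lp.coeFn_add f g,
          Lp.coeFn_add (T τ f) (T τ g)] with a h1 h2 h3 h4 h5
        rw [h1, h4, h5, Pi.add_apply, Pi.add_apply, h2, h3, map_add])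
      map_smul' := fun c f => Lp.ext (by
        filter_upwards [hT τ (c • f), hT τ f, Lp.coeFn_smul c f,
          Lp.coeFn_smul c (T τ f)] with a h1 h2 h4 h5
        rw [h1, h4, RingHom.id_apply, h5, Pi.smul_apply, Pi.smul_apply, h2, map_smul])
      norm_map' := fun f => by
        change ‖T τ f‖ = ‖f‖
        rw [Lp.norm_def, Lp.norm_def]
        congr 1
        refine eLpNorm_congr_norm_ae ?_
        filter_upwards [hT τ f] with a h1
        rw [h1, LinearIsometryEquiv.norm_map] }, hT τ⟩

end VectorValued

/-! ### The translation representation on `L²(G, H)` -/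

section Translation

variable (G : Type u) [CommGroup G] [TopologicalSpace G] [IsTopologicalGroup G]
  [LocallyCompactSpace G] [MeasurableSpace G] [BorelSpace G]
  (H : Type*) [NormedAddCommGroup H] [InnerProductSpace ℂ H]

/-- The translation representation of `G` on `L²(G, H)`. -/
theorem exists_translation [SecondCountableTopology G] :
    ∃ T : G →* UnitaryGp (Lp H 2 (Measure.haar : Measure G)),
      Continuous T ∧ ∀ g f, ∀ᵐ x ∂(Measure.haar : Measure G), T g f x = f (g * x) := by
  have : Fact ((2 : ENNReal) ≠ ⊤) := ⟨by simp⟩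
  have h1 : ∀ (g h : G) (f : Lp H 2 (Measure.haar : Measure G)),
      DomMulAct.mk (g * h) • f = DomMulAct.mk g • DomMulAct.mk h • f := fun g h f => by
    rw [mul_comm g h, smul_smul]
    rfl
  refine ⟨MonoidHom.mk' (fun g =>
    { toFun := fun f => DomMulAct.mk g • f
      invFun := fun f => DomMulAct.mk g⁻¹ • f
      left_inv := fun f => by dsimp only; rw [← h1, inv_mul_cancel]; exact one_smul _ f
      right_inv := fun f => by dsimp only; rw [← h1, mul_inv_cancel]; exact one_smul _ f
      map_add' := fun f f' => smul_add _ f f'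
      map_smul' := fun c f => smul_comm _ c f
      norm_map' := fun f => DomMulAct.norm_smul_Lp _ f }) fun g h => ?_, ?_, fun g f => ?_⟩
  · ext1 f
    exact h1 g h f
  · refine continuous_unitary_iff.mpr fun f => ?_
    change Continuous fun g : G => DomMulAct.mk g • f
    have h2 : Continuous fun g : G => (DomMulAct.mk g : Gᵈᵐᵃ) := DomMulAct.continuous_mk
    exact h2.smul continuous_const
  · exact DomMulAct.smul_Lp_ae_eq _ f

end Translation

/-! ### A Borel `N`-equivariant map from `G` to `N` -/

section MeasurableSection

variable {G : Type u} [CommGroup G] [TopologicalSpace G] [IsTopologicalGroup G]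
  [SecondCountableTopology G] [MeasurableSpace G] [BorelSpace G] (N : Subgroup G)
  [DiscreteTopology N]

/-- A countable family of open sets covering `G` on each of which `G → G/N` is injective. -/
theorem exists_countable_evenly_covered :
    ∃ U : ℕ → Set G, (∀ i, IsOpen (U i)) ∧ (∀ g, ∃ i, g ∈ U i) ∧
      ∀ i, ∀ x ∈ U i, ∀ y ∈ U i, x⁻¹ * y ∈ N → x = y := by
  obtain ⟨V, hV, hV1⟩ : ∃ V : Set G, IsOpen V ∧ (fun n : N => (n : G)) ⁻¹' V = {1} :=
    isOpen_induced_iff.mp (isOpen_discrete ({1} : Set N))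
  have hVm : ∀ n ∈ N, n ∈ V → n = 1 := fun n hn hnV => by
    have : (⟨n, hn⟩ : N) ∈ ({1} : Set N) := hV1 ▸ hnV
    exact congrArg Subtype.val this
  have h1V : V ∈ nhds (1 : G) := hV.mem_nhds (by
    have : (1 : N) ∈ (fun n : N => (n : G)) ⁻¹' V := hV1 ▸ rfl
    exact this)
  have hc : Filter.Tendsto (fun p : G × G => p.1⁻¹ * p.2) (nhds (1, 1)) (nhds 1) := by
    have : Continuous fun p : G × G => p.1⁻¹ * p.2 := by fun_prop
    simpa using this.tendsto (1, 1)
  obtain ⟨W, hW, hWo, hW2⟩ : ∃ W : Set G, (1 : G) ∈ W ∧ IsOpen W ∧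
      ∀ x ∈ W, ∀ y ∈ W, x⁻¹ * y ∈ V := by
    have := hc h1V
    rw [Filter.mem_map, nhds_prod_eq, Filter.mem_prod_same_iff] at this
    obtain ⟨t, ht, hsub⟩ := this
    obtain ⟨W, hWt, hWo, hW1⟩ := mem_nhds_iff.mp ht
    exact ⟨W, hW1, hWo, fun x hx y hy => hsub (Set.mk_mem_prod (hWt hx) (hWt hy))⟩
  have ho : ∀ g : G, IsOpen ((fun x => g⁻¹ * x) ⁻¹' W) := fun g =>
    hWo.preimage (continuous_const_mul _)
  obtain ⟨t, ht, hcov⟩ := TopologicalSpace.isOpen_iUnion_countable _ ho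
  have hne : t.Nonempty := by
    by_contra h
    rw [Set.not_nonempty_iff_eq_empty] at h
    have h1 : (1 : G) ∈ ⋃ i, (fun x => i⁻¹ * x) ⁻¹' W :=
      Set.mem_iUnion.mpr ⟨1, by simpa using hW⟩
    rw [← hcov, h] at h1
    simp at h1
  obtain ⟨e, rfl⟩ := ht.exists_eq_range hne
  refine ⟨fun i => (fun x => (e i)⁻¹ * x) ⁻¹' W, fun i => ho _, fun g => ?_,
    fun i x hx y hy hxy => ?_⟩
  · have h1 : g ∈ ⋃ i, (fun x => i⁻¹ * x) ⁻¹' W := Set.mem_iUnion.mpr ⟨g, by simpa using hW⟩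
    rw [← hcov] at h1
    simpa using h1
  · have h1 := hW2 _ hx _ hy
    have h2 : ((e i)⁻¹ * x)⁻¹ * ((e i)⁻¹ * y) = x⁻¹ * y := by group
    rw [h2] at h1
    exact inv_mul_eq_one.mp (hVm _ hxy h1)

/-- There is a Borel map `p : G → N` that is equivariant for `N`. -/
theorem exists_measurable_equivariant [MeasurableSpace N] [BorelSpace N] :
    ∃ p : G → N, Measurable p ∧ ∀ g (n : N), p (g * n) = p g * n := by
  obtain ⟨U, hUo, hUc, hUi⟩ := exists_countable_evenly_covered N
  have hex : ∀ g : G, ∃ i, ∃ n : N, g * (n : G)⁻¹ ∈ U i := fun g => by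
    obtain ⟨i, hi⟩ := hUc g
    exact ⟨i, 1, by simpa using hi⟩
  classical
  -- The least index whose open set meets the coset of `g` is an `N`-invariant Borel function.
  -- Injectivity on that open set then singles out one point of the coset, and `p g` is the position
  -- of `g` relative to it.
  let ι : G → ℕ := fun g => Nat.find (hex g)
  have hA : ∀ i, IsOpen {g : G | ∃ n : N, g * (n : G)⁻¹ ∈ U i} := fun i => by
    have : {g : G | ∃ n : N, g * (n : G)⁻¹ ∈ U i} =
        ⋃ n : N, (fun g => g * (n : G)⁻¹) ⁻¹' U i := by
      ext g
      simp
    rw [this]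
    exact isOpen_iUnion fun n => (hUo i).preimage (continuous_mul_const _)
  have hι : Measurable ι := measurable_find hex fun i => (hA i).measurableSet
  have hιn : ∀ g (n : N), ι (g * n) = ι g := fun g n => by
    refine Nat.find_congr' fun {i} => ⟨?_, ?_⟩
    · rintro ⟨k, hk⟩
      exact ⟨k * n⁻¹, by simpa [mul_assoc, mul_comm, mul_left_comm] using hk⟩
    · rintro ⟨k, hk⟩
      exact ⟨k * n, by simpa [mul_assoc, mul_comm, mul_left_comm] using hk⟩
  choose p hp using fun g => Nat.find_spec (hex g)
  have huniq : ∀ g (n : N), g * (n : G)⁻¹ ∈ U (ι g) → p g = n := fun g n hn => by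
    have h1 := hUi _ _ (hp g) _ hn (by
      have : (g * (p g : G)⁻¹)⁻¹ * (g * (n : G)⁻¹) = ((p g * n⁻¹ : N) : G) := by
        push_cast
        group
      rw [this]
      exact Subtype.mem _)
    exact Subtype.ext (inv_injective (mul_left_cancel h1))
  have : Countable N := countable_of_Lindelof_of_discrete
  refine ⟨p, measurable_to_countable' fun n => ?_, fun g n => huniq _ _ ?_⟩
  · have : p ⁻¹' {n} = ⋃ i, (ι ⁻¹' {i} ∩ (fun g => g * (n : G)⁻¹) ⁻¹' U i) := by
      ext g
      simp only [Set.mem_preimage, Set.mem_singleton_iff, Set.mem_iUnion, Set.mem_inter_iff]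
      constructor
      · rintro rfl
        exact ⟨ι g, rfl, hp g⟩
      · rintro ⟨i, rfl, h⟩
        exact huniq g n h
    rw [this]
    exact .iUnion fun i => (hι (measurableSet_singleton i)).inter
      ((hUo i).preimage (continuous_mul_const _)).measurableSet
  · rw [hιn]
    have : g * (n : G) * ((p g * n : N) : G)⁻¹ = g * (p g : G)⁻¹ := by
      push_cast
      group
    rw [this]
    exact hp g

end MeasurableSection

/-! ### Extending a representation of `N` after tensoring -/

section Extension

/-- A unitary representation `σ` of `N` extends to `G` after tensoring with the restriction of a
suitable representation `ρ` of `G`. -/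
theorem exists_extension_rep {G : Type u} [CommGroup G] [TopologicalSpace G] [IsTopologicalGroup G]
    [LocallyCompactSpace G] [SecondCountableTopology G] {N : Subgroup G} [DiscreteTopology N]
    {H : Type u} [NormedAddCommGroup H] [InnerProductSpace ℂ H] [CompleteSpace H]
    [TopologicalSpace.SeparableSpace H] (σ : N →* UnitaryGp H) :
    ∃ (K : Type u) (_ : NormedAddCommGroup K) (_ : InnerProductSpace ℂ K) (_ : CompleteSpace K)
      (_ : TopologicalSpace.SeparableSpace K) (_ : Nontrivial K) (ρ : G →* UnitaryGp K)
      (R : G →* UnitaryGp (HTensor K H)), Continuous ρ ∧ Continuous R ∧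
      ∀ n : N, R n = unitaryTensor (ρ n) (σ n) := by
  let _ : MeasurableSpace G := borel G
  have : BorelSpace G := ⟨rfl⟩
  let _ : MeasurableSpace N := borel N
  have : BorelSpace N := ⟨rfl⟩
  have : Countable N := countable_of_Lindelof_of_discrete
  have : Fact ((2 : ENNReal) ≠ ⊤) := ⟨by simp⟩
  let μ : Measure G := Measure.haar
  obtain ⟨ρ, hρ, hρ'⟩ := exists_translation G ℂ
  obtain ⟨T, hT, hT'⟩ := exists_translation G H
  obtain ⟨p, hp, hpn⟩ := exists_measurable_equivariant N
  -- Conjugating translation by multiplication with `σ ∘ p` works because `σ(p(x))⁻¹ σ(p(n * x)) =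
  -- σ(n)` for `n ∈ N`: on `N` the result is translation tensored with `σ`.
  obtain ⟨W, hW⟩ := exists_multiplication_unitary μ hp σ
  obtain ⟨J, hJ⟩ := exists_unitary_lp μ (H := H)
  have : Nontrivial (Lp ℂ 2 μ) := by
    obtain ⟨K, hK, hK1⟩ := exists_compact_mem_nhds (1 : G)
    obtain ⟨V, hVK, hVo, hV1⟩ := mem_nhds_iff.mp hK1
    have hV : μ V ≠ ⊤ := ((measure_mono hVK).trans_lt hK.measure_lt_top).ne
    refine ⟨⟨indicatorConstLp 2 hVo.measurableSet hV (1 : ℂ), 0, fun h => ?_⟩⟩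
    have h1 := norm_indicatorConstLp (p := 2) (hs := hVo.measurableSet) (hμs := hV) (c := (1 : ℂ))
      (by simp) (by simp)
    rw [h, norm_zero, norm_one, one_mul] at h1
    have h2 : 0 < μ.real V := ENNReal.toReal_pos (hVo.measure_pos μ ⟨1, hV1⟩).ne' hV
    exact (Real.rpow_pos_of_pos h2 _).ne h1
  refine ⟨Lp ℂ 2 μ, inferInstance, inferInstance, inferInstance, inferInstance, this, ρ,
    (unitaryConj J.symm).comp ((MulAut.conj W⁻¹).toMonoidHom.comp T), hρ, ?_, fun n => ?_⟩
  · refine (continuous_unitaryConj J.symm).comp ?_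
    change Continuous fun g => W⁻¹ * T g * W⁻¹⁻¹
    exact (continuous_const.mul hT).mul continuous_const
  · refine unitary_ext fun f x => ?_
    rw [unitaryTensor_htmul]
    refine J.injective ?_
    change J (J.symm ((W⁻¹ * T n * W⁻¹⁻¹) (J.symm.symm (htmul f x)))) = _
    rw [LinearIsometryEquiv.apply_symm_apply, inv_inv, LinearIsometryEquiv.symm_symm, hJ, hJ]
    have h1 : (W⁻¹ * T n * W) (lpSMul μ f x) = lpSMul μ (ρ n f) (σ n x) ↔
        T n (W (lpSMul μ f x)) = W (lpSMul μ (ρ n f) (σ n x)) := by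
      rw [← W.symm_apply_eq]
      rfl
    rw [h1]
    refine Lp.ext ?_
    have hq : ∀ {P : G → Prop}, (∀ᵐ a ∂μ, P a) → ∀ᵐ a ∂μ, P (n * a) := fun h =>
      (measurePreserving_mul_left μ (n : G)).quasiMeasurePreserving.ae h
    filter_upwards [hT' n (W (lpSMul μ f x)), hq (hW (lpSMul μ f x)), hW (lpSMul μ (ρ n f) (σ n x)),
      hq (lpSMul_ae μ f x), lpSMul_ae μ (ρ n f) (σ n x), hρ' n f] with a h1 h2 h3 h4 h5 h6
    rw [h1, h2, h3, h4, h5, h6, mul_comm (n : G) a, hpn, map_mul, map_smul, map_smul]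
    rfl

end Extension

/-! ### Replacing dualisable triples by lifted ones -/

section Rigidify

variable {Γ G : Type u} [Group Γ] [CommGroup G] [TopologicalSpace G]
  [IsTopologicalGroup G] {N : Subgroup G} {χ : Γ →* G ⧸ N}
  {H K : Type u} [NormedAddCommGroup H] [InnerProductSpace ℂ H] [NormedAddCommGroup K]
  [InnerProductSpace ℂ K]

namespace TripleOn

/-- The dynamical triple given by a unitary representation of `G`. -/
def ofRep (χ : Γ →* G ⧸ N) (ρ : G →* UnitaryGp K) (hρ : Continuous ρ) : TripleOn χ K where
  lam _ _ := 1
  mu g _ := Ad (ρ g)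
  continuous_lam _ := continuous_const
  continuous_mu := Ad_isOpenQuotientMap.continuous.comp (hρ.comp continuous_fst)
  lam_mul _ _ _ := (one_mul 1).symm
  mu_mul g h _ := by rw [map_mul, map_mul]
  lam_mu _ _ _ := by rw [one_mul, mul_one]

/-- A representation, regarded as constant along `G ⧸ N`, is itself the required unitary cocycle.
Hence tensoring a triple with `ofRep` has the same effect, up to a unitary cocycle, as stabilising
it. -/
theorem cocycleEquiv_ofRep (χ : Γ →* G ⧸ N) (ρ : G →* UnitaryGp K) (hρ : Continuous ρ) :
    CocycleEquiv (trivial χ K) (ofRep χ ρ hρ) := by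
  have h1 : ∀ x z, (trivial χ K).nu x z = 1 := fun x z => one_mul 1
  refine ⟨fun x _ => ρ x.2, fun a => hρ.comp continuous_fst, fun y x z => ?_, fun x z => ?_⟩
  · rw [h1, inv_one, map_one, MulAut.one_apply]
    exact map_mul ρ _ _
  · rw [h1, one_mul]
    exact one_mul _

/-- A triple whose cocycle `μ` is trivial on `N` up to a representation of `G` is isomorphic to one
where `μ` is that representation. -/
theorem exists_iso_mu_eq (S : TripleOn χ H) (R : G →* UnitaryGp H) (hR : Continuous R)
    (hN : ∀ n : N, Ad (R n) = S.mu n 1) :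
    ∃ T : TripleOn χ H, Iso S T ∧ ∀ (g : G) z, T.mu g z = Ad (R g) := by
  -- Agreement of `Ad R` and `μ` on `N` makes this comparison function invariant under `N`;
  -- transporting along it turns `μ` into `Ad R`.
  let v₀ : G → PU H := fun g => Ad (R g) * (S.mu g 1)⁻¹
  have hv₀ : Continuous v₀ := (Ad_isOpenQuotientMap.continuous.comp hR).mul
    (S.continuous_mu.comp (Continuous.prodMk_left 1)).inv
  have hv₁ : ∀ (g : G) (n : N), v₀ (g * n) = v₀ g := fun g n => by
    have e := S.mu_mul g n 1
    have hn : ((n : G) : G ⧸ N) = 1 := (QuotientGroup.eq_one_iff _).mpr n.2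
    rw [hn, mul_one, ← hN] at e
    change Ad (R (g * n)) * (S.mu (g * n) 1)⁻¹ = _
    rw [e, map_mul, map_mul, mul_inv_rev, mul_assoc, mul_inv_cancel_left]
  let v : G ⧸ N → PU H := Quotient.lift v₀ fun a b hab => by
    have h := hv₁ a ⟨a⁻¹ * b, QuotientGroup.leftRel_apply.mp hab⟩
    rw [← h]
    exact congrArg v₀ (mul_inv_cancel_left a b)
  have hv : Continuous v := hv₀.quotient_lift _
  have hv2 : ∀ g : G, v g = v₀ g := fun g => rfl
  refine ⟨S.transport (LinearIsometryEquiv.refl ℂ H) 1 v hv, iso_transport _ _ _ _ _,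
    fun g z => ?_⟩
  obtain ⟨h, rfl⟩ := QuotientGroup.mk_surjective z
  have e := S.mu_mul g h 1
  rw [one_mul] at e
  have h1 : (h : G ⧸ N) * (1 : G ⧸ N)⁻¹ = h := by rw [inv_one, mul_one]
  change v ((h : G ⧸ N) * 1⁻¹ * g) * puConj _ (S.mu g ((h : G ⧸ N) * 1⁻¹)) *
    (v ((h : G ⧸ N) * 1⁻¹))⁻¹ = Ad (R g)
  rw [h1, puConj_refl, ← QuotientGroup.mk_mul, hv2, hv2]
  change Ad (R (h * g)) * (S.mu (h * g) 1)⁻¹ * S.mu g h * (Ad (R h) * (S.mu h 1)⁻¹)⁻¹ = _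
  rw [mul_comm h g, e, map_mul, map_mul]
  group

/-- With `μ = Ad R` constant along `G ⧸ N`, each `λ(a, ·)` intertwines `R` with itself and so lifts.
The scalars `ψ` and `φ` compare two continuous lifts of the same projective function. -/
theorem exists_isLiftedBy_of_mu_eq [T2Space G] [LocallyCompactSpace G]
    [SecondCountableTopology G] [DiscreteTopology N] [CompactSpace (G ⧸ N)] [Nontrivial H]
    (S : TripleOn χ H) (R : G →* UnitaryGp H) (hR : Continuous R)
    (hS : ∀ (g : G) z, S.mu g z = Ad (R g)) : ∃ lamBar muBar ψ φ, S.IsLiftedBy lamBar muBar ψ φ := by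
  have hR' : ∀ (g h : G) (z : G ⧸ N), (fun (g : G) (_ : G ⧸ N) => R g) (g * h) z =
      (fun (g : G) (_ : G ⧸ N) => R g) h (z * (g : G ⧸ N)) *
        (fun (g : G) (_ : G ⧸ N) => R g) g z := fun g h z => by
    dsimp only
    rw [mul_comm g h, map_mul]
  have hl : ∀ a, ∃ F : G ⧸ N → UnitaryGp H, Continuous F ∧ ∀ z, Ad (F z) = S.lam a z := fun a =>
    exists_continuous_lift (S.lam a) (fun g _ => R g) (fun g _ => R g) hR hR hR' hR' fun g z => by
      rw [← hS g z, S.lam_mu, hS, hS]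
  choose lamBar hlc hl using hl
  have hψ : ∀ a b, ∃ c : C(G ⧸ N, Circle), ∀ z,
      lamBar b (z * χ a) * lamBar a z = lamBar (b * a) z * scalar H (c z) := fun a b =>
    exists_continuous_scalar (hlc (b * a))
      (((hlc b).comp (continuous_mul_const (χ a))).mul (hlc a)) fun z => by
        rw [map_mul]
        simp only [hl]
        rw [S.lam_mul]
  have hφ : ∀ a (g : G), ∃ c : C(G ⧸ N, Circle), ∀ z,
      lamBar a (z * (g : G ⧸ N)) * R g = R g * lamBar a z * scalar H (c z) := fun a g =>
    exists_continuous_scalar (continuous_const.mul (hlc a))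
      (((hlc a).comp (continuous_mul_const (g : G ⧸ N))).mul continuous_const) fun z => by
        rw [map_mul, map_mul]
        simp only [hl]
        rw [← hS g z, S.lam_mu, hS, hS]
  choose ψ hψ using hψ
  choose φ hφ using hφ
  exact ⟨lamBar, fun g _ => R g, ψ, φ, hlc, hR.comp continuous_fst, hl, fun g z => (hS g z).symm,
    hR', fun a b z => hψ a b z, fun a g z => hφ a g z⟩

end TripleOn

open TripleOn

/-- Dualisable triples are stably outer conjugate to triples with continuous unitary lifts. -/
theorem Triple.IsDualisable.exists_isLiftedBy [T2Space G] [LocallyCompactSpace G]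
    [SecondCountableTopology G] [DiscreteTopology N] [CompactSpace (G ⧸ N)] {S : Triple χ}
    (hS : S.IsDualisable) :
    ∃ T : Triple χ, S.StablyOuterConj T ∧
      ∃ lamBar muBar ψ φ, T.on.IsLiftedBy lamBar muBar ψ φ := by
  obtain ⟨σ, hσ⟩ := hS.exists_rep
  obtain ⟨K, _, _, _, _, _, ρ, R, hρ, hR, hRN⟩ := exists_extension_rep σ
  -- On `N` the tensor product has `μ(n, 1) = Ad (ρ n ⊗ σ n) = Ad (R n)`, as needed to make `μ`
  -- constant.
  obtain ⟨T, hT, hTμ⟩ := exists_iso_mu_eq ((ofRep χ ρ hρ).tensor S.on) R hR fun n => by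
    rw [hRN, ← puTensor_Ad, hσ]
    rfl
  have hST : OuterConj (S.stab K).on T :=
    ⟨_, _, _, S.on.stab K, _, Iso.refl _, hT.symm,
      (cocycleEquiv_ofRep χ ρ hρ).tensor_right S.on⟩
  exact ⟨{ space := HTensor K S.space, on := T },
    (S.stablyOuterConj_stab K).trans (.of_outerConj (S := S.stab K)
      (T := { space := HTensor K S.space, on := T }) hST),
    exists_isLiftedBy_of_mu_eq T R hR hTμ⟩

end Rigidify

/-! ### Lifted triples are dualisable -/

section LiftedDualisable

variable {Γ G : Type u} [Group Γ] [CommGroup G] [TopologicalSpace G]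
  [IsTopologicalGroup G] [T2Space G] [LocallyCompactSpace G] [SecondCountableTopology G]
  {N : Subgroup G} [DiscreteTopology N] [CompactSpace (G ⧸ N)] {χ : Γ →* G ⧸ N}
  {H : Type u} [NormedAddCommGroup H] [InnerProductSpace ℂ H]

theorem aestronglyMeasurable_of_continuous {Y : Type*} [TopologicalSpace Y]
    {f : G ⧸ N → Y} (hf : Continuous f) : AEStronglyMeasurable f (haarQuot N) := by
  have h : IsClosed (N : Set G) := Subgroup.isClosed_of_discrete
  have h1 : StronglyMeasurable (id : G ⧸ N → G ⧸ N) := continuous_id.stronglyMeasurable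
  exact (hf.comp_stronglyMeasurable h1).aestronglyMeasurable

/-- Each matrix coefficient is continuous in `g` by dominated convergence, with bound `‖p.1 z‖ *
‖p.2 z‖` independent of `g`; so the map is even weakly continuous. -/
theorem isBorelUnitary_of_continuous {f : G → G ⧸ N → UnitaryGp H}
    (hf : Continuous fun p : G × (G ⧸ N) => f p.1 p.2) :
    IsBorelUnitary (N := N) fun g => AEEqFun.mk (f g)
      (aestronglyMeasurable_of_continuous (hf.comp (Continuous.prodMk_right g))) := by
  let _ : MeasurableSpace G := borel G
  have : BorelSpace G := ⟨rfl⟩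
  let _ : TopologicalSpace (LinftyUnitary N H) := weakTopologyUnitary N H
  let _ : MeasurableSpace (LinftyUnitary N H) := borel _
  have : BorelSpace (LinftyUnitary N H) := ⟨rfl⟩
  refine Continuous.measurable (continuous_induced_rng.mpr (continuous_pi fun p => ?_))
  have e : (fun g : G => ∫ z, inner ℂ (p.1 z) ((AEEqFun.mk (f g)
      (aestronglyMeasurable_of_continuous (hf.comp (Continuous.prodMk_right g))) :
        LinftyUnitary N H) z (p.2 z)) ∂(haarQuot N)) =
      fun g : G => ∫ z, inner ℂ (p.1 z) (f g z (p.2 z)) ∂(haarQuot N) := by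
    funext g
    refine integral_congr_ae ?_
    filter_upwards [AEEqFun.coeFn_mk (f g)
      (aestronglyMeasurable_of_continuous (hf.comp (Continuous.prodMk_right g)))] with z hz
    rw [hz]
  change Continuous fun g : G => ∫ z, inner ℂ (p.1 z) ((AEEqFun.mk (f g)
      (aestronglyMeasurable_of_continuous (hf.comp (Continuous.prodMk_right g))) :
        LinftyUnitary N H) z (p.2 z)) ∂(haarQuot N)
  rw [e]
  have hint : Integrable (fun z => ‖p.1 z‖ * ‖p.2 z‖) (haarQuot N) :=
    MemLp.integrable_mul (Lp.memLp p.1).norm (Lp.memLp p.2).norm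
  refine continuous_of_dominated (bound := fun z => ‖p.1 z‖ * ‖p.2 z‖) (fun g => ?_) (fun g => ?_)
    hint (.of_forall fun z => ?_)
  · have h1 := aestronglyMeasurable_of_continuous (N := N)
      (hf.comp (Continuous.prodMk_right g) : Continuous fun z => f g z)
    have h2 : AEStronglyMeasurable (fun z => f g z (p.2 z)) (haarQuot N) :=
      continuous_unitary_eval.comp_aestronglyMeasurable
        (h1.prodMk (Lp.aestronglyMeasurable p.2))
    exact (Lp.aestronglyMeasurable p.1).inner h2
  · refine .of_forall fun z => (norm_inner_le_norm _ _).trans ?_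
    rw [LinearIsometryEquiv.norm_map]
  · have h1 : Continuous fun g => f g z := hf.comp (Continuous.prodMk_left z)
    exact continuous_const.inner ((continuous_unitary_apply _).comp h1)

theorem isBorelCircle_one : IsBorelCircle (N := N) 1 := by
  let _ : MeasurableSpace G := borel G
  let _ : TopologicalSpace (LinftyCircle N) := weakTopologyCircle N
  let _ : MeasurableSpace (LinftyCircle N) := borel _
  exact measurable_const (a := (1 : LinftyCircle N))

/-- Triples with continuous unitary lifts are dualisable. -/
theorem Triple.isDualisable_of_isLiftedBy {S : Triple χ}
    {lamBar : Γ → G ⧸ N → UnitaryGp S.space} {muBar : G → G ⧸ N → UnitaryGp S.space}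
    {ψ : Γ → Γ → Coeff N} {φ : Γ → G → Coeff N} (h : S.on.IsLiftedBy lamBar muBar ψ φ) :
    S.IsDualisable := by
  have hc : ∀ g, AEStronglyMeasurable (muBar g) (haarQuot N) := fun g =>
    aestronglyMeasurable_of_continuous (h.continuous_muBar.comp (Continuous.prodMk_right g))
  refine ⟨fun g => AEEqFun.mk (muBar g) (hc g), 1,
    ⟨isBorelUnitary_of_continuous h.continuous_muBar, fun g => ?_⟩, fun g k => ?_,
    1, isBorelCircle_one, fun g k => ?_⟩
  · filter_upwards [AEEqFun.coeFn_mk (muBar g) (hc g)] with z hz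
    rw [hz, h.Ad_muBar]
  · have hk := (measurePreserving_mul_right (haarQuot N) (g : G ⧸ N)).quasiMeasurePreserving.ae
      (AEEqFun.coeFn_mk (muBar k) (hc k))
    filter_upwards [AEEqFun.coeFn_mk (muBar g) (hc g), hk,
      AEEqFun.coeFn_mk (muBar (g * k)) (hc (g * k)), AEEqFun.coeFn_one (α := G ⧸ N) (β := Circle)
        (μ := haarQuot N)] with z h1 h2 h3 h4
    change _ = _ * scalar _ ((1 : LinftyCircle N) z)
    rw [h1, h2, h3, h4, h.muBar_mul, Pi.one_apply, map_one, mul_one]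
  · have h1 := AEEqFun.coeFn_one (α := G ⧸ N) (β := Circle) (μ := haarQuot N)
    filter_upwards [h1, (measurePreserving_mul_right (haarQuot N)
      (g : G ⧸ N)).quasiMeasurePreserving.ae h1] with z h1 h2
    change (1 : LinftyCircle N) z = (1 : LinftyCircle N) (z * g) / (1 : LinftyCircle N) z *
      (1 : LinftyCircle N) z
    rw [h1, h2, Pi.one_apply, Pi.one_apply, div_one, one_mul]

end LiftedDualisable

/-! ### Monomial unitaries -/

section Monomial

variable {ι : Type u} [Fintype ι]

/-- The monomial unitary `f ↦ (d ↦ θ(d) f(τ⁻¹ d))`. -/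
def monomial (θ : ι → Circle) (τ : Equiv.Perm ι) : UnitaryGp (EuclideanSpace ℂ ι) :=
  (LinearIsometryEquiv.piLpCongrLeft 2 ℂ ℂ τ).trans
    (LinearIsometryEquiv.piLpCongrRight 2 fun d => scalar ℂ (θ d))

theorem monomial_apply (θ : ι → Circle) (τ : Equiv.Perm ι) (f : EuclideanSpace ℂ ι) (d : ι) :
    monomial θ τ f d = (θ d : ℂ) * f (τ.symm d) := rfl

theorem continuous_monomial {Y : Type*} [TopologicalSpace Y] {θ : Y → ι → Circle}
    (hθ : ∀ d, Continuous fun y => θ y d) (τ : Equiv.Perm ι) :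
    Continuous fun y => monomial (θ y) τ := by
  refine continuous_unitary_iff.mpr fun f => ?_
  have e : (fun y => monomial (θ y) τ f) =
      fun y => WithLp.toLp 2 fun d => (θ y d : ℂ) * f (τ.symm d) := by
    funext y
    ext d
    exact monomial_apply _ _ _ _
  rw [e]
  refine (PiLp.continuous_toLp 2 _).comp (continuous_pi fun d => ?_)
  exact ((continuous_circle_iff.mp (hθ d))).mul continuous_const

end Monomial

/-! ### Realising cohomology classes by twisted regular representations -/

section Surjectivity

variable {Γ G : Type u} [Group Γ] [CommGroup G] [TopologicalSpace G]
  [IsTopologicalGroup G] {N : Subgroup G} {χ : Γ →* G ⧸ N}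

namespace TripleOn

/-- Projective cocycles given by unitary lifts. -/
theorem exists_of_lifts {H : Type u} [NormedAddCommGroup H] [InnerProductSpace ℂ H]
    {lamBar : Γ → G ⧸ N → UnitaryGp H} {muBar : G → G ⧸ N → UnitaryGp H}
    {ψ : Γ → Γ → Coeff N} {φ : Γ → G → Coeff N}
    (hl : ∀ a, Continuous (lamBar a))
    (hm : Continuous fun p : G × (G ⧸ N) => muBar p.1 p.2)
    (h1 : ∀ (g h : G) z, muBar (g * h) z = muBar h (z * (g : G ⧸ N)) * muBar g z)
    (h2 : ∀ a b z, lamBar b (z * χ a) * lamBar a z = lamBar (b * a) z * scalar H (ψ a b z))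
    (h3 : ∀ a (g : G) z, lamBar a (z * (g : G ⧸ N)) * muBar g z =
      muBar g (z * χ a) * lamBar a z * scalar H (φ a g z)) :
    ∃ S : TripleOn χ H, S.IsLiftedBy lamBar muBar ψ φ :=
  ⟨{ lam := fun a z => Ad (lamBar a z)
     mu := fun g z => Ad (muBar g z)
     continuous_lam := fun a => Ad_isOpenQuotientMap.continuous.comp (hl a)
     continuous_mu := Ad_isOpenQuotientMap.continuous.comp hm
     lam_mul := fun b a z => by rw [← map_mul, h2, map_mul, Ad_scalar, mul_one]
     mu_mul := fun g h z => by rw [mul_comm g h, h1, map_mul]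
     lam_mu := fun a g z => by rw [← map_mul, h3, map_mul, Ad_scalar, mul_one, map_mul] },
    hl, hm, fun _ _ => rfl, fun _ _ => rfl, h1, h2, h3⟩

end TripleOn

open TripleOn

/-- Every total cocycle of the form `(ψ, φ, 1)` is realised by a twisted regular representation
of `Γ`. -/
theorem Triple.exists_isLiftedBy_of_mem_cocycles2 [LocallyCompactSpace G] [Finite Γ]
    {ψ : Γ → Γ → Coeff N} {φ : Γ → G → Coeff N} (h : (ψ, φ, 1) ∈ cocycles2 χ) :
    ∃ (S : Triple χ) (lamBar : _) (muBar : _), S.on.IsLiftedBy lamBar muBar ψ φ := by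
  have := Fintype.ofFinite Γ
  obtain ⟨⟨hφ, -⟩, hk⟩ := h
  have hk : totalBd2 χ (ψ, φ, 1) = 1 := hk
  have k1 : ∀ a b c z, ψ b c (z * χ a) * ψ a (c * b) z = ψ (b * a) c z * ψ a b z :=
    fun a b c z => by
      have e : ψ b c (z * χ a) / ψ (b * a) c z * ψ a (c * b) z / ψ a b z = 1 :=
        DFunLike.congr_fun (congrFun (congrFun (congrFun
          (congrArg (fun x : Fun3 Γ N => x.1) hk) a) b) c) z
      rw [div_mul_eq_mul_div, div_div, div_eq_one] at e
      exact e
  have k2 : ∀ a b (g : G) z, ψ a b (z * (g : G ⧸ N)) * φ (b * a) g z =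
      φ b g (z * χ a) * φ a g z * ψ a b z := fun a b g z => by
    have e : ψ a b (z * (g : G ⧸ N)) / ψ a b z /
        (φ b g (z * χ a) / φ (b * a) g z * φ a g z) = 1 :=
      DFunLike.congr_fun (congrFun (congrFun (congrFun
          (congrArg (fun x : Fun3 Γ N => x.2.1) hk) a) b) g) z
    rw [div_eq_one, div_mul_eq_mul_div, div_eq_div_iff_mul_eq_mul] at e
    exact e
  have k3 : ∀ a (g k : G) z, φ a (g * k) z = φ a k (z * (g : G ⧸ N)) * φ a g z :=
    fun a g k z => by
      have e : φ a k (z * (g : G ⧸ N)) / φ a (k * g) z * φ a g z * (1 / 1) = 1 :=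
        DFunLike.congr_fun (congrFun (congrFun (congrFun
          (congrArg (fun x : Fun3 Γ N => x.2.2.1) hk) a) g) k) z
      rw [div_one, mul_one, div_mul_eq_mul_div, div_eq_one] at e
      rw [e, mul_comm k g]
  have hφc : ∀ a, Continuous fun p : G × (G ⧸ N) => φ a p.1 p.2 := fun a =>
    ContinuousMap.continuous_uncurry_of_continuous ⟨φ a, hφ a⟩
  -- On basis vectors, `lamBar a z` sends `e_c` to `ψ(c, a, z * (χ c)⁻¹) e_{a * c}` and `muBar g z`
  -- scales `e_c` by the inverse of `φ(c, g, z * (χ c)⁻¹)`. The shift by `χ c` makes the required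
  -- relations instances of the cocycle identities with first argument `c`.
  let lamBar : Γ → G ⧸ N → UnitaryGp (EuclideanSpace ℂ Γ) := fun a z =>
    monomial (fun d => ψ (a⁻¹ * d) a (z * (χ (a⁻¹ * d))⁻¹)) (Equiv.mulLeft a)
  let muBar : G → G ⧸ N → UnitaryGp (EuclideanSpace ℂ Γ) := fun g z =>
    monomial (fun d => (φ d g (z * (χ d)⁻¹))⁻¹) (Equiv.refl Γ)
  have hl : ∀ a z f d, lamBar a z f d =
      (ψ (a⁻¹ * d) a (z * (χ (a⁻¹ * d))⁻¹) : ℂ) * f (a⁻¹ * d) := fun a z f d => rfl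
  have hm : ∀ g z f d, muBar g z f d =
      (((φ d g (z * (χ d)⁻¹))⁻¹ : Circle) : ℂ) * f d := fun g z f d => rfl
  obtain ⟨S, hS⟩ := exists_of_lifts (χ := χ) (lamBar := lamBar) (muBar := muBar) (ψ := ψ) (φ := φ)
    (fun a => continuous_monomial (fun d => (ψ _ a).continuous.comp (continuous_mul_const _)) _)
    (continuous_monomial (fun d => ((hφc d).comp
      (continuous_fst.prodMk (continuous_snd.mul continuous_const))).inv) _)
    (fun g k z => by
      ext f d
      change _ = muBar k (z * g) (muBar g z f) d
      rw [hm, hm, hm, k3, mul_inv_rev, Circle.coe_mul, mul_right_comm z]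
      ring)
    (fun a b z => by
      ext f d
      change lamBar b (z * χ a) (lamBar a z f) d = lamBar (b * a) z ((ψ a b z : ℂ) • f) d
      obtain ⟨c, rfl⟩ : ∃ c, d = b * a * c := ⟨(b * a)⁻¹ * d, by group⟩
      have e1 : b⁻¹ * (b * a * c) = a * c := by group
      have e2 : a⁻¹ * (a * c) = c := by group
      have e3 : (b * a)⁻¹ * (b * a * c) = c := by group
      rw [hl, hl, hl, e1, e2, e3, PiLp.smul_apply, smul_eq_mul, ← mul_assoc, ← mul_assoc,
        ← Circle.coe_mul, ← Circle.coe_mul]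
      have e4 := k1 c a b (z * (χ c)⁻¹)
      rw [inv_mul_cancel_right] at e4
      have e5 : z * χ a * (χ (a * c))⁻¹ = z * (χ c)⁻¹ := by
        rw [map_mul, mul_inv, mul_assoc, mul_inv_cancel_left]
      rw [e5, ← e4, mul_comm (ψ a b z)])
    (fun a g z => by
      ext f d
      change lamBar a (z * g) (muBar g z f) d = muBar g (z * χ a) (lamBar a z ((φ a g z : ℂ) • f)) d
      obtain ⟨c, rfl⟩ : ∃ c, d = a * c := ⟨a⁻¹ * d, by group⟩
      have e2 : a⁻¹ * (a * c) = c := by group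
      rw [hl, hm, hm, hl, e2, PiLp.smul_apply, smul_eq_mul, ← mul_assoc, ← mul_assoc, ← mul_assoc,
        ← Circle.coe_mul, ← Circle.coe_mul, ← Circle.coe_mul]
      have e4 := k2 c a g (z * (χ c)⁻¹)
      rw [inv_mul_cancel_right] at e4
      have e5 : z * χ a * (χ (a * c))⁻¹ = z * (χ c)⁻¹ := by
        rw [map_mul, mul_inv, mul_assoc, mul_inv_cancel_left]
      rw [e5, mul_right_comm z (g : G ⧸ N)]
      have e6 : ∀ {A B C D E : Circle}, A * B = C * D * E → A * D⁻¹ = B⁻¹ * E * C :=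
        fun {A B C D E} e => by
          rw [mul_inv_eq_iff_eq_mul, mul_assoc, mul_assoc, eq_inv_mul_iff_mul_eq, mul_comm, e]
          simp only [mul_comm, mul_left_comm]
      rw [e6 e4])
  exact ⟨{ space := EuclideanSpace ℂ Γ, on := S }, lamBar, muBar, hS⟩

/-- Boundaries of continuous functions `G → M_χ` are total cocycles. -/
theorem totalBd1_mem_cocycles2 [LocallyCompactSpace G] {m : G → Coeff N} (hm : Continuous m) :
    totalBd1 χ (1, m) ∈ cocycles2 χ := by
  have hs : ∀ t : G ⧸ N, Continuous (shift t : Coeff N → Coeff N) := fun t =>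
    ContinuousMap.continuous_precomp _
  have hsh : Continuous fun p : G × Coeff N => shiftG p.1 p.2 := by
    refine ContinuousMap.continuous_of_continuous_uncurry _ ?_
    change Continuous fun q : (G × Coeff N) × (G ⧸ N) => q.1.2 (q.2 * (q.1.1 : G ⧸ N))
    have h1 : Continuous fun q : (G × Coeff N) × (G ⧸ N) => (q.1.1 : G ⧸ N) :=
      continuous_quot_mk.comp (continuous_fst.comp continuous_fst)
    exact (continuous_snd.comp continuous_fst).eval (continuous_snd.mul h1)
  have hss : ∀ (s t : G ⧸ N) (f : Coeff N), shift s (shift t f) = shift (s * t) f := fun s t f => by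
    ext1 z
    exact congrArg f (mul_assoc _ _ _)
  refine ⟨⟨fun a => ?_, ?_⟩, ?_⟩
  · change Continuous fun g => bd0 shiftG (1 : Coeff N) g / (shift (χ a) (m g) / m g)
    simp only [bd0, map_one, div_one, one_div]
    exact (((hs _).comp hm).div' hm).inv
  · change Continuous fun p : G × G => shiftG p.1 (m p.2) / m (p.2 * p.1) * m p.1
    exact ((hsh.comp (continuous_fst.prodMk (hm.comp continuous_snd))).div'
      (hm.comp (continuous_snd.mul continuous_fst))).mul (hm.comp continuous_fst)
  · refine Prod.ext ?_ (Prod.ext ?_ (Prod.ext ?_ ?_))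
    · funext a b c
      simp [totalBd1, totalBd2, bd1, bd2]
    · funext a b g
      -- That the boundary squares to zero is a formal identity in the abelian coefficient group
      -- once composed shifts are merged; the zeros stand for the trivial `Γ`-component of the
      -- cochain.
      have e : ∀ {B : Type u} [AddCommGroup B] (x y z : B), 0 - 0 + 0 - (0 - 0 + 0) -
          (0 - 0 - (x - y) - (0 - 0 - (x - z)) + (0 - 0 - (y - z))) = 0 := fun x y z => by abel
      simp only [totalBd1, totalBd2, bd0, bd1, MonoidHom.coe_mk, OneHom.coe_mk, Pi.one_apply,
        map_one, map_div, shiftΓ, shiftG, hss, map_mul, mul_comm (χ b)]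
      exact e (B := Additive (Coeff N)) _ _ _
    · funext a g k
      have e : ∀ {B : Type u} [AddCommGroup B] (x y z u v w : B), 0 - 0 - (x - y) -
          (0 - 0 - (z - u)) + (0 - 0 - (v - w)) + (x - z + v - (y - u + w)) = 0 :=
        fun x y z u v w => by abel
      simp only [totalBd1, totalBd2, bd0, bd1, MonoidHom.coe_mk, OneHom.coe_mk, Pi.one_apply,
        map_one, map_div, shiftΓ, shiftG, hss, map_mul]
      rw [mul_comm (χ a)]
      exact e (B := Additive (Coeff N)) _ _ _ _ _ _
    · funext g k l
      have e : ∀ {B : Type u} [AddCommGroup B] (x y z u v w : B), x - y + z - (x - u + v) +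
          (y - u + w) - (z - v + w) = 0 := fun x y z u v w => by abel
      simp only [totalBd1, totalBd2, bd0, bd1, bd2, MonoidHom.coe_mk, OneHom.coe_mk, Pi.one_apply,
        map_one, map_div, shiftΓ, shiftG, hss, map_mul]
      rw [mul_comm (g : G ⧸ N), ← QuotientGroup.mk_mul, ← mul_assoc l k g]
      exact e (B := Additive (Coeff N)) (shift ((k * g : G) : G ⧸ N) (m l))
        (shift (g : G ⧸ N) (m (l * k))) (shift (g : G ⧸ N) (m k)) (m (l * k * g)) (m (k * g)) (m g)

/-- Every class in `H^{2,†}` is realised by a triple with continuous unitary lifts. -/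
theorem exists_isLiftedBy_of_mem_H2Dag [LocallyCompactSpace G] [Finite Γ] {x : H2 χ}
    (hx : x ∈ H2Dag χ) :
    ∃ (S : Triple χ) (lamBar : _) (muBar : _) (ψ : Γ → Γ → Coeff N) (φ : Γ → G → Coeff N),
      S.on.IsLiftedBy lamBar muBar ψ φ ∧
        ∃ h : (ψ, φ, 1) ∈ cocycles2 χ, (QuotientGroup.mk ⟨(ψ, φ, 1), h⟩ : H2 χ) = x := by
  obtain ⟨⟨⟨ψ, φ, ω⟩, hc⟩, rfl⟩ := QuotientGroup.mk_surjective x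
  obtain ⟨m, hm, hmω⟩ := (QuotientGroup.eq_one_iff _).mp hx
  have hmω : bd1 shiftG m = ω := hmω
  -- Since `ω` is the boundary of `m`, adding the total boundary of this cochain makes the last
  -- entry trivial and changes `ψ`, `φ` within the same class.
  let y : Fun1 Γ N := (1, m⁻¹)
  have hy : y ∈ cochains1 Γ N := Continuous.inv hm
  have hω : ω * bd1 shiftG m⁻¹ = 1 := by
    rw [← hmω, ← bd1_mul, mul_inv_cancel]
    funext a b
    simp [bd1]
  have he : (ψ, φ, ω) * totalBd1 χ y =
      (ψ * (totalBd1 χ y).1, φ * (totalBd1 χ y).2.1, 1) := Prod.ext rfl (Prod.ext rfl hω)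
  have hc' : (ψ * (totalBd1 χ y).1, φ * (totalBd1 χ y).2.1, 1) ∈ cocycles2 χ :=
    he ▸ mul_mem hc (totalBd1_mem_cocycles2 (Continuous.inv hm))
  obtain ⟨S, lamBar, muBar, hS⟩ := Triple.exists_isLiftedBy_of_mem_cocycles2 hc'
  refine ⟨S, lamBar, muBar, _, _, hS, hc', QuotientGroup.eq.mpr ⟨y⁻¹, inv_mem hy, ?_⟩⟩
  rw [map_inv, inv_eq_iff_mul_eq_one]
  change totalBd1 χ y * ((ψ * (totalBd1 χ y).1, φ * (totalBd1 χ y).2.1, 1)⁻¹ * (ψ, φ, ω)) = 1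
  rw [← he]
  group

end Surjectivity

/-! ### The bijection between triples and cohomology classes -/

section Classification

variable {Γ Γ' G : Type u} [Group Γ] [Group Γ'] [CommGroup G] [TopologicalSpace G]
  [IsTopologicalGroup G] [T2Space G] [LocallyCompactSpace G] [SecondCountableTopology G]
  {N : Subgroup G} [DiscreteTopology N] [CompactSpace (G ⧸ N)] {χ : Γ →* G ⧸ N}

open TripleOn

/-- The class `c` of triples contains a triple with continuous unitary lifts and associated
cohomology class `x`. -/
def HasClass (c : Dyn χ) (x : H2 χ) : Prop :=
  ∃ (S : Triple χ) (lamBar : _) (muBar : _) (ψ : Γ → Γ → Coeff N) (φ : Γ → G → Coeff N)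
    (h : (ψ, φ, 1) ∈ cocycles2 χ), S.on.IsLiftedBy lamBar muBar ψ φ ∧ S.cls = c ∧
      (QuotientGroup.mk ⟨(ψ, φ, 1), h⟩ : H2 χ) = x

theorem hasClass_of_isLiftedBy {S : Triple χ} {lamBar : Γ → G ⧸ N → UnitaryGp S.space}
    {muBar : G → G ⧸ N → UnitaryGp S.space} {ψ : Γ → Γ → Coeff N} {φ : Γ → G → Coeff N}
    (h : S.on.IsLiftedBy lamBar muBar ψ φ) :
    HasClass S.cls (QuotientGroup.mk ⟨(ψ, φ, 1), h.mem_cocycles2⟩ : H2 χ) :=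
  ⟨S, lamBar, muBar, ψ, φ, h.mem_cocycles2, h, rfl, rfl⟩

/-- This is invariance of the class: stably outer conjugate lifted triples have cocycles differing
by a boundary. -/
theorem HasClass.right_unique {c : Dyn χ} {x y : H2 χ} (hx : HasClass c x) (hy : HasClass c y) :
    x = y := by
  obtain ⟨S, _, _, _, _, _, hS, rfl, rfl⟩ := hx
  obtain ⟨T, _, _, _, _, _, hT, hc, rfl⟩ := hy
  obtain ⟨y, hy, e⟩ := (Triple.StablyOuterConj.symm (Quotient.exact hc)).exists_coboundary hS hT
  refine QuotientGroup.eq.mpr ⟨y, hy, ?_⟩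
  exact (inv_mul_eq_of_eq_mul e).symm

/-- This is injectivity: a boundary between the cocycles is absorbed by rescaling lifts, after which
the triples are stably outer conjugate. -/
theorem HasClass.left_unique {c d : Dyn χ} {x : H2 χ} (hc : HasClass c x) (hd : HasClass d x) :
    c = d := by
  obtain ⟨S, _, _, _, _, _, hS, rfl, rfl⟩ := hc
  obtain ⟨T, _, _, _, _, _, hT, rfl, hx⟩ := hd
  obtain ⟨y, hy, e⟩ := QuotientGroup.eq.mp hx.symm
  exact Quotient.sound (Triple.stablyOuterConj_of_coboundary hS hT hy
    (eq_mul_of_inv_mul_eq e.symm))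

theorem HasClass.mem_H2Dag {c : Dyn χ} {x : H2 χ} (h : HasClass c x) : x ∈ H2Dag χ := by
  obtain ⟨S, _, _, _, _, _, hS, rfl, rfl⟩ := h
  exact map_one (QuotientGroup.mk' ((coboundaries2G N).subgroupOf (cocycles2G N)))

theorem HasClass.exists_isDualisable {c : Dyn χ} {x : H2 χ} (h : HasClass c x) :
    ∃ S : Triple χ, S.IsDualisable ∧ S.cls = c := by
  obtain ⟨S, _, _, _, _, _, hS, hc, -⟩ := h
  exact ⟨S, Triple.isDualisable_of_isLiftedBy hS, hc⟩

theorem DynDag.exists_hasClass (c : DynDag χ) : ∃ x, HasClass c.1 x := by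
  obtain ⟨c, S, hS, rfl⟩ := c
  obtain ⟨T, hT, _, _, _, _, h⟩ := hS.exists_isLiftedBy
  have e : S.cls = T.cls := Quotient.sound hT
  exact ⟨_, e ▸ hasClass_of_isLiftedBy h⟩

theorem H2Dag.exists_hasClass [Finite Γ] {x : H2 χ} (hx : x ∈ H2Dag χ) : ∃ c, HasClass c x := by
  obtain ⟨S, _, _, _, _, hS, _, rfl⟩ := exists_isLiftedBy_of_mem_H2Dag hx
  exact ⟨_, hasClass_of_isLiftedBy hS⟩

/-- Both factors may be replaced by lifted representatives, and tensoring lifts multiplies their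
scalars. -/
theorem HasClass.tensor {S T : Triple χ} {x y : H2 χ} (hS : HasClass S.cls x)
    (hT : HasClass T.cls y) : HasClass (S.tensor T).cls (x * y) := by
  obtain ⟨S', _, _, _, _, _, hS', hc, rfl⟩ := hS
  obtain ⟨T', _, _, _, _, _, hT', hd, rfl⟩ := hT
  have e : (S'.tensor T').cls = (S.tensor T).cls :=
    Quotient.sound (Triple.StablyOuterConj.tensor (Quotient.exact hc) (Quotient.exact hd))
  rw [← e]
  have h : (S'.tensor T').on.IsLiftedBy _ _ _ _ := hS'.tensor hT'
  have h' := hasClass_of_isLiftedBy h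
  convert h' using 1
  refine congrArg QuotientGroup.mk (Subtype.ext ?_)
  exact Prod.ext rfl (Prod.ext rfl (one_mul 1))

theorem HasClass.pullback (f : Γ' →* Γ) {c : Dyn χ} {x : H2 χ} (h : HasClass c x) :
    HasClass (c.pullback f) (H2.pullback f χ x) := by
  obtain ⟨S, _, _, _, _, _, hS, rfl, rfl⟩ := h
  have h : (S.pullback f).on.IsLiftedBy _ _ _ _ := hS.pullback f
  exact hasClass_of_isLiftedBy h

variable [Finite Γ] [Finite Γ']

/-- The bijection between classes of dualisable triples and cohomology classes. -/
def dynDagEquiv (χ : Γ →* G ⧸ N) : DynDag χ ≃ H2Dag χ where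
  toFun c := ⟨c.exists_hasClass.choose, c.exists_hasClass.choose_spec.mem_H2Dag⟩
  invFun x := ⟨(H2Dag.exists_hasClass x.2).choose,
    (H2Dag.exists_hasClass x.2).choose_spec.exists_isDualisable⟩
  left_inv c := Subtype.ext ((H2Dag.exists_hasClass
    c.exists_hasClass.choose_spec.mem_H2Dag).choose_spec.left_unique c.exists_hasClass.choose_spec)
  right_inv x := Subtype.ext ((DynDag.exists_hasClass ⟨_, (H2Dag.exists_hasClass
    x.2).choose_spec.exists_isDualisable⟩).choose_spec.right_unique
      (H2Dag.exists_hasClass x.2).choose_spec)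

theorem hasClass_dynDagEquiv (c : DynDag χ) : HasClass c.1 (dynDagEquiv χ c : H2 χ) :=
  c.exists_hasClass.choose_spec

theorem dynDagEquiv_eq {c : DynDag χ} {x : H2Dag χ} (h : HasClass c.1 (x : H2 χ)) :
    dynDagEquiv χ c = x :=
  Subtype.ext ((hasClass_dynDagEquiv c).right_unique h)

end Classification

/-- The classification of dualisable dynamical triples. -/
theorem exists_dynDag_mulEquiv (G : Type u) [CommGroup G] [TopologicalSpace G]
    [IsTopologicalGroup G] [T2Space G] [LocallyCompactSpace G] [SecondCountableTopology G]
    (N : Subgroup G) [DiscreteTopology N] [CompactSpace (G ⧸ N)] :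
    ∃ grp : ∀ (Γ : Type u) [Group Γ] [Finite Γ] (χ : Γ →* G ⧸ N), CommGroup (DynDag χ),
      (∀ (Γ : Type u) [Group Γ] [Finite Γ] (χ : Γ →* G ⧸ N) (S T : Triple χ)
        (hS : S.IsDualisable) (hT : T.IsDualisable),
        letI := grp Γ χ
        (DynDag.mk S hS * DynDag.mk T hT).1 = (S.tensor T).cls) ∧
      ∃ Φ : ∀ (Γ : Type u) [Group Γ] [Finite Γ] (χ : Γ →* G ⧸ N),
          letI := grp Γ χ
          DynDag χ ≃* H2Dag χ,
        (∀ (Γ Γ' : Type u) [Group Γ] [Finite Γ] [Group Γ'] [Finite Γ'] (f : Γ' →* Γ)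
          (χ : Γ →* G ⧸ N) (c : DynDag χ),
          Φ Γ' (χ.comp f) (c.pullback f) = H2Dag.pullback f χ (Φ Γ χ c)) ∧
        (∀ (Γ : Type u) [Group Γ] [Finite Γ] (χ : Γ →* G ⧸ N) (S : Triple χ)
          (hS : S.IsDualisable) (lamBar : Γ → G ⧸ N → UnitaryGp S.space)
          (muBar : G → G ⧸ N → UnitaryGp S.space)
          (ψ : Γ → Γ → Coeff N) (φ : Γ → G → Coeff N),
          S.on.IsLiftedBy lamBar muBar ψ φ →
          ∃ h : (ψ, φ, 1) ∈ cocycles2 χ,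
            (Φ Γ χ (DynDag.mk S hS) : H2 χ) = QuotientGroup.mk ⟨(ψ, φ, 1), h⟩) := by
  -- The group structure is the one pulled back from cohomology, so multiplicativity is automatic
  -- and the content is that this product is the tensor product.
  refine ⟨fun Γ _ _ χ => (dynDagEquiv χ).commGroup, fun Γ _ _ χ S T hS hT => ?_,
    fun Γ _ _ χ => @Equiv.mulEquiv _ _ (dynDagEquiv χ) _, fun Γ Γ' _ _ _ _ f χ c => ?_,
    fun Γ _ _ χ S hS lamBar muBar ψ φ h => ⟨h.mem_cocycles2, ?_⟩⟩
  · have h := (hasClass_dynDagEquiv (DynDag.mk S hS)).tensor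
      (hasClass_dynDagEquiv (DynDag.mk T hT))
    have h' := hasClass_dynDagEquiv ((dynDagEquiv χ).symm
      (dynDagEquiv χ (DynDag.mk S hS) * dynDagEquiv χ (DynDag.mk T hT)))
    rw [Equiv.apply_symm_apply] at h'
    exact h'.left_unique h
  · exact dynDagEquiv_eq ((hasClass_dynDagEquiv c).pullback f)
  · exact (hasClass_dynDagEquiv (DynDag.mk S hS)).right_unique (hasClass_of_isLiftedBy h)

/-! ### The annihilator in the dual group -/

section DualGroup

variable {G : Type u} [CommGroup G] [TopologicalSpace G]

instance [IsTopologicalGroup G] [LocallyCompactSpace G] [SecondCountableTopology G] :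
    SecondCountableTopology (PontryaginDual G) :=
  (ContinuousMonoidHom.isInducing_toContinuousMap G Circle).secondCountableTopology

variable [IsTopologicalGroup G] [T2Space G] [LocallyCompactSpace G] [SecondCountableTopology G]
  (N : Subgroup G)

theorem continuous_dual_eval : Continuous fun p : PontryaginDual G × G => p.1 p.2 := by
  have h : Continuous fun p : (G →ₜ* Circle) × G => p.1 p.2 := continuous_eval
  exact h

/-- The annihilator of a cocompact subgroup is discrete. -/
theorem discreteTopology_annihilator [CompactSpace (G ⧸ N)] :
    DiscreteTopology (annihilator N) := by
  -- Characters trivial on `N` factor through the compact group `G ⧸ N`, whose dual is discrete; a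
  -- continuous injection into a discrete space forces discreteness.
  let F : annihilator N → PontryaginDual (G ⧸ N) := fun x =>
    { toMonoidHom := QuotientGroup.lift N (x.1 : G →ₜ* Circle).toMonoidHom fun n hn => x.2 n hn
      continuous_toFun := (map_continuous (x.1 : G →ₜ* Circle)).quotient_lift _ }
  have hF : ∀ x (g : G), F x g = x.1 g := fun _ _ => rfl
  refine DiscreteTopology.of_continuous_injective (f := F) ?_ fun x y hxy => ?_
  · refine ContinuousMonoidHom.continuous_of_continuous_uncurry _ ?_
    have h : IsOpenQuotientMap (Prod.map (id : annihilator N → annihilator N)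
        (QuotientGroup.mk : G → G ⧸ N)) :=
      IsOpenQuotientMap.id.prodMap QuotientGroup.isOpenQuotientMap_mk
    refine h.isQuotientMap.continuous_iff.mpr ?_
    exact continuous_dual_eval.comp
      ((continuous_subtype_val.comp continuous_fst).prodMk continuous_snd)
  · refine Subtype.ext (PontryaginDual.ext fun g => ?_)
    rw [← hF, ← hF, hxy]

/-- The annihilator of a discrete cocompact subgroup is cocompact. -/
theorem compactSpace_quotient_annihilator [DiscreteTopology N] [CompactSpace (G ⧸ N)] :
    CompactSpace (PontryaginDual G ⧸ annihilator N) := by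
  let i : N →ₜ* G := { toMonoidHom := N.subtype, continuous_toFun := continuous_subtype_val }
  let r : PontryaginDual G →ₜ* PontryaginDual N := PontryaginDual.map i
  have hr : ∀ x (n : N), r x n = x n := fun _ _ => rfl
  -- Surjectivity of restriction to `N` is the extension of characters; the dual of the discrete
  -- group `N` is compact.
  have hs : Function.Surjective r := fun κ => by
    obtain ⟨c, hc, hcκ⟩ := exists_extension_character (κ : N →ₜ* Circle).toMonoidHom
    let x : G →ₜ* Circle := { toMonoidHom := c, continuous_toFun := hc }
    exact ⟨x, PontryaginDual.ext hcκ⟩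
  -- By the open mapping theorem `r` is a quotient map, so the map `t` from the dual of `N` to the
  -- quotient by the annihilator is continuous although the section `s` is arbitrary.
  have ho : IsOpenMap r :=
    MonoidHom.isOpenMap_of_sigmaCompact r.toMonoidHom hs (map_continuous r)
  have hq : Topology.IsQuotientMap r := ho.isQuotientMap (map_continuous r) hs
  choose s hs' using hs
  let t : PontryaginDual N → PontryaginDual G ⧸ annihilator N := fun κ => s κ
  have ht : ∀ x, t (r x) = x := fun x => QuotientGroup.eq.mpr fun n hn => by
    have h : s (r x) n = x n := by
      rw [← hr _ ⟨n, hn⟩, hs', hr]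
    change (s (r x) n)⁻¹ * x n = 1
    rw [h, inv_mul_cancel]
  have htc : Continuous t := hq.continuous_iff.mpr (by
    have e : t ∘ r = QuotientGroup.mk := funext ht
    rw [e]
    exact continuous_quot_mk)
  have hts : Function.Surjective t := fun z => by
    obtain ⟨x, rfl⟩ := QuotientGroup.mk_surjective z
    exact ⟨r x, ht x⟩
  exact ⟨hts.range_eq ▸ isCompact_range htc⟩

end DualGroup

end

end EquivTriples

theorem mainTheorem1 (G : Type u) [CommGroup G] [TopologicalSpace G] [IsTopologicalGroup G]
    [T2Space G] [LocallyCompactSpace G] [SecondCountableTopology G]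
    (N : Subgroup G) [DiscreteTopology N] [CompactSpace (G ⧸ N)] :
    (∃ grp : ∀ (Γ : Type u) [Group Γ] [Finite Γ] (χ : Γ →* G ⧸ N), CommGroup (DynDag χ),
      (∀ (Γ : Type u) [Group Γ] [Finite Γ] (χ : Γ →* G ⧸ N) (S T : Triple χ)
        (hS : S.IsDualisable) (hT : T.IsDualisable),
        letI := grp Γ χ
        (DynDag.mk S hS * DynDag.mk T hT).1 = (S.tensor T).cls) ∧
      ∃ Φ : ∀ (Γ : Type u) [Group Γ] [Finite Γ] (χ : Γ →* G ⧸ N),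
          letI := grp Γ χ
          DynDag χ ≃* H2Dag χ,
        (∀ (Γ Γ' : Type u) [Group Γ] [Finite Γ] [Group Γ'] [Finite Γ'] (f : Γ' →* Γ)
          (χ : Γ →* G ⧸ N) (c : DynDag χ),
          Φ Γ' (χ.comp f) (c.pullback f) = H2Dag.pullback f χ (Φ Γ χ c)) ∧
        (∀ (Γ : Type u) [Group Γ] [Finite Γ] (χ : Γ →* G ⧸ N) (S : Triple χ)
          (hS : S.IsDualisable) (lamBar : Γ → G ⧸ N → UnitaryGp S.space)
          (muBar : G → G ⧸ N → UnitaryGp S.space)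
          (ψ : Γ → Γ → Coeff N) (φ : Γ → G → Coeff N),
          S.on.IsLiftedBy lamBar muBar ψ φ →
          ∃ h : (ψ, φ, 1) ∈ cocycles2 χ,
            (Φ Γ χ (DynDag.mk S hS) : H2 χ) = QuotientGroup.mk ⟨(ψ, φ, 1), h⟩)) ∧
    (∃ grp : ∀ (Γ : Type u) [Group Γ] [Finite Γ] (χ : Γ →* PontryaginDual G ⧸ annihilator N), CommGroup (DynDag χ),
      (∀ (Γ : Type u) [Group Γ] [Finite Γ] (χ : Γ →* PontryaginDual G ⧸ annihilator N) (S T : Triple χ)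
        (hS : S.IsDualisable) (hT : T.IsDualisable),
        letI := grp Γ χ
        (DynDag.mk S hS * DynDag.mk T hT).1 = (S.tensor T).cls) ∧
      ∃ Φ : ∀ (Γ : Type u) [Group Γ] [Finite Γ] (χ : Γ →* PontryaginDual G ⧸ annihilator N),
          letI := grp Γ χ
          DynDag χ ≃* H2Dag χ,
        (∀ (Γ Γ' : Type u) [Group Γ] [Finite Γ] [Group Γ'] [Finite Γ'] (f : Γ' →* Γ)
          (χ : Γ →* PontryaginDual G ⧸ annihilator N) (c : DynDag χ),
          Φ Γ' (χ.comp f) (c.pullback f) = H2Dag.pullback f χ (Φ Γ χ c)) ∧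
        (∀ (Γ : Type u) [Group Γ] [Finite Γ] (χ : Γ →* PontryaginDual G ⧸ annihilator N) (S : Triple χ)
          (hS : S.IsDualisable) (lamBar : Γ → PontryaginDual G ⧸ annihilator N → UnitaryGp S.space)
          (muBar : PontryaginDual G → PontryaginDual G ⧸ annihilator N → UnitaryGp S.space)
          (ψ : Γ → Γ → Coeff (annihilator N)) (φ : Γ → PontryaginDual G → Coeff (annihilator N)),
          S.on.IsLiftedBy lamBar muBar ψ φ →
          ∃ h : (ψ, φ, 1) ∈ cocycles2 χ,
            (Φ Γ χ (DynDag.mk S hS) : H2 χ) = QuotientGroup.mk ⟨(ψ, φ, 1), h⟩)) :=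
  have := discreteTopology_annihilator N
  have := compactSpace_quotient_annihilator N
  ⟨exists_dynDag_mulEquiv G N, exists_dynDag_mulEquiv (PontryaginDual G) (annihilator N)⟩
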